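/- For a probability law on $\mathbb{R}$ with mean $0$, variance $1$ and finite fourth moment, let $\kappa=\mathbb{E}[X^4]$ be its kurtosis, and for $0<\tau<1$ let its $\tau$-tail radius be the quantile $R_\tau=Q_{1-\tau/2}(X)$, where $Q_p(X)=\inf\{x:\ p\le \Pr(X\le x)\}$. (a) Generalised Gaussian. For $\beta>0$ let $X$ have density $p_\beta(x)=\frac{\beta}{2a\,\Gamma(1/\beta)}\exp(-|x/a|^\beta)$ with $a=a(\beta)=\sqrt{\Gamma(1/\beta)/\Gamma(3/\beta)}$. This is a standardised law (mean $0$, variance $1$, finite fourth moment) with kurtosis $$\kappa(\beta)=\frac{\Gamma(5/\beta)\,\Gamma(1/\beta)}{\Gamma(3/\beta)^2},$$ and $\kappa$ is strictly decreasing in $\beta\in(0,\infty)$. For every compact range of shapes $[b_1,b_2]\subset(0,\infty)$ there is a threshold $\tau^*>0$ such that, for every $\tau\in(0,\tau^*)$, $R_\tau$ is a strictly increasing function of $\kappa$ across the family $\beta\in[b_1,b_2]$. For the range $\beta\in[1/2,50]$ the threshold can be taken to satisfy $\tau^*>0.02$. (b) Student-$t$. For $\nu>4$ let $X=\sqrt{(\nu-2)/\nu}\;T$,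 where $T$ has the Student-$t$ law with $\nu$ degrees of freedom. This is a standardised law with kurtosis $\kappa(\nu)=3+\frac{6}{\nu-4}$, and $\kappa$ is strictly decreasing in $\nu\in(4,\infty)$. There is a threshold $\tau^*>0.02$ such that, for every $\tau\in(0,\tau^*)$, $R_\tau$ is a strictly increasing function of $\kappa$ across the whole family $\nu\in(4,\infty)$. -/

import Mathlib

open MeasureTheory ProbabilityTheory Set

noncomputable section

/-- The `p`-quantile of a law on the real line: the least `x` with `p ≤ μ (-∞, x]`. -/
def quantile (μ : Measure ℝ) (p : ℝ) : ℝ := sInf {x : ℝ | p ≤ cdf μ x}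

/-- The `τ`-tail radius of a law on the real line: its quantile of level `1 - τ / 2`. -/
def tailRadius (μ : Measure ℝ) (τ : ℝ) : ℝ := quantile μ (1 - τ / 2)

/-- Pearson kurtosis: the fourth central moment divided by the squared variance (for a law with
mean zero and variance one, this is the fourth moment). -/
def kurtosis (μ : Measure ℝ) : ℝ := centralMoment id 4 μ / (variance id μ) ^ 2

/-- `μ` is a probability law with finite fourth moment, mean zero and variance one. -/
structure IsStandardised (μ : Measure ℝ) : Prop where
  isProbabilityMeasure : IsProbabilityMeasure μ
  memLp : MemLp id 4 μ
  mean_eq : ∫ x, x ∂μ = 0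
  variance_eq : variance id μ = 1

/-- The generalised Gaussian density with shape `β` and scale `a`, proportional to
`exp (-|x / a| ^ β)`. -/
def ggdPDF (β a x : ℝ) : ℝ :=
  β / (2 * a * Real.Gamma (1 / β)) * Real.exp (-(|x / a| ^ β))

/-- The scale for which the generalised Gaussian of shape `β` has unit variance. -/
def ggdScale (β : ℝ) : ℝ := Real.sqrt (Real.Gamma (1 / β) / Real.Gamma (3 / β))

/-- The unit-variance generalised Gaussian law of shape `β`. -/
def ggdLaw (β : ℝ) : Measure ℝ :=
  volume.withDensity fun x => ENNReal.ofReal (ggdPDF β (ggdScale β) x)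

/-- The density of the Student-t distribution with `ν` degrees of freedom. -/
def studentPDF (ν x : ℝ) : ℝ :=
  Real.Gamma ((ν + 1) / 2) / (Real.sqrt (ν * Real.pi) * Real.Gamma (ν / 2)) *
    (1 + x ^ 2 / ν) ^ (-((ν + 1) / 2))

/-- The Student-t law with `ν` degrees of freedom (location zero, scale one). -/
def studentLaw (ν : ℝ) : Measure ℝ :=
  volume.withDensity fun x => ENNReal.ofReal (studentPDF ν x)

/-- The standardised Student-t law: the law of `√((ν - 2) / ν) * T`, where `T` has the Student-t law
with `ν` degrees of freedom. -/
def stdStudentLaw (ν : ℝ) : Measure ℝ :=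
  (studentLaw ν).map fun x => Real.sqrt ((ν - 2) / ν) * x

/-- In the family of laws `(P s)` indexed by the shape parameters `s ∈ S`, the `τ`-tail radius is a
strictly increasing function of the kurtosis. -/
def TailRadiusStrictMonoInKurtosis (P : ℝ → Measure ℝ) (S : Set ℝ) (τ : ℝ) : Prop :=
  ∃ g : ℝ → ℝ, StrictMonoOn g ((fun s => kurtosis (P s)) '' S) ∧
    ∀ s ∈ S, tailRadius (P s) τ = g (kurtosis (P s))

end

open Filter Topology Asymptotics

/-! In both families the kurtosis strictly decreases in the shape, so it is enough that the tail
radius strictly decreases too (`tailRadiusStrictMonoInKurtosis_of_strictAntiOn`). The radius is the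
point where a continuous strictly decreasing tail equals `τ / 2`. Hence two radii are compared by
looking at one point: at the radius `x` of the lighter law, the heavier law must have the larger
tail (`HasTail.lt_tailRadius`).

Keep `x` fixed and move the shape from the lighter to the heavier law. The derivative of the tail
along this path is a positive multiple of a core function (`ggdCore`, `studentCore`) of a rescaled
point. The core need not have one sign, but it vanishes at both ends of its range, and its
derivative is a positive weight times a concave function. By `pos_of_hasDerivAt_mul_concaveOn` it
therefore stays positive once it has become positive on the way outward. So for each shape a single
test point with positive core settles the sign everywhere further out.

If the tail at every test point is at least a common level `σ`, then a tail below `σ` forces `x`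
beyond the test point, where the tail is increasing in the shape parameter. A path that starts below
`σ` then ends strictly above its start (`lt_of_deriv_pos_of_lt`). This makes `2 * σ` an admissible
threshold.

On a compact range of generalised Gaussian shapes one far test point works for all shapes, by
compactness. For the threshold `0.0202` the test points are explicit. Each has to lie far enough out
for a positive core and far enough in for a tail of at least `0.0101`. Both requirements reduce to
rational inequalities through sharp digamma bounds (`digamma_add_one_ge`, `digamma_add_one_le`,
`digamma_add_half_sub_le`) and elementary lower bounds for the incomplete Gamma and Beta functions.
-/

/-! ### Tails, quantiles and moments of laws with even densities -/

/-- `T` is the upper tail function `x ↦ μ (x, ∞)` on `[0, ∞)` of a law with a continuous,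
strictly decreasing upper tail and median zero. -/
structure HasTail (μ : Measure ℝ) (T : ℝ → ℝ) : Prop where
  isProbabilityMeasure : IsProbabilityMeasure μ
  cdf_eq : ∀ x, 0 ≤ x → cdf μ x = 1 - T x
  continuousOn : ContinuousOn T (Ici 0)
  strictAntiOn : StrictAntiOn T (Ici 0)
  map_zero : T 0 = 1 / 2
  tendsto : Tendsto T atTop (𝓝 0)

namespace HasTail

variable {μ : Measure ℝ} {T : ℝ → ℝ} {τ : ℝ}

theorem exists_eq (h : HasTail μ T) (hτ : τ ∈ Ioo (0 : ℝ) 1) : ∃ R, 0 < R ∧ T R = τ / 2 := by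
  obtain ⟨h0, h1⟩ := hτ
  obtain ⟨b, hb0, hb⟩ : ∃ b, 0 ≤ b ∧ T b < τ / 2 :=
    ((eventually_ge_atTop 0).and (h.tendsto.eventually (gt_mem_nhds (half_pos h0)))).exists
  have hsub := intermediate_value_Icc' hb0 (h.continuousOn.mono Icc_subset_Ici_self)
  obtain ⟨R, hR, hTR⟩ := hsub ⟨hb.le, by rw [h.map_zero]; linarith⟩
  refine ⟨R, lt_of_le_of_ne hR.1 ?_, hTR⟩
  rintro rfl
  rw [h.map_zero] at hTR
  linarith

theorem tailRadius_eq (h : HasTail μ T) (hτ : τ < 1) {R : ℝ} (hR : 0 ≤ R)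
    (hTR : T R = τ / 2) : tailRadius μ τ = R := by
  have : {x : ℝ | 1 - τ / 2 ≤ cdf μ x} = Ici R := by
    ext x
    simp only [mem_ofPred_eq, mem_Ici]
    rcases le_or_gt 0 x with hx | hx
    · rw [h.cdf_eq x hx, ← hTR, sub_le_sub_iff_left]
      exact h.strictAntiOn.le_iff_ge hx hR
    -- To the left of the median the cdf is at most `1 / 2`, which is below `1 - τ / 2` since `τ <
    -- 1`.
    · have h1 := monotone_cdf μ hx.le
      rw [h.cdf_eq 0 le_rfl, h.map_zero] at h1
      exact ⟨fun h2 => by linarith, fun h2 => by linarith⟩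
  rw [tailRadius, quantile, this, csInf_Ici]

theorem tailRadius_pos (h : HasTail μ T) (hτ : τ ∈ Ioo (0 : ℝ) 1) : 0 < tailRadius μ τ := by
  obtain ⟨R, hR, hTR⟩ := h.exists_eq hτ
  rwa [h.tailRadius_eq hτ.2 hR.le hTR]

theorem apply_tailRadius (h : HasTail μ T) (hτ : τ ∈ Ioo (0 : ℝ) 1) :
    T (tailRadius μ τ) = τ / 2 := by
  obtain ⟨R, hR, hTR⟩ := h.exists_eq hτ
  rwa [h.tailRadius_eq hτ.2 hR.le hTR]

/-- This turns a comparison of quantiles of two laws into a comparison of their tails at a single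
point. -/
theorem lt_tailRadius (h : HasTail μ T) (hτ : τ ∈ Ioo (0 : ℝ) 1) {x : ℝ} (hx : 0 ≤ x)
    (hTx : τ / 2 < T x) : x < tailRadius μ τ := by
  rw [← h.apply_tailRadius hτ] at hTx
  exact (h.strictAntiOn.lt_iff_gt (h.tailRadius_pos hτ).le hx).1 hTx

theorem map_const_mul (h : HasTail μ T) {c : ℝ} (hc : 0 < c) :
    HasTail (μ.map fun x => c * x) fun x => T (x / c) := by
  have := h.isProbabilityMeasure
  have hm : Measurable fun x : ℝ => c * x := measurable_const_mul c
  have hp : IsProbabilityMeasure (μ.map fun x => c * x) :=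
    Measure.isProbabilityMeasure_map hm.aemeasurable
  have hmaps : MapsTo (fun x => x / c) (Ici 0) (Ici 0) := fun x hx => div_nonneg hx hc.le
  refine ⟨hp, fun x hx => ?_, ?_, ?_, by simp [h.map_zero], ?_⟩
  · rw [← h.cdf_eq _ (div_nonneg hx hc.le), cdf_eq_real, cdf_eq_real, measureReal_def,
      measureReal_def, Measure.map_apply hm measurableSet_Iic]
    congr 2
    ext y
    simp [le_div_iff₀' hc]
  · exact h.continuousOn.comp (by fun_prop) hmaps
  · exact fun x hx y hy hxy => h.strictAntiOn (hmaps hx) (hmaps hy)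
      (div_lt_div_of_pos_right hxy hc)
  · exact h.tendsto.comp (tendsto_id.atTop_div_const hc)

end HasTail

/-- An even nonnegative function with a given antiderivative on the half-line. -/
theorem integrable_and_integral_of_even {g U : ℝ → ℝ} (heven : ∀ x, g |x| = g x)
    (hg : ∀ x, 0 < x → 0 ≤ g x) (hU : ∀ x, 0 < x → HasDerivAt U (-g x) x)
    (hU0 : ContinuousWithinAt U (Ici 0) 0) (hlim : Tendsto U atTop (𝓝 0)) :
    Integrable g ∧ ∫ x, g x = 2 * U 0 := by
  have hneg : ∀ x ∈ Ioi (0 : ℝ), -g x ≤ 0 := fun x hx => neg_nonpos.2 (hg x hx)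
  have hint : IntegrableOn g (Ioi 0) := by
    have := (integrableOn_Ioi_deriv_of_nonpos hU0 hU hneg hlim).neg
    simpa only [Pi.neg_def, neg_neg] using this
  have hval : ∫ x in Ioi 0, g x = U 0 := by
    have := integral_Ioi_of_hasDerivAt_of_nonpos hU0 hU hneg hlim
    rw [integral_neg] at this
    linarith
  refine ⟨?_, ?_⟩
  · rw [← integrableOn_univ, ← Iic_union_Ioi (a := (0 : ℝ)), integrableOn_union]
    refine ⟨?_, hint⟩
    have h1 : IntegrableOn (fun x => g (-x)) (Iio 0) :=
      IntegrableOn.comp_neg_Iio (c := 0) (by rwa [neg_zero])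
    rw [integrableOn_Iic_iff_integrableOn_Iio]
    refine h1.congr_fun (fun x _ => ?_) measurableSet_Iio
    change g (-x) = g x
    rw [← heven (-x), abs_neg, heven]
  · have h1 := integral_comp_abs (f := g)
    simp only [heven] at h1
    rw [h1, hval]

/-- A law with an even density, positive on the half-line, whose tail is `T`. -/
theorem hasTail_withDensity {f T : ℝ → ℝ} (heven : ∀ x, f |x| = f x)
    (hf : ∀ x, 0 < x → 0 < f x) (hf0 : 0 ≤ f 0) (hT : ∀ x, 0 < x → HasDerivAt T (-f x) x)
    (hT0 : ContinuousWithinAt T (Ici 0) 0) (hlim : Tendsto T atTop (𝓝 0)) (h0 : T 0 = 1 / 2) :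
    HasTail (volume.withDensity fun x => ENNReal.ofReal (f x)) T := by
  obtain ⟨hint, hval⟩ := integrable_and_integral_of_even heven (fun x hx => (hf x hx).le) hT hT0 hlim
  have hnn : ∀ x, 0 ≤ f x := fun x => by
    rw [← heven x]
    rcases (abs_nonneg x).eq_or_lt with h | h
    · rwa [← h]
    · exact (hf _ h).le
  have hp : IsProbabilityMeasure (volume.withDensity fun x => ENNReal.ofReal (f x)) := by
    constructor
    rw [withDensity_apply _ MeasurableSet.univ, Measure.restrict_univ,
      ← ofReal_integral_eq_lintegral_ofReal hint (ae_of_all _ hnn), hval, h0]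
    norm_num
  have hcont : ContinuousOn T (Ici 0) := by
    intro x hx
    rcases (mem_Ici.1 hx).eq_or_lt with h | h
    · rwa [← h]
    · exact (hT x h).continuousAt.continuousWithinAt
  refine ⟨hp, fun x hx => ?_, hcont, ?_, h0, hlim⟩
  · have hcx : ContinuousWithinAt T (Ici x) x := (hcont x hx).mono (Ici_subset_Ici.2 hx)
    have hd : ∀ y ∈ Ioi x, HasDerivAt T (-f y) y := fun y hy => hT y (hx.trans_lt hy)
    have hval : ∫ y in Ioi x, f y = T x := by
      have := integral_Ioi_of_hasDerivAt_of_nonpos hcx hd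
        (fun y _ => neg_nonpos.2 (hnn y)) hlim
      rw [integral_neg] at this
      linarith
    have hmeas : (volume.withDensity fun x => ENNReal.ofReal (f x)).real (Ioi x) = T x := by
      rw [measureReal_def, withDensity_apply _ measurableSet_Ioi,
        ← ofReal_integral_eq_lintegral_ofReal hint.integrableOn (ae_of_all _ hnn), hval,
        ENNReal.toReal_ofReal]
      rw [← hval]
      exact setIntegral_nonneg measurableSet_Ioi fun y _ => hnn y
    rw [cdf_eq_real, ← compl_Ioi, probReal_compl_eq_one_sub measurableSet_Ioi, hmeas]
  · refine strictAntiOn_of_deriv_neg (convex_Ici 0) hcont fun x hx => ?_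
    rw [interior_Ici] at hx
    rw [(hT x hx).deriv]
    exact neg_lt_zero.2 (hf x hx)

/-- The moment of order `n` of a law with a density. -/
theorem integral_pow_withDensity {f : ℝ → ℝ} (hm : Measurable f) (hf : ∀ x, 0 ≤ f x) (n : ℕ) :
    ∫ x, x ^ n ∂(volume.withDensity fun x => ENNReal.ofReal (f x)) = ∫ x, f x * x ^ n := by
  rw [integral_withDensity_eq_integral_toReal_smul (by fun_prop) (by simp)]
  simp [ENNReal.toReal_ofReal (hf _)]

theorem integrable_pow_withDensity {f : ℝ → ℝ} (hm : Measurable f) (hf : ∀ x, 0 ≤ f x) (n : ℕ)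
    (h : Integrable fun x => f x * x ^ n) :
    Integrable (fun x => x ^ n) (volume.withDensity fun x => ENNReal.ofReal (f x)) := by
  rw [integrable_withDensity_iff_integrable_smul' (by fun_prop) (by simp)]
  simpa [ENNReal.toReal_ofReal (hf _)] using h

theorem integral_pow_one_withDensity {f : ℝ → ℝ} (hm : Measurable f) (heven : ∀ x, f |x| = f x)
    (hf : ∀ x, 0 ≤ f x) :
    ∫ x, x ∂(volume.withDensity fun x => ENNReal.ofReal (f x)) = 0 := by
  have h1 := integral_pow_withDensity hm hf 1
  simp only [pow_one] at h1
  have h2 := integral_neg_eq_self (fun x => f x * x) volume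
  have h3 : ∀ x, f (-x) * -x = -(f x * x) := fun x => by
    rw [← heven (-x), abs_neg, heven]; ring
  simp only [h3, integral_neg] at h2
  linarith

theorem isStandardised_and_kurtosis_eq {μ : Measure ℝ} (hμ : IsProbabilityMeasure μ) {κ : ℝ}
    (h4 : Integrable (fun x => x ^ 4) μ) (e1 : ∫ x, x ∂μ = 0) (e2 : ∫ x, x ^ 2 ∂μ = 1)
    (e4 : ∫ x, x ^ 4 ∂μ = κ) : IsStandardised μ ∧ kurtosis μ = κ := by
  have hv : variance id μ = 1 := by
    rw [variance_of_integral_eq_zero aemeasurable_id e1, ← e2]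
    rfl
  refine ⟨⟨hμ, ?_, e1, hv⟩, ?_⟩
  · rw [← integrable_norm_rpow_iff aestronglyMeasurable_id (by norm_num) (by norm_num)]
    refine h4.congr (ae_of_all _ fun x => ?_)
    have : (4 : ENNReal).toReal = ((4 : ℕ) : ℝ) := by norm_num
    simp only [id, Real.norm_eq_abs]
    rw [this, Real.rpow_natCast, ← abs_pow, abs_of_nonneg (by positivity)]
  · rw [kurtosis, hv, centralMoment]
    simp only [id, e1]
    simpa using e4

/-- A strictly monotone kurtosis can be inverted on `S`; composing the radius with this inverse
gives `g`, and the two order reversals cancel. -/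
theorem tailRadiusStrictMonoInKurtosis_of_strictAntiOn {P : ℝ → Measure ℝ} {S : Set ℝ} {τ : ℝ}
    (hκ : StrictAntiOn (fun s => kurtosis (P s)) S)
    (hR : StrictAntiOn (fun s => tailRadius (P s) τ) S) :
    TailRadiusStrictMonoInKurtosis P S τ := by
  have hinv : ∀ s ∈ S, Function.invFunOn (fun s => kurtosis (P s)) S (kurtosis (P s)) = s :=
    fun s hs => hκ.injOn.leftInvOn_invFunOn hs
  refine ⟨fun k => tailRadius (P (Function.invFunOn (fun s => kurtosis (P s)) S k)) τ, ?_, ?_⟩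
  · rintro _ ⟨s, hs, rfl⟩ _ ⟨s', hs', rfl⟩ hlt
    simp only [hinv s hs, hinv s' hs']
    exact hR hs' hs ((hκ.lt_iff_gt hs hs').1 hlt)
  · intro s hs
    simp only [hinv s hs]

/-- A function that increases whenever it is below the level `σ` never returns to a level below
`σ`. -/
theorem lt_of_deriv_pos_of_lt {h h' : ℝ → ℝ} {a b σ : ℝ} (hab : a < b)
    (hd : ∀ t ∈ Icc a b, HasDerivAt h (h' t) t) (ha : h a < σ)
    (hpos : ∀ t ∈ Icc a b, h t < σ → 0 < h' t) : h a < h b := by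
  by_contra! hb
  have hc : ContinuousOn h (Icc a b) := fun t ht => (hd t ht).continuousAt.continuousWithinAt
  -- If `h b ≤ h a`, the minimum is attained at some `c > a`: a minimum at `a` is also one at `b`.
  -- There `h c ≤ h a < σ`, so the derivative at `c` is positive and `h` is smaller just to the left
  -- of `c`, a contradiction.
  have key : ∃ c ∈ Ioc a b, ∀ t ∈ Icc a b, h c ≤ h t := by
    obtain ⟨c, hc1, hc2⟩ := isCompact_Icc.exists_isMinOn (nonempty_Icc.2 hab.le) hc
    rcases hc1.1.eq_or_lt with h1 | h1
    · exact ⟨b, ⟨hab, le_rfl⟩, fun t ht => hb.trans (h1 ▸ hc2 ht)⟩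
    · exact ⟨c, ⟨h1, hc1.2⟩, fun t ht => hc2 ht⟩
  obtain ⟨c, hc1, hc2⟩ := key
  have hcI : c ∈ Icc a b := ⟨hc1.1.le, hc1.2⟩
  have hp := hpos c hcI ((hc2 a ⟨le_rfl, hab.le⟩).trans_lt ha)
  have hder := hd c hcI
  have hev : ∀ᶠ t in 𝓝[<] c, h t < h c := by
    have := hder.hasDerivWithinAt (s := Iio c)
    rw [hasDerivWithinAt_iff_tendsto_slope' (by simp)] at this
    filter_upwards [this.eventually (lt_mem_nhds hp), self_mem_nhdsWithin] with t ht htc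
    rw [slope_def_field] at ht
    have htc' : t - c < 0 := sub_neg.2 htc
    have := mul_neg_of_pos_of_neg ht htc'
    rw [div_mul_cancel₀ _ htc'.ne] at this
    linarith
  have hev2 : ∀ᶠ t in 𝓝[<] c, t ∈ Ioo a c := Ioo_mem_nhdsLT hc1.1
  obtain ⟨t, ht1, ht2⟩ := (hev.and hev2).exists
  exact absurd (hc2 t ⟨ht2.1.le, ht2.2.le.trans hc1.2⟩) (not_le.2 ht1)

/-! ### Bounds for the digamma function, Gamma ratios and logarithms -/

/-- The real digamma function. -/
noncomputable def digamma (s : ℝ) : ℝ := deriv Real.Gamma s / Real.Gamma s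

theorem hasDerivAt_Gamma_digamma {s : ℝ} (hs : 0 < s) :
    HasDerivAt Real.Gamma (Real.Gamma s * digamma s) s := by
  have h : DifferentiableAt ℝ Real.Gamma s := by
    refine Real.differentiableAt_Gamma fun m => ?_
    have : (0 : ℝ) ≤ m := m.cast_nonneg
    linarith
  rw [digamma, mul_div_cancel₀ _ (Real.Gamma_pos_of_pos hs).ne']
  exact h.hasDerivAt

theorem hasDerivAt_log_Gamma {s : ℝ} (hs : 0 < s) :
    HasDerivAt (Real.log ∘ Real.Gamma) (digamma s) s := by
  have h := (hasDerivAt_Gamma_digamma hs).log (Real.Gamma_pos_of_pos hs).ne'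
  rwa [mul_div_cancel_left₀ _ (Real.Gamma_pos_of_pos hs).ne'] at h

theorem digamma_add_one {s : ℝ} (hs : 0 < s) : digamma (s + 1) = digamma s + 1 / s := by
  have h1 : HasDerivAt (fun x => Real.log (Real.Gamma (x + 1))) (digamma (s + 1)) s :=
    (hasDerivAt_log_Gamma (by linarith : 0 < s + 1)).comp_add_const s 1
  have h2 : HasDerivAt (fun x => Real.log (Real.Gamma (x + 1))) (1 / s + digamma s) s := by
    refine (((hasDerivAt_id s).log hs.ne').add (hasDerivAt_log_Gamma hs)).congr_of_eventuallyEq ?_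
    filter_upwards [lt_mem_nhds hs] with x hx
    simp only [Pi.add_apply, id, Function.comp]
    rw [Real.Gamma_add_one hx.ne', Real.log_mul hx.ne' (Real.Gamma_pos_of_pos hx).ne']
  rw [h1.unique h2, add_comm]

theorem monotoneOn_digamma : MonotoneOn digamma (Ioi 0) := by
  have h := Real.convexOn_log_Gamma.monotoneOn_deriv
    (fun x hx => (hasDerivAt_log_Gamma hx).differentiableAt)
  intro x hx y hy hxy
  have := h hx hy hxy
  rwa [(hasDerivAt_log_Gamma hx).deriv, (hasDerivAt_log_Gamma hy).deriv] at this

/-- By convexity of `log Γ`, this chord slope separates the derivatives at its ends, so `log s` lies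
between `digamma s` and `digamma (s + 1)`. -/
theorem slope_log_Gamma {s : ℝ} (hs : 0 < s) :
    slope (Real.log ∘ Real.Gamma) s (s + 1) = Real.log s := by
  rw [slope_def_field]
  simp only [Function.comp]
  rw [Real.Gamma_add_one hs.ne', Real.log_mul hs.ne' (Real.Gamma_pos_of_pos hs).ne']
  ring

theorem digamma_le_log {s : ℝ} (hs : 0 < s) : digamma s ≤ Real.log s := by
  rw [← slope_log_Gamma hs]
  exact Real.convexOn_log_Gamma.le_slope_of_hasDerivAt (mem_Ioi.2 hs) (mem_Ioi.2 (by linarith))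
    (by linarith) (hasDerivAt_log_Gamma hs)

theorem log_le_digamma_add_one {s : ℝ} (hs : 0 < s) : Real.log s ≤ digamma (s + 1) := by
  rw [← slope_log_Gamma hs]
  exact Real.convexOn_log_Gamma.slope_le_of_hasDerivAt (mem_Ioi.2 hs) (mem_Ioi.2 (by linarith))
    (by linarith) (hasDerivAt_log_Gamma (by linarith : 0 < s + 1))

theorem tendsto_digamma_sub_log :
    Tendsto (fun s => digamma (s + 1) - Real.log s) atTop (𝓝 0) := by
  have h : Tendsto (fun s : ℝ => 1 / s) atTop (𝓝 0) := by
    exact tendsto_const_nhds.div_atTop tendsto_id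
  refine tendsto_of_tendsto_of_tendsto_of_le_of_le' tendsto_const_nhds h ?_ ?_
  · filter_upwards [eventually_gt_atTop 0] with s hs
    linarith [log_le_digamma_add_one hs]
  · filter_upwards [eventually_gt_atTop 0] with s hs
    rw [digamma_add_one hs]
    linarith [digamma_le_log hs]

/-- A function that increases along unit steps and is eventually below a function with limit `l`
is bounded above by `l`. -/
theorem le_of_step_le_of_le_of_tendsto {φ G : ℝ → ℝ} {s l : ℝ}
    (hstep : ∀ t, s ≤ t → φ t ≤ φ (t + 1)) (hG : ∀ t, s ≤ t → φ t ≤ G t)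
    (hlim : Tendsto G atTop (𝓝 l)) : φ s ≤ l := by
  have h1 : ∀ n : ℕ, φ s ≤ φ (s + n) := by
    intro n
    induction n with
    | zero => simp
    | succ n ih =>
      refine ih.trans ((hstep (s + n) (by simp)).trans_eq ?_)
      push_cast
      ring_nf
  have h2 : Tendsto (fun n : ℕ => G (s + n)) atTop (𝓝 l) :=
    hlim.comp (tendsto_atTop_add_const_left _ _ tendsto_natCast_atTop_atTop)
  exact ge_of_tendsto' h2 fun n => (h1 n).trans (hG _ (by simp))

theorem le_of_step_le_of_tendsto {φ : ℝ → ℝ} {s l : ℝ} (hstep : ∀ t, s ≤ t → φ t ≤ φ (t + 1))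
    (hlim : Tendsto φ atTop (𝓝 l)) : φ s ≤ l :=
  le_of_step_le_of_le_of_tendsto hstep (fun _ _ => le_rfl) hlim

/-- The series is `log (1 + 1 / s) = 2 artanh (1 / (2 s + 1))`; its terms are positive, so every
partial sum is a lower bound. -/
theorem log_one_add_inv_ge {s : ℝ} (hs : 0 < s) (n : ℕ) :
    ∑ k ∈ Finset.range n, 2 * (1 / (2 * (k : ℝ) + 1)) * (1 / (2 * s + 1)) ^ (2 * k + 1) ≤
      Real.log (1 + 1 / s) := by
  have h := Real.hasSum_log_one_add_inv hs
  rw [one_div s]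
  exact sum_le_hasSum _ (fun k _ => by positivity) h

theorem log_one_add_inv_le {s z : ℝ} (hs : 0 < s) (hz : z = 1 / (2 * s + 1)) :
    Real.log (1 + 1 / s) ≤ 2 * z + 2 / 3 * z ^ 3 + 2 / 5 * (z ^ 5 / (1 - z ^ 2)) := by
  have hz0 : 0 < z := by rw [hz]; positivity
  have hz1 : z < 1 := by rw [hz, div_lt_one (by positivity)]; linarith
  have hz2 : z ^ 2 < 1 := by nlinarith
  have h := Real.hasSum_log_one_add_inv hs
  rw [← hz] at h
  -- From the third term on, the artanh coefficients are at most `2 / 5`, which gives a geometric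
  -- majorant. The two point masses below restore the exact first coefficients: `2 = 2/5 + 8/5` and
  -- `2/3 = 2/5 + 4/15`.
  have hg : HasSum (fun k : ℕ => 2 / 5 * z * (z ^ 2) ^ k) (2 / 5 * z * (1 - z ^ 2)⁻¹) :=
    (hasSum_geometric_of_lt_one (by positivity) hz2).mul_left _
  have h0 := hasSum_ite_eq (0 : ℕ) (8 / 5 * z)
  have h1 := hasSum_ite_eq (1 : ℕ) (4 / 15 * z ^ 3)
  have hsum := (hg.add h0).add h1
  rw [one_div s]
  refine (hasSum_le ?_ h hsum).trans_eq ?_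
  · intro k
    rcases k with _ | _ | k
    · norm_num
      linarith
    · norm_num
      nlinarith [pow_pos hz0 3]
    · have e : (z ^ 2) ^ (k + 1 + 1) * z = z ^ (2 * (k + 1 + 1) + 1) := by
        rw [← pow_mul, ← pow_succ]
      have : 2 * (1 / (2 * ((k + 1 + 1 : ℕ) : ℝ) + 1)) ≤ 2 / 5 := by
        rw [← mul_div_assoc, mul_one]
        refine div_le_div_of_nonneg_left (by norm_num) (by norm_num) ?_
        push_cast
        linarith [(k.cast_nonneg : (0 : ℝ) ≤ k)]
      have h3 := mul_le_mul_of_nonneg_right this (pow_pos hz0 (2 * (k + 1 + 1) + 1)).le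
      simp only [Nat.add_eq_zero_iff, one_ne_zero, and_false, if_false, Nat.add_eq_right, add_zero]
      linarith
  · have : 1 - z ^ 2 ≠ 0 := by linarith
    field_simp
    ring

/-- The defect, bound minus `digamma (s + 1) - log s`, tends to zero at infinity and increases along
unit steps, hence is nonpositive. By the functional equation a unit step involves only rational
terms and `log (1 + 1 / t)`, for which two terms of the artanh series suffice. -/
theorem digamma_add_one_ge {s : ℝ} (hs : 0 < s) :
    Real.log s + 1 / (2 * s + 1 / 2) ≤ digamma (s + 1) := by
  have hlim : Tendsto (fun s : ℝ => 1 / (2 * s + 1 / 2) - (digamma (s + 1) - Real.log s)) atTop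
      (𝓝 (0 - 0)) := by
    refine Tendsto.sub ?_ tendsto_digamma_sub_log
    simp only [one_div]
    exact tendsto_inv_atTop_zero.comp
      (tendsto_atTop_add_const_right _ _ (tendsto_id.const_mul_atTop two_pos))
  have h := le_of_step_le_of_tendsto (s := s) (fun t ht => ?_) hlim
  · simp only [sub_zero] at h
    linarith
  · have ht0 : 0 < t := hs.trans_le ht
    rw [digamma_add_one (by linarith : 0 < t + 1)]
    have h1 := log_one_add_inv_ge ht0 2
    have h2 : Real.log (1 + 1 / t) = Real.log (t + 1) - Real.log t := by
      rw [← Real.log_div (by linarith) ht0.ne']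
      congr 1
      field_simp
    rw [h2] at h1
    simp only [Finset.sum_range_succ, Finset.sum_range_zero] at h1
    norm_num at h1
    have h3 : 1 / (t + 1) + 1 / (2 * t + 1 / 2) - 1 / (2 * (t + 1) + 1 / 2) ≤
        2 * (2 * t + 1)⁻¹ + 2 / 3 * ((2 * t + 1) ^ 3)⁻¹ := by
      rw [← sub_nonneg]
      have : 2 * (2 * t + 1)⁻¹ + 2 / 3 * ((2 * t + 1) ^ 3)⁻¹ -
          (1 / (t + 1) + 1 / (2 * t + 1 / 2) - 1 / (2 * (t + 1) + 1 / 2)) =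
          (1 + 22 * t + 44 * t ^ 2 + 32 * t ^ 3) /
            (12 * (t + 1) * (2 * t + 1 / 2) * (2 * (t + 1) + 1 / 2) * (2 * t + 1) ^ 3) := by
        field_simp
        ring
      rw [this]
      positivity
    linarith

theorem digamma_add_one_le {s : ℝ} (hs : 3 / 10 ≤ s) :
    digamma (s + 1) ≤ Real.log s + 1 / (2 * s + 1 / 3) := by
  have hlim : Tendsto (fun s : ℝ => (digamma (s + 1) - Real.log s) - 1 / (2 * s + 1 / 3)) atTop
      (𝓝 (0 - 0)) := by
    refine Tendsto.sub tendsto_digamma_sub_log ?_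
    simp only [one_div]
    exact tendsto_inv_atTop_zero.comp
      (tendsto_atTop_add_const_right _ _ (tendsto_id.const_mul_atTop two_pos))
  have h := le_of_step_le_of_tendsto (s := s) (fun t ht => ?_) hlim
  · simp only [sub_zero] at h
    linarith
  · have ht0 : 3 / 10 ≤ t := hs.trans ht
    have ht1 : 0 < t := by linarith
    rw [digamma_add_one (by linarith : 0 < t + 1)]
    have h1 := log_one_add_inv_le ht1 rfl
    have h2 : Real.log (1 + 1 / t) = Real.log (t + 1) - Real.log t := by
      rw [← Real.log_div (by linarith) ht1.ne']
      congr 1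
      field_simp
    rw [h2] at h1
    have h3 : 2 * (1 / (2 * t + 1)) + 2 / 3 * (1 / (2 * t + 1)) ^ 3 +
        2 / 5 * ((1 / (2 * t + 1)) ^ 5 / (1 - (1 / (2 * t + 1)) ^ 2)) ≤
        1 / (t + 1) + 1 / (2 * t + 1 / 3) - 1 / (2 * (t + 1) + 1 / 3) := by
      have e : 1 - (1 / (2 * t + 1)) ^ 2 = 4 * t * (t + 1) / (2 * t + 1) ^ 2 := by
        field_simp
        ring
      rw [← sub_nonneg, e]
      have : 1 / (t + 1) + 1 / (2 * t + 1 / 3) - 1 / (2 * (t + 1) + 1 / 3) -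
          (2 * (1 / (2 * t + 1)) + 2 / 3 * (1 / (2 * t + 1)) ^ 3 +
            2 / 5 * ((1 / (2 * t + 1)) ^ 5 / (4 * t * (t + 1) / (2 * t + 1) ^ 2))) =
          (-7 + 46 / 3 * t + 292 / 3 * t ^ 2 + 120 * t ^ 3) /
            ((1 + t) * (1 + 6 * t) * (7 + 6 * t) * (1 + 2 * t) ^ 3 * (10 * t)) := by
        field_simp
        ring
      rw [this]
      -- The numerator is negative near zero; this is where `3 / 10 ≤ t` enters. The lemma is later
      -- used at `3 * t` with `1 / 10 ≤ t`.
      refine div_nonneg ?_ (by positivity)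
      nlinarith [mul_nonneg ht1.le (sub_nonneg.2 ht0), pow_pos ht1 3]
    linarith

/-- The previous lower bound at `s = 1` reads `digamma 1 + 1 ≥ 2 / 5`; monotonicity does the rest.
-/
theorem neg_three_fifths_le_digamma {s : ℝ} (hs : 1 ≤ s) : -(3 / 5) ≤ digamma s := by
  have h1 := digamma_add_one_ge one_pos
  rw [digamma_add_one one_pos, Real.log_one] at h1
  have h2 : digamma 1 ≤ digamma s := monotoneOn_digamma (by simp) (by simp; linarith) hs
  norm_num at h1
  linarith

/-- The difference `digamma (m + 1 / 2) - digamma m`. -/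
theorem digamma_add_half_sub_le {m : ℝ} (hm : 1 ≤ m) :
    digamma (m + 1 / 2) - digamma m ≤ 1 / (2 * m - 1 / 2) := by
  have hl : Tendsto (fun s : ℝ => (digamma (s + 1 / 2) - digamma s)) atTop (𝓝 0) := by
    have h0 : Tendsto (fun s : ℝ => 1 / s) atTop (𝓝 0) := by
      exact tendsto_const_nhds.div_atTop tendsto_id
    refine tendsto_of_tendsto_of_tendsto_of_le_of_le' tendsto_const_nhds h0 ?_ ?_
    · filter_upwards [eventually_gt_atTop 0] with s hs
      exact sub_nonneg.2 (monotoneOn_digamma (mem_Ioi.2 hs) (by simp; linarith) (by linarith))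
    · filter_upwards [eventually_gt_atTop 0] with s hs
      have := monotoneOn_digamma (a := s + 1 / 2) (b := s + 1) (by simp; linarith) (by simp; linarith)
        (by linarith)
      rw [digamma_add_one hs] at this
      linarith
  -- The comparison function `1 / (2 s - 1 / 2)` agrees with the digamma difference to second order
  -- at infinity. The excess over it increases along unit steps to the limit zero.
  have hlim : Tendsto (fun s : ℝ => (digamma (s + 1 / 2) - digamma s) - 1 / (2 * s - 1 / 2)) atTop
      (𝓝 (0 - 0)) := by
    refine hl.sub ?_
    simp only [one_div, sub_eq_add_neg]
    exact tendsto_inv_atTop_zero.comp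
      (tendsto_atTop_add_const_right _ _ (tendsto_id.const_mul_atTop two_pos))
  have h := le_of_step_le_of_tendsto (s := m) (fun t ht => ?_) hlim
  · simp only [sub_zero] at h
    linarith
  · have ht0 : 1 ≤ t := hm.trans ht
    have e : t + 1 + 1 / 2 = t + 1 / 2 + 1 := by ring
    rw [e, digamma_add_one (by linarith), digamma_add_one (by linarith)]
    have h1 : 4 * t - 1 ≠ 0 := by linarith
    have e1 : 2 * t - 1 / 2 = (4 * t - 1) / 2 := by ring
    have e2 : 2 * (t + 1) - 1 / 2 = (4 * t + 3) / 2 := by ring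
    have : 1 / (2 * t - 1 / 2) - 1 / (2 * (t + 1) - 1 / 2) - (1 / t - 1 / (t + 1 / 2)) =
        (3 / 4) / (2 * (t * (t + 1 / 2)) * ((2 * t - 1 / 2) * (2 * (t + 1) - 1 / 2))) := by
      rw [e1, e2]
      field_simp
      ring
    have h4 : 0 ≤ (3 / 4) / (2 * (t * (t + 1 / 2)) * ((2 * t - 1 / 2) * (2 * (t + 1) - 1 / 2))) := by
      refine div_nonneg (by norm_num) (mul_nonneg (by positivity) (mul_nonneg ?_ ?_)) <;> linarith
    linarith

/-- Lower bound for the ratio `Γ (m + 1 / 2) / Γ m`. -/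
theorem Gamma_le_Gamma_add_half {m : ℝ} (hm : 1 ≤ m) :
    Real.Gamma m * Real.sqrt (m - 1 / 4) ≤ Real.Gamma (m + 1 / 2) := by
  have hlim : Tendsto (fun s => (1 / s - (digamma (s + 1) - Real.log s)) / 2) atTop
      (𝓝 ((0 - 0) / 2)) := by
    refine (Tendsto.sub ?_ tendsto_digamma_sub_log).div_const 2
    exact tendsto_const_nhds.div_atTop tendsto_id
  -- The logarithm of the quotient of the two sides increases along unit steps, because `(t + 3/4) t
  -- ^ 2` exceeds `(t - 1/4) (t + 1/2) ^ 2` by exactly `1/16`. The tangent of `log Γ` at `t` bounds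
  -- it by a function tending to zero.
  have h := le_of_step_le_of_le_of_tendsto (s := m)
    (φ := fun s => Real.log (Real.Gamma s) + Real.log (s - 1 / 4) / 2 -
      Real.log (Real.Gamma (s + 1 / 2))) (fun t ht => ?_) (fun t ht => ?_) hlim
  · have hG := Real.Gamma_pos_of_pos (by linarith : 0 < m)
    have hG2 := Real.Gamma_pos_of_pos (by linarith : 0 < m + 1 / 2)
    have hs : 0 < Real.sqrt (m - 1 / 4) := Real.sqrt_pos.2 (by linarith)
    rw [← Real.log_le_log_iff (by positivity) hG2, Real.log_mul hG.ne' hs.ne',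
      Real.log_sqrt (by linarith)]
    norm_num at h
    norm_num
    linarith
  · have ht0 : 1 ≤ t := hm.trans ht
    have hG := Real.Gamma_pos_of_pos (by linarith : 0 < t)
    have hG2 := Real.Gamma_pos_of_pos (by linarith : 0 < t + 1 / 2)
    have e : t + 1 + 1 / 2 = t + 1 / 2 + 1 := by ring
    simp only [e]
    rw [Real.Gamma_add_one (by linarith), Real.Gamma_add_one (by linarith),
      Real.log_mul (by linarith) hG.ne', Real.log_mul (by linarith) hG2.ne']
    have h1 : Real.log ((t - 1 / 4) * (t + 1 / 2) ^ 2) ≤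
        Real.log ((t + 1 - 1 / 4) * t ^ 2) := by
      refine Real.log_le_log (mul_pos (by linarith) (by positivity)) ?_
      nlinarith
    rw [Real.log_mul (by linarith) (by positivity), Real.log_mul (by linarith) (by positivity),
      Real.log_pow, Real.log_pow] at h1
    push_cast at h1
    linarith
  · have ht0 : 1 ≤ t := hm.trans ht
    have h1 := Real.convexOn_log_Gamma.le_slope_of_hasDerivAt (x := t) (y := t + 1 / 2)
      (mem_Ioi.2 (by linarith)) (mem_Ioi.2 (by linarith)) (by linarith)
      (hasDerivAt_log_Gamma (by linarith))
    rw [slope_def_field, le_div_iff₀ (by linarith)] at h1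
    simp only [Function.comp] at h1
    have h2 := digamma_add_one (by linarith : 0 < t)
    have h3 : Real.log (t - 1 / 4) ≤ Real.log t := Real.log_le_log (by linarith) (by linarith)
    linarith

/-- Logarithms of small numbers are reached from `log 2` through a ratio close to one, here `9 / 8`,
for which the artanh series converges fast. -/
theorem log_three_lt : Real.log 3 < 1.0987 := by
  have h1 : Real.log 9 = 2 * Real.log 3 := by
    rw [show (9 : ℝ) = 3 ^ 2 by norm_num, Real.log_pow]; norm_num
  have h2 : Real.log (9 / 8) = Real.log 9 - 3 * Real.log 2 := by
    rw [Real.log_div (by norm_num) (by norm_num), show (8 : ℝ) = 2 ^ 3 by norm_num, Real.log_pow]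
    norm_num
  have h3 := log_one_add_inv_le (s := 8) (by norm_num) rfl
  norm_num at h3
  linarith [Real.log_two_lt_d9]

theorem lt_log_three : 1.0986 < Real.log 3 := by
  have h1 : Real.log 9 = 2 * Real.log 3 := by
    rw [show (9 : ℝ) = 3 ^ 2 by norm_num, Real.log_pow]; norm_num
  have h2 : Real.log (9 / 8) = Real.log 9 - 3 * Real.log 2 := by
    rw [Real.log_div (by norm_num) (by norm_num), show (8 : ℝ) = 2 ^ 3 by norm_num, Real.log_pow]
    norm_num
  have h3 := log_one_add_inv_ge (s := 8) (by norm_num) 2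
  simp only [Finset.sum_range_succ, Finset.sum_range_zero] at h3
  norm_num at h3
  linarith [Real.log_two_gt_d9]

theorem lt_log_seven : 1.9459 < Real.log 7 := by
  have h2 : Real.log (8 / 7) = 3 * Real.log 2 - Real.log 7 := by
    rw [Real.log_div (by norm_num) (by norm_num), show (8 : ℝ) = 2 ^ 3 by norm_num, Real.log_pow]
    norm_num
  have h3 := log_one_add_inv_le (s := 7) (by norm_num) rfl
  norm_num at h3
  linarith [Real.log_two_gt_d9]

/-! ### Differentiation under the integral sign, and the sign lemma -/

/-- The derivative of a parametric integral with a moving endpoint. -/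
theorem hasDerivAt_param_comp {F k : ℝ → ℝ → ℝ} {y : ℝ → ℝ} {A t₀ y' : ℝ}
    (hk : ∀ᶠ p in 𝓝 (t₀, y t₀), HasDerivAt (F p.1) (k p.1 p.2) p.2)
    (hc : ContinuousAt (fun p : ℝ × ℝ => k p.1 p.2) (t₀, y t₀))
    (hF : HasDerivAt (fun t => F t (y t₀)) A t₀) (hy : HasDerivAt y y' t₀) :
    HasDerivAt (fun t => F t (y t)) (A + k t₀ (y t₀) * y') t₀ := by
  -- Joint continuity of `k` makes the mean value inequality in the second variable uniform for `t`
  -- near `t₀`. Thus the partial derivative of `F` in `t` is needed only at the frozen endpoint `y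
  -- t₀`.
  have h1 : (fun t => F t (y t) - F t (y t₀) - k t₀ (y t₀) * (y t - y t₀)) =o[𝓝 t₀]
      fun t => t - t₀ := by
    refine IsLittleO.trans_isBigO ?_ hy.isBigO_sub
    rw [isLittleO_iff]
    intro ε hε
    obtain ⟨r, hr, h⟩ := Metric.eventually_nhds_iff.1
      (hk.and (hc.eventually (Metric.ball_mem_nhds _ hε)))
    filter_upwards [Metric.ball_mem_nhds t₀ hr, hy.continuousAt (Metric.ball_mem_nhds _ hr)]
      with t ht hyt
    have hz : ∀ z ∈ Metric.ball (y t₀) r, HasDerivAt (F t) (k t z) z ∧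
        |k t z - k t₀ (y t₀)| < ε := fun z hz => by
      have := @h (t, z) (by rw [Prod.dist_eq]; exact max_lt ht hz)
      exact ⟨this.1, by simpa [Real.dist_eq] using this.2⟩
    have hb := (convex_ball (y t₀) r).norm_image_sub_le_of_norm_hasDerivWithin_le
      (f := fun z => F t z - k t₀ (y t₀) * z) (f' := fun z => k t z - k t₀ (y t₀) * 1) (C := ε)
      (x := y t₀) (y := y t)
      (fun z hz' => (((hz z hz').1.sub ((hasDerivAt_id z).const_mul _))).hasDerivWithinAt)
      (fun z hz' => by simpa using (hz z hz').2.le) (Metric.mem_ball_self hr) hyt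
    refine le_trans (le_of_eq ?_) hb
    congr 1
    ring
  rw [hasDerivAt_iff_isLittleO] at hF hy ⊢
  have h2 := (h1.add hF).add (hy.const_mul_left (k t₀ (y t₀)))
  refine h2.congr_left fun t => ?_
  simp only [smul_eq_mul]
  ring

theorem hasDerivAt_integral_Ioi {f : ℝ → ℝ} {c x : ℝ} (hf : IntegrableOn f (Ioi c)) (hx : c < x)
    (hfx : ContinuousAt f x) (hm : StronglyMeasurableAtFilter f (𝓝 x)) :
    HasDerivAt (fun y => ∫ z in Ioi y, f z) (-f x) x := by
  have hi : IntervalIntegrable f volume c x :=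
    (intervalIntegrable_iff_integrableOn_Ioc_of_le hx.le).2 (hf.mono_set Ioc_subset_Ioi_self)
  have h1 := (intervalIntegral.integral_hasDerivAt_right hi hm hfx).const_sub (∫ z in Ioi c, f z)
  refine h1.congr_of_eventuallyEq ?_
  filter_upwards [lt_mem_nhds hx] with y hy
  rw [← intervalIntegral.integral_Ioi_sub_Ioi hf hy.le]
  ring

/-- Differentiation of a real Mellin transform. -/
theorem hasDerivAt_integral_rpow_mul {w : ℝ → ℝ} {a b s : ℝ}
    (hloc : LocallyIntegrableOn w (Ioi 0)) (htop : w =O[atTop] fun x => x ^ (-a)) (hsa : s < a)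
    (hbot : w =O[𝓝[>] 0] fun x => x ^ (-b)) (hbs : b < s) :
    IntegrableOn (fun x => x ^ (s - 1) * (Real.log x * w x)) (Ioi 0) ∧
      HasDerivAt (fun s => ∫ x in Ioi 0, x ^ (s - 1) * w x)
        (∫ x in Ioi 0, x ^ (s - 1) * (Real.log x * w x)) s := by
  -- At real arguments the complex Mellin transform of a real function is real, so its complex
  -- derivative restricts to the real one.
  have hre : ∀ {g : ℝ → ℝ} {r : ℝ}, mellin (fun x => (g x : ℂ)) r =
      ((∫ x in Ioi 0, x ^ (r - 1) * g x : ℝ) : ℂ) := by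
    intro g r
    rw [mellin, ← integral_complex_ofReal]
    refine setIntegral_congr_fun measurableSet_Ioi fun x hx => ?_
    simp only [smul_eq_mul, Complex.ofReal_mul, Complex.ofReal_cpow (mem_Ioi.1 hx).le]
    norm_cast
  have hloc' : LocallyIntegrableOn (fun x => (w x : ℂ)) (Ioi 0) := fun x hx =>
    let ⟨t, ht, h⟩ := hloc x hx
    ⟨t, ht, h.ofReal⟩
  have htop' : (fun x => (w x : ℂ)) =O[atTop] fun x => x ^ (-a) :=
    (isBigO_norm_left.1 (by simpa using htop.norm_left))
  have hbot' : (fun x => (w x : ℂ)) =O[𝓝[>] 0] fun x => x ^ (-b) :=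
    (isBigO_norm_left.1 (by simpa using hbot.norm_left))
  obtain ⟨h1, h2⟩ := mellin_hasDerivAt_of_isBigO_rpow (s := (s : ℂ)) hloc' htop' (by simpa using hsa)
    hbot' (by simpa using hbs)
  have e : (fun t : ℝ => Real.log t • (w t : ℂ)) = fun t => ((Real.log t * w t : ℝ) : ℂ) := by
    ext t
    simp
  rw [e] at h1 h2
  refine ⟨?_, ?_⟩
  · have h3 : IntegrableOn (fun x : ℝ => RCLike.re ((x : ℂ) ^ ((s : ℂ) - 1) •
        ((Real.log x * w x : ℝ) : ℂ))) (Ioi 0) := Integrable.re h1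
    refine h3.congr_fun (fun (x : ℝ) hx => ?_) measurableSet_Ioi
    have : (x : ℂ) ^ ((s : ℂ) - 1) = ((x ^ (s - 1) : ℝ) : ℂ) := by
      rw [Complex.ofReal_cpow (mem_Ioi.1 hx).le]
      norm_cast
    simp only [this, smul_eq_mul, ← Complex.ofReal_mul]
    exact Complex.ofReal_re _
  · have h3 := h2.real_of_complex
    rw [hre] at h3
    simpa only [hre, Complex.ofReal_re] using h3

/-- If `I` vanishes at both ends of an interval and its derivative is a positive multiple of a
concave function, then `I` stays positive to the right of any point where it is positive. -/
theorem pos_of_hasDerivAt_mul_concaveOn {I ρ c : ℝ → ℝ} {S : Set ℝ} {y₀ y₁ : ℝ}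
    (hS : Convex ℝ S)
    (hd : ∀ y ∈ S, HasDerivAt I (ρ y * c y) y) (hρ : ∀ y ∈ S, 0 < ρ y) (hc : ConcaveOn ℝ S c)
    (hy₀ : y₀ ∈ S) (hy₁ : y₁ ∈ S) (h01 : y₀ ≤ y₁) (hI : 0 < I y₀)
    (hleft : ∃ z ∈ S, z < y₀ ∧ I z < I y₀)
    (hright : I y₁ ≤ 0 → ∃ p ∈ S, ∃ q ∈ S, y₁ ≤ p ∧ p < q ∧ I p ≤ I q) : 0 < I y₁ := by
  by_contra! h
  have mvt : ∀ p ∈ S, ∀ q ∈ S, p < q → ∃ z ∈ S, z ∈ Ioo p q ∧ ρ z * c z = (I q - I p) / (q - p) := by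
    intro p hp q hq hpq
    have hsub : Icc p q ⊆ S := hS.ordConnected.out hp hq
    obtain ⟨z, hz, hz'⟩ := exists_hasDerivAt_eq_slope I (fun y => ρ y * c y) hpq
      (fun y hy => (hd y (hsub hy)).continuousAt.continuousWithinAt)
      (fun y hy => hd y (hsub (Ioo_subset_Icc_self hy)))
    exact ⟨z, hsub (Ioo_subset_Icc_self hz), hz, hz'⟩
  have h01' : y₀ < y₁ := h01.lt_of_ne (by rintro rfl; linarith)
  obtain ⟨a, haS, ha, hIa⟩ := hleft
  obtain ⟨p, hpS, q, hqS, hp, hpq, hIpq⟩ := hright h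
  -- Mean value points `z₁ < z₂ < z₃` with `c z₁ > 0`, `c z₂ < 0` and `c z₃ ≥ 0` cannot exist:
  -- between two points a concave function is at least the smaller of its end values.
  obtain ⟨z₁, hz₁S, hz₁, e₁⟩ := mvt a haS y₀ hy₀ ha
  obtain ⟨z₂, hz₂S, hz₂, e₂⟩ := mvt y₀ hy₀ y₁ hy₁ h01'
  obtain ⟨z₃, hz₃S, hz₃, e₃⟩ := mvt p hpS q hqS hpq
  have c₁ : 0 < c z₁ := by
    have : 0 < ρ z₁ * c z₁ := by rw [e₁]; exact div_pos (by linarith) (by linarith)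
    exact (mul_pos_iff_of_pos_left (hρ _ hz₁S)).1 this
  have c₂ : c z₂ < 0 := by
    have : ρ z₂ * c z₂ < 0 := by rw [e₂]; exact div_neg_of_neg_of_pos (by linarith) (by linarith)
    by_contra! h0
    exact absurd (mul_nonneg (hρ _ hz₂S).le h0) (not_le.2 this)
  have c₃ : 0 ≤ c z₃ := by
    have : 0 ≤ ρ z₃ * c z₃ := by rw [e₃]; exact div_nonneg (by linarith) (by linarith)
    exact (mul_nonneg_iff_of_pos_left (hρ _ hz₃S)).1 this
  have hmin := hc.min_le_of_mem_Icc hz₁S hz₃S (z := z₂)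
    ⟨(hz₁.2.trans hz₂.1).le, (hz₂.2.le.trans (hp.trans hz₃.1.le))⟩
  exact absurd ((le_min c₁.le c₃).trans hmin) (not_le.2 c₂)

/-! ### The incomplete Gamma function: recursions and lower bounds -/

/-- The upper incomplete Gamma function. -/
noncomputable def incGamma (s y : ℝ) : ℝ := ∫ x in Ioi y, x ^ (s - 1) * Real.exp (-x)

/-- The derivative of the upper incomplete Gamma function in its first argument. -/
noncomputable def logIncGamma (s y : ℝ) : ℝ :=
  ∫ x in Ioi y, x ^ (s - 1) * (Real.log x * Real.exp (-x))

theorem tendsto_rpow_mul_exp_neg (s : ℝ) :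
    Tendsto (fun x : ℝ => x ^ s * Real.exp (-x)) atTop (𝓝 0) := by
  simpa using tendsto_rpow_mul_exp_neg_mul_atTop_nhds_zero s 1 one_pos

theorem hasDerivAt_rpow_mul_exp_neg (s : ℝ) {x : ℝ} (hx : 0 < x) :
    HasDerivAt (fun x : ℝ => x ^ s * Real.exp (-x))
      ((s - x) * (x ^ (s - 1) * Real.exp (-x))) x := by
  have h := (Real.hasDerivAt_rpow_const (p := s) (Or.inl hx.ne')).mul (hasDerivAt_neg x).exp
  refine h.congr_deriv ?_
  have : x ^ s = x ^ (s - 1) * x := by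
    rw [← Real.rpow_add_one hx.ne']; simp
  rw [this]
  ring

/-- Comparison of two functions that vanish at infinity. -/
theorem le_of_deriv_le_of_tendsto_zero {f g f' g' : ℝ → ℝ} {y : ℝ}
    (hf : ∀ x, y ≤ x → HasDerivAt f (f' x) x) (hg : ∀ x, y ≤ x → HasDerivAt g (g' x) x)
    (hle : ∀ x, y ≤ x → g' x ≤ f' x) (hf0 : Tendsto f atTop (𝓝 0))
    (hg0 : Tendsto g atTop (𝓝 0)) : f y ≤ g y := by
  have hmono : MonotoneOn (f - g) (Ici y) := by
    refine monotoneOn_of_deriv_nonneg (convex_Ici y) ?_ ?_ ?_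
    · exact fun x hx => ((hf x hx).sub (hg x hx)).continuousAt.continuousWithinAt
    · exact fun x hx => ((hf x (interior_subset hx)).sub
        (hg x (interior_subset hx))).differentiableAt.differentiableWithinAt
    · intro x hx
      have hx' : y ≤ x := interior_subset hx
      rw [((hf x hx').sub (hg x hx')).deriv]
      exact sub_nonneg.2 (hle x hx')
  have hlim : Tendsto (f - g) atTop (𝓝 0) := by
    have h := hf0.sub hg0
    rwa [sub_zero] at h
  have : (f - g) y ≤ 0 := ge_of_tendsto hlim (by
    filter_upwards [eventually_ge_atTop y] with x hx
    exact hmono self_mem_Ici hx hx)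
  simpa using this

section

variable {s y : ℝ}

theorem integrableOn_incGamma (hs : 0 < s) :
    IntegrableOn (fun x : ℝ => x ^ (s - 1) * Real.exp (-x)) (Ioi 0) := by
  simpa only [mul_comm] using Real.GammaIntegral_convergent hs

theorem incGamma_zero (hs : 0 < s) : incGamma s 0 = Real.Gamma s := by
  rw [incGamma, Real.Gamma_eq_integral hs]
  simp only [mul_comm]

/-- The truncated integral is the Mellin transform of `exp (-x)` cut off by an indicator, which is
bounded near zero and decays faster than any power. -/
theorem hasDerivAt_incGamma_param (hs : 0 < s) (hy : 0 ≤ y) :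
    IntegrableOn (fun x => x ^ (s - 1) * (Real.log x * Real.exp (-x))) (Ioi y) ∧
      HasDerivAt (fun s => incGamma s y) (logIncGamma s y) s := by
  have hloc : LocallyIntegrableOn ((Ioi y).indicator fun x => Real.exp (-x)) (Ioi 0) := by
    have h : IntegrableOn (fun x : ℝ => Real.exp (-x)) (Ioi 0) := integrableOn_exp_neg_Ioi 0
    exact (IntegrableOn.indicator h measurableSet_Ioi).locallyIntegrableOn
  have hle : ∀ x, ‖(Ioi y).indicator (fun x => Real.exp (-x)) x‖ ≤ ‖Real.exp (-x)‖ :=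
    fun x => norm_indicator_le_norm_self _ _
  have htop : ((Ioi y).indicator fun x => Real.exp (-x)) =O[atTop] fun x : ℝ => x ^ (-(s + 1)) := by
    refine (IsBigO.of_bound 1 (Eventually.of_forall fun x => by simpa using hle x)).trans
      (g := fun x : ℝ => Real.exp (-x)) ?_
    simpa using (isLittleO_exp_neg_mul_rpow_atTop one_pos (-(s + 1))).isBigO
  have hbot : ((Ioi y).indicator fun x => Real.exp (-x)) =O[𝓝[>] 0] fun x : ℝ => x ^ (-(0 : ℝ)) := by
    refine IsBigO.of_bound 1 ?_
    filter_upwards [self_mem_nhdsWithin] with x hx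
    refine (hle x).trans ?_
    simp only [Real.norm_eq_abs, Real.abs_exp, neg_zero, Real.rpow_zero, abs_one, mul_one]
    exact Real.exp_le_one_iff.2 (neg_nonpos.2 (mem_Ioi.1 hx).le)
  obtain ⟨h1, h2⟩ := hasDerivAt_integral_rpow_mul hloc htop (lt_add_one s) hbot hs
  have e : ∀ g : ℝ → ℝ, (fun x => g x * (Ioi y).indicator (fun x => Real.exp (-x)) x) =
      (Ioi y).indicator fun x => g x * Real.exp (-x) := fun g => by
    ext x
    by_cases hx : x ∈ Ioi y <;> simp [hx]
  have hinter : Ioi 0 ∩ Ioi y = Ioi y := inter_eq_self_of_subset_right (Ioi_subset_Ioi hy)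
  have e2 : ∀ s, ∫ x in Ioi 0, x ^ (s - 1) * (Ioi y).indicator (fun x => Real.exp (-x)) x =
      incGamma s y := fun s => by
    rw [e, setIntegral_indicator measurableSet_Ioi, hinter, incGamma]
  have e3 : (fun x => x ^ (s - 1) * (Real.log x * (Ioi y).indicator (fun x => Real.exp (-x)) x)) =
      (Ioi y).indicator fun x => x ^ (s - 1) * (Real.log x * Real.exp (-x)) := by
    simp only [← mul_assoc]
    exact e _
  rw [e3] at h1 h2
  rw [setIntegral_indicator measurableSet_Ioi, hinter] at h2
  simp only [e2] at h2
  refine ⟨?_, h2⟩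
  rw [IntegrableOn, integrable_indicator_iff measurableSet_Ioi, IntegrableOn,
    Measure.restrict_restrict measurableSet_Ioi, inter_comm, hinter] at h1
  exact h1

theorem logIncGamma_zero (hs : 0 < s) : logIncGamma s 0 = Real.Gamma s * digamma s := by
  have h1 := (hasDerivAt_incGamma_param hs le_rfl).2
  refine h1.unique ((hasDerivAt_Gamma_digamma hs).congr_of_eventuallyEq ?_)
  filter_upwards [lt_mem_nhds hs] with x hx
  exact incGamma_zero hx

theorem hasDerivAt_incGamma (hs : 0 < s) (hy : 0 < y) :
    HasDerivAt (incGamma s) (-(y ^ (s - 1) * Real.exp (-y))) y :=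
  hasDerivAt_integral_Ioi (integrableOn_incGamma hs) hy
    ((Real.continuousAt_rpow_const _ _ (Or.inl hy.ne')).mul (by fun_prop))
    (Measurable.stronglyMeasurable (by fun_prop)).stronglyMeasurableAtFilter

theorem hasDerivAt_logIncGamma (hs : 0 < s) (hy : 0 < y) :
    HasDerivAt (logIncGamma s) (-(y ^ (s - 1) * (Real.log y * Real.exp (-y)))) y :=
  hasDerivAt_integral_Ioi (hasDerivAt_incGamma_param hs le_rfl).1 hy
    ((Real.continuousAt_rpow_const _ _ (Or.inl hy.ne')).mul
      ((Real.continuousAt_log hy.ne').mul (by fun_prop)))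
    (Measurable.stronglyMeasurable (by fun_prop)).stronglyMeasurableAtFilter

theorem continuousOn_incGamma (hs : 0 < s) : ContinuousOn (incGamma s) (Ici 0) :=
  (integrableOn_incGamma hs).continuousOn_Ici_primitive_Ioi

theorem continuousOn_logIncGamma (hs : 0 < s) : ContinuousOn (logIncGamma s) (Ici 0) :=
  (hasDerivAt_incGamma_param hs le_rfl).1.continuousOn_Ici_primitive_Ioi

theorem tendsto_incGamma : Tendsto (incGamma s) atTop (𝓝 0) :=
  tendsto_integral_Ioi_zero tendsto_id

theorem tendsto_logIncGamma : Tendsto (logIncGamma s) atTop (𝓝 0) :=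
  tendsto_integral_Ioi_zero tendsto_id

theorem incGamma_pos (hs : 0 < s) (hy : 0 ≤ y) : 0 < incGamma s y := by
  rw [incGamma, setIntegral_pos_iff_support_of_nonneg_ae]
  · have : Function.support (fun x => x ^ (s - 1) * Real.exp (-x)) ∩ Ioi y = Ioi y := by
      refine inter_eq_right.2 fun x hx => ?_
      have : 0 < x := hy.trans_lt hx
      exact (mul_pos (Real.rpow_pos_of_pos this _) (Real.exp_pos _)).ne'
    rw [this]
    simp
  · filter_upwards [ae_restrict_mem measurableSet_Ioi] with x hx
    exact mul_nonneg (Real.rpow_nonneg (hy.trans hx.le) _) (Real.exp_pos _).le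
  · exact (integrableOn_incGamma hs).mono_set (Ioi_subset_Ioi hy)

theorem eq_of_deriv_eq_of_tendsto_zero {f g f' : ℝ → ℝ} {y : ℝ}
    (hf : ∀ x, y ≤ x → HasDerivAt f (f' x) x) (hg : ∀ x, y ≤ x → HasDerivAt g (f' x) x)
    (hf0 : Tendsto f atTop (𝓝 0)) (hg0 : Tendsto g atTop (𝓝 0)) : f y = g y :=
  le_antisymm (le_of_deriv_le_of_tendsto_zero hf hg (fun _ _ => le_rfl) hf0 hg0)
    (le_of_deriv_le_of_tendsto_zero hg hf (fun _ _ => le_rfl) hg0 hf0)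

/-- This is integration by parts in differential form: both sides have the same derivative in `y`
and vanish at infinity. -/
theorem incGamma_add_one (hs : 0 < s) (hy : 0 < y) :
    incGamma (s + 1) y = s * incGamma s y + y ^ s * Real.exp (-y) := by
  refine eq_of_deriv_eq_of_tendsto_zero (g := fun y => s * incGamma s y + y ^ s * Real.exp (-y))
    (fun x hx => hasDerivAt_incGamma (by linarith) (hy.trans_le hx)) (fun x hx => ?_)
    tendsto_incGamma ?_
  · have hx0 := hy.trans_le hx
    refine (((hasDerivAt_incGamma hs hx0).const_mul s).add
      (hasDerivAt_rpow_mul_exp_neg s hx0)).congr_deriv ?_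
    rw [add_sub_cancel_right]
    have : x ^ s = x ^ (s - 1) * x := by
      rw [← Real.rpow_add_one hx0.ne']; simp
    rw [this]
    ring
  · simpa using (tendsto_incGamma.const_mul s).add (tendsto_rpow_mul_exp_neg s)

theorem tendsto_rpow_mul_log_mul_exp_neg (s : ℝ) :
    Tendsto (fun x : ℝ => x ^ s * Real.exp (-x) * Real.log x) atTop (𝓝 0) := by
  have h1 : (fun x : ℝ => x ^ s * Real.exp (-x) * Real.log x) =o[atTop]
      fun x : ℝ => x ^ s * Real.exp (-x) * x :=
    (isBigO_refl _ _).mul_isLittleO Real.isLittleO_log_id_atTop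
  refine h1.trans_tendsto ?_
  refine (tendsto_rpow_mul_exp_neg (s + 1)).congr' ?_
  filter_upwards [eventually_gt_atTop 0] with x hx
  rw [Real.rpow_add_one hx.ne']
  ring

theorem logIncGamma_add_one (hs : 0 < s) (hy : 0 < y) :
    logIncGamma (s + 1) y = s * logIncGamma s y + y ^ s * Real.exp (-y) * Real.log y +
      incGamma s y := by
  refine eq_of_deriv_eq_of_tendsto_zero
    (g := fun y => s * logIncGamma s y + y ^ s * Real.exp (-y) * Real.log y + incGamma s y)
    (fun x hx => hasDerivAt_logIncGamma (by linarith) (hy.trans_le hx)) (fun x hx => ?_)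
    tendsto_logIncGamma ?_
  · have hx0 := hy.trans_le hx
    refine ((((hasDerivAt_logIncGamma hs hx0).const_mul s).add
      ((hasDerivAt_rpow_mul_exp_neg s hx0).mul (Real.hasDerivAt_log hx0.ne'))).add
      (hasDerivAt_incGamma hs hx0)).congr_deriv ?_
    rw [add_sub_cancel_right]
    have : x ^ s = x ^ (s - 1) * x := by
      rw [← Real.rpow_add_one hx0.ne']; simp
    rw [this]
    field_simp
    ring
  · simpa using ((tendsto_logIncGamma.const_mul s).add (tendsto_rpow_mul_log_mul_exp_neg s)).add
      tendsto_incGamma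

/-- The quotient is the first convergent of Legendre's continued fraction for the incomplete Gamma
function. For `s ≤ 1` it decreases no faster than that function, so it lies below it, since both
vanish at infinity. -/
theorem hasDerivAt_rpow_mul_exp_neg_div (s : ℝ) (hs1 : s ≤ 1) (hy : 0 < y) :
    ∃ D, HasDerivAt (fun y => y ^ s * Real.exp (-y) / (y + 1 - s)) D y ∧
      -(y ^ (s - 1) * Real.exp (-y)) ≤ D := by
  have hpos : 0 < y + 1 - s := by linarith
  have hlin : HasDerivAt (fun y : ℝ => y + 1 - s) 1 y :=
    ((hasDerivAt_id y).add_const 1).sub_const s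
  refine ⟨_, (hasDerivAt_rpow_mul_exp_neg s hy).div hlin hpos.ne', ?_⟩
  have e : y ^ s = y ^ (s - 1) * y := by
    rw [← Real.rpow_add_one hy.ne']; simp
  have hE : 0 < y ^ (s - 1) * Real.exp (-y) := by positivity
  rw [le_div_iff₀ (by positivity), e]
  nlinarith [mul_nonneg hE.le (sub_nonneg.2 hs1)]

theorem tendsto_rpow_mul_exp_neg_div (s : ℝ) :
    Tendsto (fun y : ℝ => y ^ s * Real.exp (-y) / (y + 1 - s)) atTop (𝓝 0) := by
  refine (tendsto_rpow_mul_exp_neg s).div_atTop ?_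
  simp only [add_sub_assoc]
  exact tendsto_atTop_add_const_right _ _ tendsto_id

theorem incGamma_ge_of_le_one (hs0 : 0 < s) (hs1 : s ≤ 1) (hy : 0 < y) :
    y ^ s * Real.exp (-y) / (y + 1 - s) ≤ incGamma s y := by
  choose! D hD hle using fun x : ℝ => hasDerivAt_rpow_mul_exp_neg_div (y := x) s hs1
  exact le_of_deriv_le_of_tendsto_zero (fun x hx => hD x (hy.trans_le hx))
    (fun x hx => hasDerivAt_incGamma hs0 (hy.trans_le hx)) (fun x hx => hle x (hy.trans_le hx))
    (tendsto_rpow_mul_exp_neg_div s) tendsto_incGamma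

theorem rpow_mul_exp_neg_le_incGamma (hs : 1 ≤ s) (hy : 0 < y) :
    y ^ (s - 1) * Real.exp (-y) ≤ incGamma s y := by
  refine le_of_deriv_le_of_tendsto_zero (f := fun y => y ^ (s - 1) * Real.exp (-y))
    (fun x hx => hasDerivAt_rpow_mul_exp_neg (s - 1) (hy.trans_le hx))
    (fun x hx => hasDerivAt_incGamma (by linarith) (hy.trans_le hx)) (fun x hx => ?_)
    (tendsto_rpow_mul_exp_neg _) tendsto_incGamma
  have hx0 := hy.trans_le hx
  have e : x ^ (s - 1) = x ^ (s - 1 - 1) * x := by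
    rw [← Real.rpow_add_one hx0.ne']; simp
  have hE : 0 < x ^ (s - 1 - 1) * Real.exp (-x) := by positivity
  rw [e]
  nlinarith [mul_nonneg hE.le (sub_nonneg.2 hs)]

theorem incGamma_ge_of_one_le (hs1 : 1 ≤ s) (hs2 : s ≤ 2) (hy : 0 < y) :
    y ^ (s - 1) * Real.exp (-y) * ((y + 1) / (y + 2 - s)) ≤ incGamma s y := by
  -- The recursion lowers the order to `s - 1`, which must be positive; the order `s = 1` is
  -- therefore treated directly.
  rcases hs1.eq_or_lt with rfl | hs
  · have h := rpow_mul_exp_neg_le_incGamma (s := 1) le_rfl hy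
    have e : (y + 1) / (y + 2 - 1) = 1 := by
      rw [div_eq_one_iff_eq (by linarith)]; ring
    rwa [e, mul_one]
  · have h := incGamma_add_one (by linarith : 0 < s - 1) hy
    have h1 := incGamma_ge_of_le_one (by linarith : 0 < s - 1) (by linarith) hy
    rw [sub_add_cancel] at h
    rw [h]
    have e : y ^ (s - 1) * Real.exp (-y) * ((y + 1) / (y + 2 - s)) =
        (s - 1) * (y ^ (s - 1) * Real.exp (-y) / (y + 1 - (s - 1))) +
          y ^ (s - 1) * Real.exp (-y) := by
      have h2 : y + 2 - s ≠ 0 := by linarith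
      rw [show y + 1 - (s - 1) = y + 2 - s by ring]
      field_simp
      ring
    rw [e]
    gcongr

theorem log_mul_incGamma_le (hs : 0 < s) (hy : 0 < y) :
    Real.log y * incGamma s y ≤ logIncGamma s y := by
  rw [incGamma, logIncGamma, ← integral_const_mul]
  refine setIntegral_mono_on ?_ (hasDerivAt_incGamma_param hs hy.le).1 measurableSet_Ioi ?_
  · exact ((integrableOn_incGamma hs).mono_set (Ioi_subset_Ioi hy.le)).const_mul _
  · intro x hx
    have hx0 : 0 < x := hy.trans hx
    have h1 : Real.log y ≤ Real.log x := Real.log_le_log hy (le_of_lt hx)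
    have h2 : 0 < x ^ (s - 1) * Real.exp (-x) := by positivity
    nlinarith

/-- The excess over `log y * incGamma s y` has derivative `-incGamma s y / y`, which is at most `-(y
^ (s - 2) * exp (-y))`. Integrating this back from infinity is bounded below by the convergent of
order `s - 1`. -/
theorem log_mul_incGamma_add_le (hs1 : 1 ≤ s) (hs2 : s ≤ 2) (hy : 0 < y) :
    Real.log y * incGamma s y + y ^ (s - 1) * Real.exp (-y) / (y + 2 - s) ≤ logIncGamma s y := by
  have hs : 0 < s := by linarith
  choose! D hD hle using fun x : ℝ =>
    hasDerivAt_rpow_mul_exp_neg_div (y := x) (s - 1) (by linarith)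
  have h0 : Tendsto (fun y => Real.log y * incGamma s y) atTop (𝓝 0) := by
    refine tendsto_of_tendsto_of_tendsto_of_le_of_le' tendsto_const_nhds
      (tendsto_logIncGamma (s := s)) ?_ ?_
    · filter_upwards [eventually_ge_atTop 1] with x hx
      exact mul_nonneg (Real.log_nonneg hx) (incGamma_pos hs (by linarith)).le
    · filter_upwards [eventually_gt_atTop 0] with x hx
      exact log_mul_incGamma_le hs hx
  have h := le_of_deriv_le_of_tendsto_zero (y := y)
    (f := fun y => Real.log y * incGamma s y + y ^ (s - 1) * Real.exp (-y) / (y + 1 - (s - 1)))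
    (g := logIncGamma s)
    (fun x hx => ((Real.hasDerivAt_log (hy.trans_le hx).ne').mul
      (hasDerivAt_incGamma hs (hy.trans_le hx))).add (hD x (hy.trans_le hx)))
    (fun x hx => hasDerivAt_logIncGamma hs (hy.trans_le hx)) (fun x hx => ?_)
    (by simpa using h0.add (tendsto_rpow_mul_exp_neg_div (s - 1))) tendsto_logIncGamma
  · simp only [show y + 1 - (s - 1) = y + 2 - s by ring] at h
    exact h
  · have hx0 := hy.trans_le hx
    have h1 := hle x hx0
    have h2 := rpow_mul_exp_neg_le_incGamma hs1 hx0
    have e : x ^ (s - 1 - 1) * Real.exp (-x) = x⁻¹ * (x ^ (s - 1) * Real.exp (-x)) := by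
      rw [Real.rpow_sub_one hx0.ne']
      field_simp
    have h3 : x⁻¹ * (x ^ (s - 1) * Real.exp (-x)) ≤ x⁻¹ * incGamma s x := by gcongr
    rw [e] at h1
    linarith

end

/-! ### The generalised Gaussian law: tail, moments and kurtosis -/

theorem ggdScale_pos {β : ℝ} (hβ : 0 < β) : 0 < ggdScale β :=
  Real.sqrt_pos.2 (div_pos (Real.Gamma_pos_of_pos (by positivity))
    (Real.Gamma_pos_of_pos (by positivity)))

theorem ggdScale_sq {β : ℝ} (hβ : 0 < β) :
    ggdScale β ^ 2 = Real.Gamma (1 / β) / Real.Gamma (3 / β) :=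
  Real.sq_sqrt (div_pos (Real.Gamma_pos_of_pos (by positivity))
    (Real.Gamma_pos_of_pos (by positivity))).le

/-- The upper tail integral of the `k`-th moment of a generalised Gaussian law. -/
noncomputable def ggdMomentTail (β a : ℝ) (k : ℕ) (x : ℝ) : ℝ :=
  a ^ k / (2 * Real.Gamma (1 / β)) * incGamma ((k + 1) / β) ((x / a) ^ β)

section

variable {β a : ℝ}

theorem ggdPDF_abs (x : ℝ) : ggdPDF β a |x| = ggdPDF β a x := by
  simp only [ggdPDF, abs_div, abs_abs]

theorem ggdPDF_pos (hβ : 0 < β) (ha : 0 < a) (x : ℝ) : 0 < ggdPDF β a x := by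
  have := Real.Gamma_pos_of_pos (by positivity : 0 < 1 / β)
  rw [ggdPDF]
  positivity

theorem measurable_ggdPDF : Measurable (ggdPDF β a) := by
  unfold ggdPDF
  fun_prop

theorem hasDerivAt_ggdMomentTail (hβ : 0 < β) (ha : 0 < a) (k : ℕ) {x : ℝ} (hx : 0 < x) :
    HasDerivAt (ggdMomentTail β a k) (-(ggdPDF β a x * x ^ k)) x := by
  have hxa : 0 < x / a := div_pos hx ha
  have hy : HasDerivAt (fun x => (x / a) ^ β) (1 / a * β * (x / a) ^ (β - 1)) x :=
    ((hasDerivAt_id x).div_const a).rpow_const (Or.inl hxa.ne')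
  have hs : 0 < ((k : ℝ) + 1) / β := by positivity
  have h := ((hasDerivAt_incGamma hs (Real.rpow_pos_of_pos hxa β)).comp x hy).const_mul
    (a ^ k / (2 * Real.Gamma (1 / β)))
  refine h.congr_deriv ?_
  have hG := (Real.Gamma_pos_of_pos (by positivity : 0 < 1 / β)).ne'
  have e : ((x / a) ^ β) ^ (((k : ℝ) + 1) / β - 1) * (x / a) ^ (β - 1) = (x / a) ^ k := by
    rw [← Real.rpow_mul hxa.le, ← Real.rpow_add hxa, ← Real.rpow_natCast]
    congr 1
    field_simp
    ring
  have e2 : x ^ k = a ^ k * (x / a) ^ k := by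
    rw [← mul_pow, mul_div_cancel₀ _ ha.ne']
  rw [ggdPDF, abs_of_pos hxa, e2, ← e]
  field_simp

theorem continuousOn_ggdMomentTail (hβ : 0 < β) (ha : 0 < a) (k : ℕ) :
    ContinuousOn (ggdMomentTail β a k) (Ici 0) := by
  refine continuousOn_const.mul ((continuousOn_incGamma (by positivity)).comp
    ((Continuous.rpow_const (by fun_prop) fun _ => Or.inr hβ.le).continuousOn) ?_)
  exact fun x hx => Real.rpow_nonneg (div_nonneg hx ha.le) _

theorem tendsto_ggdMomentTail (hβ : 0 < β) (ha : 0 < a) (k : ℕ) :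
    Tendsto (ggdMomentTail β a k) atTop (𝓝 0) := by
  have h := (tendsto_incGamma (s := ((k : ℝ) + 1) / β)).comp
    ((tendsto_rpow_atTop hβ).comp (tendsto_id.atTop_div_const ha))
  have h2 := h.const_mul (a ^ k / (2 * Real.Gamma (1 / β)))
  rw [mul_zero] at h2
  exact h2

theorem ggdMomentTail_zero (hβ : 0 < β) (k : ℕ) : ggdMomentTail β a k 0 =
    a ^ k / (2 * Real.Gamma (1 / β)) * Real.Gamma ((k + 1) / β) := by
  rw [ggdMomentTail, zero_div, Real.zero_rpow hβ.ne', incGamma_zero (by positivity)]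

theorem hasTail_ggdLaw (hβ : 0 < β) :
    HasTail (ggdLaw β) (ggdMomentTail β (ggdScale β) 0) := by
  have ha := ggdScale_pos hβ
  refine hasTail_withDensity (ggdPDF_abs) (fun x _ => ggdPDF_pos hβ ha x)
    (ggdPDF_pos hβ ha 0).le (fun x hx => ?_) (continuousOn_ggdMomentTail hβ ha 0 0 self_mem_Ici)
    (tendsto_ggdMomentTail hβ ha 0) ?_
  · simpa using hasDerivAt_ggdMomentTail hβ ha 0 hx
  · have := (Real.Gamma_pos_of_pos (by positivity : 0 < 1 / β)).ne'
    rw [ggdMomentTail_zero hβ]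
    norm_num at this ⊢
    field_simp

theorem integral_ggdPDF_mul_pow (hβ : 0 < β) (ha : 0 < a) {k : ℕ} (hk : Even k) :
    Integrable (fun x => ggdPDF β a x * x ^ k) ∧
      ∫ x, ggdPDF β a x * x ^ k =
        a ^ k * Real.Gamma ((k + 1) / β) / Real.Gamma (1 / β) := by
  obtain ⟨h1, h2⟩ := integrable_and_integral_of_even (g := fun x => ggdPDF β a x * x ^ k)
    (fun x => by simp only [ggdPDF_abs, hk.pow_abs])
    (fun x hx => mul_nonneg (ggdPDF_pos hβ ha x).le (pow_nonneg hx.le k))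
    (fun x hx => hasDerivAt_ggdMomentTail hβ ha k hx)
    (continuousOn_ggdMomentTail hβ ha k 0 self_mem_Ici) (tendsto_ggdMomentTail hβ ha k)
  refine ⟨h1, h2.trans ?_⟩
  rw [ggdMomentTail_zero hβ]
  field_simp

theorem isStandardised_ggdLaw (hβ : 0 < β) : IsStandardised (ggdLaw β) ∧
    kurtosis (ggdLaw β) = Real.Gamma (5 / β) * Real.Gamma (1 / β) / Real.Gamma (3 / β) ^ 2 := by
  have ha := ggdScale_pos hβ
  have hnn : ∀ x, 0 ≤ ggdPDF β (ggdScale β) x := fun x => (ggdPDF_pos hβ ha x).le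
  have h1 := (Real.Gamma_pos_of_pos (by positivity : 0 < 1 / β)).ne'
  have h3 := (Real.Gamma_pos_of_pos (by positivity : 0 < 3 / β)).ne'
  have i2 := integral_ggdPDF_mul_pow hβ ha (k := 2) (by decide)
  have i4 := integral_ggdPDF_mul_pow hβ ha (k := 4) (by decide)
  refine isStandardised_and_kurtosis_eq (hasTail_ggdLaw hβ).isProbabilityMeasure
    (integrable_pow_withDensity measurable_ggdPDF hnn 4 i4.1)
    (integral_pow_one_withDensity measurable_ggdPDF (ggdPDF_abs) hnn) ?_ ?_
  · refine (integral_pow_withDensity measurable_ggdPDF hnn 2).trans (i2.2.trans ?_)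
    rw [ggdScale_sq hβ]
    norm_num
    norm_num at h1
    field_simp
  · refine (integral_pow_withDensity measurable_ggdPDF hnn 4).trans (i4.2.trans ?_)
    rw [show ggdScale β ^ 4 = (ggdScale β ^ 2) ^ 2 by ring, ggdScale_sq hβ]
    norm_num
    norm_num at h1
    field_simp

end

/-- In Euler's limit for `log Γ` at `5t`, `t` and twice negatively at `3t`, the `log n` terms cancel
since `5 + 1 = 2 * 3`, and so do the factorials. What remains is a sum over `m` of terms
nondecreasing in `t`; the term `m = 0` is constant. -/
theorem strictMonoOn_Gamma_ratio : StrictMonoOn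
    (fun t => Real.Gamma (5 * t) * Real.Gamma t / Real.Gamma (3 * t) ^ 2) (Ioi 0) := by
  have hθ : ∀ (m : ℕ) {t u : ℝ}, 0 < t → t < u →
      2 * Real.log (3 * t + m) - Real.log (5 * t + m) - Real.log (t + m) ≤
      2 * Real.log (3 * u + m) - Real.log (5 * u + m) - Real.log (u + m) ∧ (0 < m →
      2 * Real.log (3 * t + m) - Real.log (5 * t + m) - Real.log (t + m) <
      2 * Real.log (3 * u + m) - Real.log (5 * u + m) - Real.log (u + m)) := by
    intro m t u ht htu
    have hu : 0 < u := ht.trans htu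
    have hm : (0 : ℝ) ≤ m := m.cast_nonneg
    have e : ∀ p q : ℝ, 0 < p → 0 < q → Real.log ((3 * p + m) ^ 2 * ((5 * q + m) * (q + m))) =
        2 * Real.log (3 * p + m) + (Real.log (5 * q + m) + Real.log (q + m)) := by
      intro p q hp hq
      rw [Real.log_mul (by positivity) (by positivity), Real.log_pow,
        Real.log_mul (by positivity) (by positivity)]
      norm_num
    have e1 := e t u ht hu
    have e2 := e u t hu ht
    have key : (3 * u + m) ^ 2 * ((5 * t + m) * (t + m)) - (3 * t + m) ^ 2 * ((5 * u + m) * (u + m))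
        = 4 * m * (u - t) * (6 * t * u + m * (u + t)) := by ring
    have hut : 0 < u - t := sub_pos.2 htu
    refine ⟨?_, fun hm0 => ?_⟩
    · have := Real.log_le_log (by positivity)
        (sub_nonneg.1 (key ▸ (by positivity : 0 ≤ 4 * m * (u - t) * (6 * t * u + m * (u + t)))))
      linarith
    · have hm1 : (0 : ℝ) < m := Nat.cast_pos.2 hm0
      have := Real.log_lt_log (by positivity)
        (sub_pos.1 (key ▸ (by positivity : 0 < 4 * m * (u - t) * (6 * t * u + m * (u + t)))))
      linarith
  intro t ht u hu htu
  rw [mem_Ioi] at ht hu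
  have hG : ∀ {p : ℝ}, 0 < p → 0 < Real.Gamma p := fun hp => Real.Gamma_pos_of_pos hp
  set L : ℝ → ℝ := fun t => Real.log (Real.Gamma (5 * t)) + Real.log (Real.Gamma t) -
    2 * Real.log (Real.Gamma (3 * t)) with hL
  have hlim : ∀ t, 0 < t → Tendsto (fun n => ∑ m ∈ Finset.range (n + 1),
      (2 * Real.log (3 * t + m) - Real.log (5 * t + m) - Real.log (t + m))) atTop (𝓝 (L t)) := by
    intro t ht
    have h := ((Real.BohrMollerup.tendsto_log_gamma (by positivity : 0 < 5 * t)).add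
      (Real.BohrMollerup.tendsto_log_gamma ht)).sub
      ((Real.BohrMollerup.tendsto_log_gamma (by positivity : 0 < 3 * t)).const_mul 2)
    refine h.congr fun n => ?_
    simp only [Real.BohrMollerup.logGammaSeq, Finset.sum_sub_distrib, ← Finset.mul_sum]
    ring
  have hlt : L t < L u := by
    have h1 := (hθ 1 ht htu).2 one_pos
    have h := (hlim u hu).sub (hlim t ht)
    -- A strict inequality need not survive the limit, so the increment of the term `m = 1` is kept
    -- as a gap independent of `n`.
    have hge := ge_of_tendsto h (b := 2 * Real.log (3 * u + (1 : ℕ)) - Real.log (5 * u + (1 : ℕ)) -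
      Real.log (u + (1 : ℕ)) - (2 * Real.log (3 * t + (1 : ℕ)) - Real.log (5 * t + (1 : ℕ)) -
      Real.log (t + (1 : ℕ)))) (by
        filter_upwards [eventually_ge_atTop 1] with n hn
        rw [← Finset.sum_sub_distrib]
        exact Finset.single_le_sum (f := fun m : ℕ => 2 * Real.log (3 * u + m) -
          Real.log (5 * u + m) - Real.log (u + m) - (2 * Real.log (3 * t + m) -
          Real.log (5 * t + m) - Real.log (t + m)))
          (fun m _ => sub_nonneg.2 (hθ m ht htu).1) (Finset.mem_range.2 (by omega)))
    linarith
  have e : ∀ t, 0 < t →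
      Real.Gamma (5 * t) * Real.Gamma t / Real.Gamma (3 * t) ^ 2 = Real.exp (L t) := by
    intro t ht
    have h5 := hG (by positivity : 0 < 5 * t)
    have h3 := hG (by positivity : 0 < 3 * t)
    rw [hL]
    simp only
    rw [Real.exp_sub, Real.exp_add, Real.exp_log h5, Real.exp_log (hG ht), two_mul, Real.exp_add,
      Real.exp_log h3, sq]
  simp only [e t ht, e u hu]
  exact Real.exp_lt_exp.2 hlt

theorem strictAntiOn_kurtosis_ggdLaw : StrictAntiOn (fun β => kurtosis (ggdLaw β)) (Ioi 0) := by
  intro b hb c hc hbc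
  rw [mem_Ioi] at hb hc
  simp only [(isStandardised_ggdLaw hb).2, (isStandardised_ggdLaw hc).2]
  have h := strictMonoOn_Gamma_ratio (mem_Ioi.2 (one_div_pos.2 hc)) (mem_Ioi.2 (one_div_pos.2 hb))
    (one_div_lt_one_div_of_lt hb hbc)
  simpa only [mul_one_div] using h

/-! ### Generalised Gaussian: derivative in the shape, and the threshold on compact ranges -/

theorem incGamma_antitone {s y z : ℝ} (hs : 0 < s) (hy : 0 ≤ y) (hyz : y ≤ z) :
    incGamma s z ≤ incGamma s y := by
  refine setIntegral_mono_set ((integrableOn_incGamma hs).mono_set (Ioi_subset_Ioi hy)) ?_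
    (Ioi_subset_Ioi hyz).eventuallyLE
  filter_upwards [ae_restrict_mem measurableSet_Ioi] with x hx
  exact mul_nonneg (Real.rpow_nonneg (hy.trans (mem_Ioi.1 hx).le) _) (Real.exp_pos _).le

/-- Half of the derivative, with respect to the logarithm of the shape, of the logarithm of
`Γ (3 / β) ^ 3 / Γ (1 / β)`, expressed through shifted arguments. -/
noncomputable def ggdDrift (t : ℝ) : ℝ := 3 / 2 * (digamma (3 * t + 1) - digamma (t + 1))

/-- Up to the factor `2 Γ (t + 1)`, the derivative in `t = 1 / β` of the upper tail of the
standardised generalised Gaussian law at the point where `|x / a| ^ β = y`. -/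
noncomputable def ggdCore (t y : ℝ) : ℝ :=
  logIncGamma (t + 1) y - digamma (t + 1) * incGamma (t + 1) y -
    ggdDrift t * (y ^ t * Real.exp (-y))

/-- The logarithm of `|x / a| ^ β` for the standardised generalised Gaussian law, `t = 1 / β`. -/
noncomputable def ggdLogArg (x t : ℝ) : ℝ :=
  (Real.log x - (Real.log (Real.Gamma t) - Real.log (Real.Gamma (3 * t))) / 2) / t

theorem ggdMomentTail_eq {x t : ℝ} (hx : 0 < x) (ht : 0 < t) :
    ggdMomentTail (1 / t) (ggdScale (1 / t)) 0 x =
      incGamma t (Real.exp (ggdLogArg x t)) / (2 * Real.Gamma t) := by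
  have ha := ggdScale_pos (one_div_pos.2 ht)
  have h1 := Real.Gamma_pos_of_pos ht
  have h3 := Real.Gamma_pos_of_pos (by positivity : 0 < 3 * t)
  have e : (x / ggdScale (1 / t)) ^ (1 / t) = Real.exp (ggdLogArg x t) := by
    rw [Real.rpow_def_of_pos (div_pos hx ha), Real.log_div hx.ne' ha.ne', ggdScale, ggdLogArg,
      Real.log_sqrt (by positivity), one_div_one_div, div_div_eq_mul_div, div_one,
      Real.log_div h1.ne' h3.ne']
    ring_nf
  rw [ggdMomentTail, e]
  simp [div_eq_inv_mul]

theorem hasDerivAt_ggdLogArg {x t : ℝ} (ht : 0 < t) :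
    HasDerivAt (ggdLogArg x)
      (-((digamma t - 3 * digamma (3 * t)) / 2 + ggdLogArg x t) / t) t := by
  have h1 := hasDerivAt_log_Gamma ht
  have h3 : HasDerivAt (fun t => Real.log (Real.Gamma (3 * t))) (digamma (3 * t) * (3 * 1)) t :=
    (hasDerivAt_log_Gamma (by positivity : 0 < 3 * t)).comp t ((hasDerivAt_id t).const_mul 3)
  refine ((((h1.sub h3).div_const 2).const_sub (Real.log x)).div (hasDerivAt_id t)
    ht.ne').congr_deriv ?_
  simp only [ggdLogArg, id, Pi.sub_apply, Function.comp]
  field_simp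
  ring

/-- The quotient rule produces terms at order `t`; the recursions for `incGamma`, `logIncGamma` and
`digamma` absorb them into order `t + 1`, and the `1 / t` contributions cancel. -/
theorem hasDerivAt_ggdTail {x t : ℝ} (ht : 0 < t) :
    HasDerivAt (fun t => incGamma t (Real.exp (ggdLogArg x t)) / (2 * Real.Gamma t))
      (ggdCore t (Real.exp (ggdLogArg x t)) / (2 * Real.Gamma (t + 1))) t := by
  set y := Real.exp (ggdLogArg x t) with hydef
  have hy : 0 < y := Real.exp_pos _
  have hk : ∀ᶠ p : ℝ × ℝ in 𝓝 (t, y),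
      HasDerivAt (incGamma p.1) (-(p.2 ^ (p.1 - 1) * Real.exp (-p.2))) p.2 := by
    filter_upwards [(lt_mem_nhds ht).prod_nhds (lt_mem_nhds hy)] with p hp
    exact hasDerivAt_incGamma hp.1 hp.2
  have hc : ContinuousAt (fun p : ℝ × ℝ => -(p.2 ^ (p.1 - 1) * Real.exp (-p.2))) (t, y) := by
    refine ContinuousAt.neg (ContinuousAt.mul ?_ (by fun_prop))
    exact ContinuousAt.rpow (by fun_prop) (by fun_prop) (Or.inl hy.ne')
  have hd := hasDerivAt_param_comp (y := fun t => Real.exp (ggdLogArg x t))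
    (k := fun t y => -(y ^ (t - 1) * Real.exp (-y))) hk hc
    (hasDerivAt_incGamma_param ht hy.le).2 (hasDerivAt_ggdLogArg ht).exp
  have hG := Real.Gamma_pos_of_pos ht
  refine (hd.div ((hasDerivAt_Gamma_digamma ht).const_mul 2) (by positivity)).congr_deriv ?_
  rw [← hydef, ggdCore, ggdDrift, logIncGamma_add_one ht hy, incGamma_add_one ht hy,
    Real.Gamma_add_one ht.ne', digamma_add_one ht, digamma_add_one (by positivity : 0 < 3 * t)]
  have e : ggdLogArg x t = Real.log y := by rw [hydef, Real.log_exp]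
  have e2 : y ^ t = y ^ (t - 1) * y := by
    rw [← Real.rpow_add_one hy.ne']; simp
  rw [e, e2]
  field_simp
  ring

theorem hasDerivAt_ggdCore {t y : ℝ} (ht : 0 < t) (hy : 0 < y) :
    HasDerivAt (ggdCore t) (y ^ (t - 1) * Real.exp (-y) *
      -(y * Real.log y - (digamma (t + 1) + ggdDrift t) * y + ggdDrift t * t)) y := by
  have ht1 : 0 < t + 1 := by linarith
  refine (((hasDerivAt_logIncGamma ht1 hy).sub ((hasDerivAt_incGamma ht1 hy).const_mul _)).sub
    ((hasDerivAt_rpow_mul_exp_neg t hy).const_mul _)).congr_deriv ?_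
  have e2 : y ^ t = y ^ (t - 1) * y := by
    rw [← Real.rpow_add_one hy.ne']; simp
  rw [add_sub_cancel_right, e2]
  ring

theorem tendsto_ggdCore {t : ℝ} : Tendsto (ggdCore t) atTop (𝓝 0) := by
  have h := ((tendsto_logIncGamma (s := t + 1)).sub
    ((tendsto_incGamma (s := t + 1)).const_mul (digamma (t + 1)))).sub
    ((tendsto_rpow_mul_exp_neg t).const_mul (ggdDrift t))
  simp only [mul_zero, sub_zero] at h
  exact h

theorem tendsto_ggdCore_zero {t : ℝ} (ht : 0 < t) : Tendsto (ggdCore t) (𝓝[>] 0) (𝓝 0) := by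
  have ht1 : 0 < t + 1 := by linarith
  have hc : ContinuousWithinAt (ggdCore t) (Ici 0) 0 :=
    ((continuousOn_logIncGamma ht1 0 self_mem_Ici).sub
      ((continuousOn_incGamma ht1 0 self_mem_Ici).const_mul _)).sub
      (ContinuousAt.continuousWithinAt (ContinuousAt.const_mul
        ((Real.continuousAt_rpow_const _ _ (Or.inr ht.le)).mul (by fun_prop)) _))
  have h0 : ggdCore t 0 = 0 := by
    rw [ggdCore, logIncGamma_zero ht1, incGamma_zero ht1, Real.zero_rpow ht.ne']
    ring
  have := hc.tendsto.mono_left (nhdsWithin_mono 0 Ioi_subset_Ici_self)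
  rwa [h0] at this

/-- The core vanishes at zero and at infinity, and convexity of `y log y` makes the unweighted
factor of its derivative concave. Were it nonpositive at `z`, it would have to climb back towards
zero further out, which the sign lemma excludes. Hence one test point per shape suffices. -/
theorem ggdCore_pos_of_le {t y z : ℝ} (ht : 0 < t) (hy : 0 < y) (hyz : y ≤ z)
    (h : 0 < ggdCore t y) : 0 < ggdCore t z := by
  have hconv : ConcaveOn ℝ (Ioi 0) fun y : ℝ =>
      -(y * Real.log y - (digamma (t + 1) + ggdDrift t) * y + ggdDrift t * t) := by
    have h1 : ConvexOn ℝ (Ioi 0) fun y : ℝ => y * Real.log y :=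
      Real.convexOn_mul_log.subset Ioi_subset_Ici_self (convex_Ioi 0)
    have h2 : ConvexOn ℝ (Ioi 0) fun y : ℝ => -(digamma (t + 1) + ggdDrift t) * y + ggdDrift t * t :=
      ((LinearMap.mul ℝ ℝ (-(digamma (t + 1) + ggdDrift t))).convexOn (convex_Ioi 0)).add_const _
    refine (h1.add h2).neg.congr fun y _ => ?_
    simp only [Pi.neg_apply, Pi.add_apply]
    ring
  refine pos_of_hasDerivAt_mul_concaveOn (convex_Ioi (0 : ℝ))
    (fun y hy => hasDerivAt_ggdCore ht hy)
    (fun y hy => mul_pos (Real.rpow_pos_of_pos hy _) (Real.exp_pos _)) hconv hy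
    (mem_Ioi.2 (hy.trans_le hyz)) hyz h ?_ ?_
  · obtain ⟨x, h1, h2, h3⟩ := ((tendsto_ggdCore_zero ht).eventually (gt_mem_nhds h) |>.and
      (Ioo_mem_nhdsGT hy)).exists
    exact ⟨x, h2, h3, h1⟩
  · intro hz
    have hz0 : 0 < z := hy.trans_le hyz
    rcases le_or_gt (ggdCore t z) (ggdCore t (z + 1)) with h1 | h1
    · exact ⟨z, hz0, z + 1, by simp; linarith, le_rfl, by linarith, h1⟩
    · obtain ⟨q, h2, h3⟩ := ((tendsto_ggdCore (t := t)).eventually (lt_mem_nhds (h1.trans_le hz))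
        |>.and (eventually_gt_atTop (z + 1))).exists
      exact ⟨z + 1, by simp; linarith, q, by simp; linarith, by linarith, h3, h2.le⟩

theorem ggdDrift_nonneg {t : ℝ} (ht : 0 < t) : 0 ≤ ggdDrift t :=
  mul_nonneg (by norm_num) (sub_nonneg.2
    (monotoneOn_digamma (by simp; linarith) (by simp; linarith) (by linarith)))

/-- Beyond the outer zero of an explicit convex function the derivative is positive. -/
theorem ggdCore_pos_of_le_log {t y : ℝ} (ht : 0 < t) (hy : 0 < y)
    (h : digamma (t + 1) + ggdDrift t ≤ Real.log y) (hpos : 0 < Real.log y - digamma (t + 1)) :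
    0 < ggdCore t y := by
  have h1 := log_mul_incGamma_le (by linarith : 0 < t + 1) hy
  have h2 := incGamma_add_one ht hy
  have h3 := mul_pos ht (incGamma_pos ht hy.le)
  have h4 : 0 < y ^ t * Real.exp (-y) := by positivity
  have h5 : 0 < (Real.log y - digamma (t + 1)) * (t * incGamma t y) := mul_pos hpos h3
  have h6 : ggdDrift t * (y ^ t * Real.exp (-y)) ≤
      (Real.log y - digamma (t + 1)) * (y ^ t * Real.exp (-y)) := by
    gcongr
    linarith
  rw [ggdCore]
  have h7 : (Real.log y - digamma (t + 1)) * incGamma (t + 1) y =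
      (Real.log y - digamma (t + 1)) * (t * incGamma t y) +
      (Real.log y - digamma (t + 1)) * (y ^ t * Real.exp (-y)) := by rw [h2]; ring
  linarith

/-- At the radius of the law with the larger shape `c`, the tail is followed as `t` goes from `1 /
c` to `1 / b`. It starts at `τ / 2`, below the level `τs / 2`. Below that level, monotonicity of
`incGamma` puts the rescaled point beyond the test point, so the tail increases. -/
theorem tailRadiusStrictMono_ggdLaw {b₁ b₂ τs : ℝ} (hb : 0 < b₁) (hτs : τs ≤ 1)
    (h : ∀ t ∈ Icc (1 / b₂) (1 / b₁), ∃ y, 0 < y ∧ τs * Real.Gamma t ≤ incGamma t y ∧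
      ∀ z, y ≤ z → 0 < ggdCore t z) {τ : ℝ} (hτ : τ ∈ Ioo 0 τs) :
    TailRadiusStrictMonoInKurtosis ggdLaw (Icc b₁ b₂) τ := by
  refine tailRadiusStrictMonoInKurtosis_of_strictAntiOn
    (strictAntiOn_kurtosis_ggdLaw.mono fun b hb' => hb.trans_le hb'.1) ?_
  intro b hbm c hcm hbc
  have hb0 : 0 < b := hb.trans_le hbm.1
  have hc0 : 0 < c := hb.trans_le hcm.1
  have hτ1 : τ ∈ Ioo (0 : ℝ) 1 := ⟨hτ.1, hτ.2.trans_le hτs⟩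
  have hx := (hasTail_ggdLaw hc0).tailRadius_pos hτ1
  have hTx := (hasTail_ggdLaw hc0).apply_tailRadius hτ1
  set x := tailRadius (ggdLaw c) τ
  have hbt : 0 < 1 / b := one_div_pos.2 hb0
  have hct : 0 < 1 / c := one_div_pos.2 hc0
  have hec := ggdMomentTail_eq hx hct
  have heb := ggdMomentTail_eq hx hbt
  rw [one_div_one_div] at hec heb
  refine (hasTail_ggdLaw hb0).lt_tailRadius hτ1 hx.le ?_
  rw [← hTx, hec, heb]
  refine lt_of_deriv_pos_of_lt (σ := τs / 2) (one_div_lt_one_div_of_lt hb0 hbc)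
    (fun t ht => hasDerivAt_ggdTail (hct.trans_le ht.1)) ?_ ?_
  · rw [← hec, hTx]
    linarith [hτ.2]
  · intro t ht hlt
    have ht0 : 0 < t := hct.trans_le ht.1
    have hG := Real.Gamma_pos_of_pos ht0
    obtain ⟨y, hy, hle, hcore⟩ := h t ⟨(one_div_le_one_div_of_le hc0 hcm.2).trans ht.1,
      ht.2.trans (one_div_le_one_div_of_le hb hbm.1)⟩
    refine div_pos (hcore _ ?_) (mul_pos two_pos (Real.Gamma_pos_of_pos (by linarith)))
    by_contra! hcon
    have := incGamma_antitone ht0 (Real.exp_pos _).le hcon.le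
    rw [div_lt_iff₀ (by positivity)] at hlt
    linarith

theorem exists_threshold_ggdLaw {b₁ b₂ : ℝ} (hb : 0 < b₁) (hb₂ : b₁ ≤ b₂) :
    ∃ τs : ℝ, 0 < τs ∧ ∀ τ ∈ Ioo 0 τs, TailRadiusStrictMonoInKurtosis ggdLaw (Icc b₁ b₂) τ := by
  have hb₂0 : 0 < b₂ := hb.trans_le hb₂
  have h0 : 0 < 1 / b₂ := one_div_pos.2 hb₂0
  have hne : (Icc (1 / b₂) (1 / b₁)).Nonempty := nonempty_Icc.2 (one_div_le_one_div_of_le hb hb₂)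
  set u := 1 / b₁
  -- Monotonicity of `digamma` makes `B - 1` a uniform bound for `digamma (t + 1) + ggdDrift t` on
  -- the range; the extra one gives the strict inequality needed for a positive core.
  set B := digamma (u + 1) + 3 / 2 * (digamma (3 * u + 1) - digamma 1) + 1 with hB
  set Y := Real.exp B
  have hc : ContinuousOn (fun t => incGamma t Y / Real.Gamma t) (Icc (1 / b₂) u) := by
    intro t ht
    have ht0 : 0 < t := h0.trans_le ht.1
    exact ((hasDerivAt_incGamma_param ht0 (Real.exp_pos _).le).2.continuousAt.div
      (hasDerivAt_Gamma_digamma ht0).continuousAt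
      (Real.Gamma_pos_of_pos ht0).ne').continuousWithinAt
  obtain ⟨t₀, ht₀, hmin⟩ := isCompact_Icc.exists_isMinOn hne hc
  have ht₀0 : 0 < t₀ := h0.trans_le ht₀.1
  refine ⟨min 1 (incGamma t₀ Y / Real.Gamma t₀), lt_min one_pos
    (div_pos (incGamma_pos ht₀0 (Real.exp_pos _).le) (Real.Gamma_pos_of_pos ht₀0)),
    fun τ hτ => tailRadiusStrictMono_ggdLaw hb (min_le_left _ _) (fun t ht => ?_) hτ⟩
  have ht0 : 0 < t := h0.trans_le ht.1
  refine ⟨Y, Real.exp_pos _, ?_, fun z hz => ?_⟩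
  · rw [← le_div_iff₀ (Real.Gamma_pos_of_pos ht0)]
    exact (min_le_right _ _).trans (hmin ht)
  · have hz0 : 0 < z := (Real.exp_pos _).trans_le hz
    have hlz : B ≤ Real.log z := by
      rw [Real.le_log_iff_exp_le hz0]
      exact hz
    have m1 : digamma (t + 1) ≤ digamma (u + 1) :=
      monotoneOn_digamma (by simp; linarith) (by simp; linarith [ht.2]) (by linarith [ht.2])
    have m2 : digamma (3 * t + 1) ≤ digamma (3 * u + 1) :=
      monotoneOn_digamma (by simp; linarith) (by simp; linarith [ht.2]) (by linarith [ht.2])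
    have m3 : digamma 1 ≤ digamma (t + 1) :=
      monotoneOn_digamma (by simp) (by simp; linarith) (by linarith)
    have hd := ggdDrift_nonneg ht0
    have hd2 : ggdDrift t ≤ 3 / 2 * (digamma (3 * u + 1) - digamma 1) := by
      rw [ggdDrift]
      linarith
    refine ggdCore_pos_of_le_log ht0 hz0 ?_ ?_ <;> linarith

/-! ### Generalised Gaussian: positive core at explicit test points -/

theorem Gamma_le_one {s : ℝ} (h1 : 1 ≤ s) (h2 : s ≤ 2) : Real.Gamma s ≤ 1 := by
  have h := Real.convexOn_Gamma.le_max_of_mem_Icc (x := 1) (y := 2) (z := s) (by simp) (by simp)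
    ⟨h1, h2⟩
  simpa [Real.Gamma_two] using h

/-- Lower bound for the core function in terms of lower bounds for the incomplete Gamma
functions, relative to `y ^ t * exp (-y)`. -/
theorem ggdCore_pos_of_bounds {t c m n lc p q : ℝ} (ht : 0 < t) (hc : 1 ≤ c)
    (hm : m * ((c * t) ^ t * Real.exp (-(c * t))) ≤ incGamma t (c * t))
    (hn : Real.log (c * t) * incGamma t (c * t) + n * ((c * t) ^ t * Real.exp (-(c * t))) ≤
      logIncGamma t (c * t))
    (hlc : lc ≤ Real.log c) (hp : Real.log t + p ≤ digamma (t + 1))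
    (hq : digamma (3 * t + 1) ≤ Real.log t + q) (hm0 : 0 ≤ m) (hm1 : t * m ≤ 1 / 2)
    (h : 0 < m + (1 + t * m) * lc + (1 / 2 - t * m) * p - 3 / 2 * q + t * n) :
    0 < ggdCore t (c * t) := by
  have hy : 0 < c * t := by positivity
  have hP : 0 < (c * t) ^ t * Real.exp (-(c * t)) := by positivity
  have hlog : Real.log (c * t) = Real.log c + Real.log t :=
    Real.log_mul (by positivity) ht.ne'
  have hlc0 : 0 ≤ Real.log c := Real.log_nonneg hc
  have hfac : 0 ≤ 1 + t * (Real.log (c * t) - digamma (t + 1)) := by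
    have h1 := digamma_le_log ht
    have h2 : t * (1 / t) = 1 := mul_one_div_cancel ht.ne'
    rw [digamma_add_one ht, hlog]
    -- The factor equals `t * (log c + log t - digamma t)`, which is nonnegative; so the lower bound
    -- `m` may replace the incomplete Gamma function.
    nlinarith [mul_nonneg ht.le hlc0, mul_nonneg ht.le (sub_nonneg.2 h1)]
  rw [ggdCore, ggdDrift, logIncGamma_add_one ht hy, incGamma_add_one ht hy]
  generalize (c * t) ^ t * Real.exp (-(c * t)) = P at *
  generalize incGamma t (c * t) = G at *
  generalize logIncGamma t (c * t) = J at *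
  rw [hlog] at *
  generalize digamma (t + 1) = ψ at *
  generalize digamma (3 * t + 1) = ψ₃ at *
  have h1 := mul_le_mul_of_nonneg_left hm hfac
  have h2 := mul_le_mul_of_nonneg_left hn ht.le
  have h3 : (1 + t * m) * lc ≤ (1 + t * m) * Real.log c := by gcongr
  have h4 : (1 / 2 - t * m) * (Real.log t + p) ≤ (1 / 2 - t * m) * ψ :=
    mul_le_mul_of_nonneg_left hp (by linarith)
  -- The coefficients `1 + t m`, `1/2 - t m` and `-3/2` of `log t` add up to zero, so only the
  -- corrections `p`, `q` and `log c` remain.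
  have h5 : 0 < m + (1 + t * m) * (Real.log c + Real.log t) + (1 / 2 - t * m) * ψ - 3 / 2 * ψ₃ +
      t * n := by
    nlinarith
  have h6 := mul_pos hP h5
  nlinarith

theorem log_add_le_digamma_three_mul {t : ℝ} (ht : 1 / 10 ≤ t) :
    digamma (3 * t + 1) ≤ Real.log t + (1.0987 + 1 / (6 * t + 1 / 3)) := by
  have h := digamma_add_one_le (s := 3 * t) (by linarith)
  rw [Real.log_mul (by norm_num) (by linarith), show 2 * (3 * t) = 6 * t by ring] at h
  linarith [log_three_lt]

/-- Here `m` is the first convergent at `y = c t` divided by `y ^ t * exp (-y)`, and bounding `log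
x` below by `log y` in the integral is enough, so `n = 0`. -/
theorem ggdCore_pos_of_le_one {t c lc : ℝ} (ht : 1 / 10 ≤ t) (ht1 : t ≤ 1) (hc : 3 ≤ c)
    (hlc : lc ≤ Real.log c)
    (h : 0 < 1 / ((c - 1) * t + 1) + (1 + t * (1 / ((c - 1) * t + 1))) * lc +
      (1 / 2 - t * (1 / ((c - 1) * t + 1))) * (1 / (2 * t + 1 / 2)) -
      3 / 2 * (1.0987 + 1 / (6 * t + 1 / 3))) : 0 < ggdCore t (c * t) := by
  have ht0 : 0 < t := by linarith
  have hy : 0 < c * t := by positivity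
  have hD : 0 < (c - 1) * t + 1 := by nlinarith
  refine ggdCore_pos_of_bounds (m := 1 / ((c - 1) * t + 1)) (n := 0) ht0 (by linarith) ?_ ?_ hlc
    (digamma_add_one_ge ht0) (log_add_le_digamma_three_mul ht) (by positivity) ?_ (by linarith)
  · have := incGamma_ge_of_le_one ht0 ht1 hy
    rw [one_div_mul_eq_div]
    rwa [show (c - 1) * t + 1 = c * t + 1 - t by ring]
  · rw [zero_mul, add_zero]
    exact log_mul_incGamma_le ht0 hy
  · rw [mul_one_div, div_le_div_iff₀ hD two_pos]
    nlinarith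

theorem lt_log_seven_halves : 1.2527 < Real.log 3.5 := by
  rw [show (3.5 : ℝ) = 7 / 2 by norm_num, Real.log_div (by norm_num) (by norm_num)]
  linarith [lt_log_seven, Real.log_two_lt_d9]

theorem lt_log_nine_halves : 1.504 < Real.log 4.5 := by
  rw [show (4.5 : ℝ) = 3 ^ 2 / 2 by norm_num, Real.log_div (by norm_num) (by norm_num),
    Real.log_pow]
  push_cast
  linarith [lt_log_three, Real.log_two_lt_d9]

theorem lt_log_twenty_nine_tenths : 1.0646 < Real.log 2.9 := by
  have h2 : Real.log (30 / 29) = Real.log 3 - Real.log 2.9 := by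
    rw [← Real.log_div (by norm_num) (by norm_num)]
    norm_num
  have h3 := log_one_add_inv_le (s := 29) (by norm_num) rfl
  norm_num at h3
  norm_num at h2 ⊢
  linarith [lt_log_three]

theorem ggdCore_pos_seven {t : ℝ} (h1 : 1 / 10 ≤ t) (h2 : t ≤ 1 / 5) : 0 < ggdCore t (7 * t) := by
  refine ggdCore_pos_of_le_one h1 (by linarith) (by norm_num) lt_log_seven.le ?_
  -- With the left endpoint as origin, all coefficients of the cleared numerator are positive. The
  -- next test points use the same device.
  obtain ⟨x, hx, rfl⟩ : ∃ x : ℝ, 0 ≤ x ∧ t = 1 / 10 + x := ⟨t - 1 / 10, by linarith, by ring⟩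
  have e : 1 / ((7 - 1) * (1 / 10 + x) + 1) + (1 + (1 / 10 + x) * (1 / ((7 - 1) * (1 / 10 + x) + 1)))
      * 1.9459 + (1 / 2 - (1 / 10 + x) * (1 / ((7 - 1) * (1 / 10 + x) + 1))) *
        (1 / (2 * (1 / 10 + x) + 1 / 2)) - 3 / 2 * (1.0987 + 1 / (6 * (1 / 10 + x) + 1 / 3)) =
      (0.390908 + 45.26322 * x + 220.204 * x ^ 2 + 268.776 * x ^ 3) /
        ((1 + 6 * (1 / 10 + x)) * (1 + 4 * (1 / 10 + x)) * (1 + 18 * (1 / 10 + x))) := by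
    field_simp
    ring
  rw [e]
  positivity

theorem ggdCore_pos_nine_halves {t : ℝ} (h1 : 1 / 5 ≤ t) (h2 : t ≤ 1 / 2) :
    0 < ggdCore t (4.5 * t) := by
  refine ggdCore_pos_of_le_one (by linarith) (by linarith) (by norm_num) lt_log_nine_halves.le ?_
  obtain ⟨x, hx, rfl⟩ : ∃ x : ℝ, 0 ≤ x ∧ t = 1 / 5 + x := ⟨t - 1 / 5, by linarith, by ring⟩
  have e : 1 / ((4.5 - 1) * (1 / 5 + x) + 1) + (1 + (1 / 5 + x) * (1 / ((4.5 - 1) * (1 / 5 + x) + 1)))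
      * 1.504 + (1 / 2 - (1 / 5 + x) * (1 / ((4.5 - 1) * (1 / 5 + x) + 1))) *
        (1 / (2 * (1 / 5 + x) + 1 / 2)) - 3 / 2 * (1.0987 + 1 / (6 * (1 / 5 + x) + 1 / 3)) =
      (0.9529762 + 33.269033 * x + 90.81699 * x ^ 2 + 71.9874 * x ^ 3) /
        ((1 + 3.5 * (1 / 5 + x)) * (1 + 4 * (1 / 5 + x)) * (1 + 18 * (1 / 5 + x))) := by
    norm_num
    field_simp
    ring
  rw [e]
  positivity

theorem ggdCore_pos_seven_halves {t : ℝ} (h1 : 1 / 2 ≤ t) (h2 : t ≤ 1) :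
    0 < ggdCore t (3.5 * t) := by
  refine ggdCore_pos_of_le_one (by linarith) (by linarith) (by norm_num) lt_log_seven_halves.le ?_
  obtain ⟨x, hx, rfl⟩ : ∃ x : ℝ, 0 ≤ x ∧ t = 1 / 2 + x := ⟨t - 1 / 2, by linarith, by ring⟩
  have e : 1 / ((3.5 - 1) * (1 / 2 + x) + 1) + (1 + (1 / 2 + x) * (1 / ((3.5 - 1) * (1 / 2 + x) + 1)))
      * 1.2527 + (1 / 2 - (1 / 2 + x) * (1 / ((3.5 - 1) * (1 / 2 + x) + 1))) *
        (1 / (2 * (1 / 2 + x) + 1 / 2)) - 3 / 2 * (1.0987 + 1 / (6 * (1 / 2 + x) + 1 / 3)) =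
      (4.229375 + 30.440125 * x + 41.89705 * x ^ 2 + 19.0314 * x ^ 3) /
        ((1 + 2.5 * (1 / 2 + x)) * (1 + 4 * (1 / 2 + x)) * (1 + 18 * (1 / 2 + x))) := by
    norm_num
    field_simp
    ring
  rw [e]
  positivity

theorem incGamma_ge_mul {t c : ℝ} (h1 : 1 ≤ t) (h2 : t ≤ 2) (hc : 0 < c) :
    (c * t + 1) / (c * t * (c * t + 2 - t)) * ((c * t) ^ t * Real.exp (-(c * t))) ≤
      incGamma t (c * t) := by
  have hy : 0 < c * t := by positivity
  have hD : 0 < c * t + 2 - t := by linarith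
  refine le_trans (le_of_eq ?_) (incGamma_ge_of_one_le h1 h2 hy)
  rw [Real.rpow_sub_one hy.ne']
  field_simp

theorem ggdCore_pos_of_one_le {t : ℝ} (h1 : 1 ≤ t) (h2 : t ≤ 2) : 0 < ggdCore t (2.9 * t) := by
  have ht0 : 0 < t := by linarith
  have hy : 0 < 2.9 * t := by positivity
  have hD : 0 < 2.9 * t + 2 - t := by linarith
  -- The logarithmic excess `n` cannot be dropped here: without it the lower bound is already
  -- negative at `t = 1`.
  refine ggdCore_pos_of_bounds (m := (2.9 * t + 1) / (2.9 * t * (2.9 * t + 2 - t)))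
    (n := 1 / (2.9 * t * (2.9 * t + 2 - t))) ht0 (by norm_num)
    (incGamma_ge_mul h1 h2 (by norm_num)) ?_ lt_log_twenty_nine_tenths.le
    (digamma_add_one_ge ht0) (log_add_le_digamma_three_mul (by linarith)) (by positivity) ?_ ?_
  · refine le_trans (le_of_eq ?_) (log_mul_incGamma_add_le h1 h2 hy)
    rw [Real.rpow_sub_one hy.ne']
    field_simp
  · rw [← mul_div_assoc, div_le_div_iff₀ (by positivity) two_pos]
    nlinarith
  · obtain ⟨x, hx, rfl⟩ : ∃ x : ℝ, 0 ≤ x ∧ t = 1 + x := ⟨t - 1, by linarith, by ring⟩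
    have hx1 : x ≤ 1 := by linarith
    have e0 : 2.9 * (1 + x) + 2 - (1 + x) = 2 + 1.9 * (1 + x) := by ring
    rw [e0]
    have e : (2.9 * (1 + x) + 1) / (2.9 * (1 + x) * (2 + 1.9 * (1 + x))) +
        (1 + (1 + x) * ((2.9 * (1 + x) + 1) / (2.9 * (1 + x) * (2 + 1.9 * (1 + x))))) * 1.0646 +
        (1 / 2 - (1 + x) * ((2.9 * (1 + x) + 1) / (2.9 * (1 + x) * (2 + 1.9 * (1 + x))))) *
          (1 / (2 * (1 + x) + 1 / 2)) - 3 / 2 * (1.0987 + 1 / (6 * (1 + x) + 1 / 3)) +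
        (1 + x) * (1 / (2.9 * (1 + x) * (2 + 1.9 * (1 + x)))) =
        (45.2614475 + 75.484848 * x + 10.2881395 * x ^ 2 - 30.113065 * x ^ 3 - 9.177804 * x ^ 4) /
          (2.9 * (1 + x) * (2 + 1.9 * (1 + x)) * (1 + 4 * (1 + x)) * (1 + 18 * (1 + x))) := by
      norm_num
      field_simp
      ring
    rw [e]
    have h3 : x ^ 3 ≤ 1 := pow_le_one₀ hx hx1
    have h4 : x ^ 4 ≤ 1 := pow_le_one₀ hx hx1
    refine div_pos ?_ (by positivity)
    nlinarith [sq_nonneg x]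

/-- For test points near the origin. The part of the core without drift is the integral over `(0,
y)` of `z ^ t (ψ - log z) exp (-z)`, whose integrand is nonnegative when `log y ≤ ψ`. Replacing `exp
(-z)` by `exp (-y)` leaves the elementary integral `V`. -/
theorem ggdCore_pos_of_log_le {t y : ℝ} (ht : 0 < t) (hy : 0 < y)
    (hl : Real.log y ≤ digamma (t + 1))
    (h : ggdDrift t < y * ((digamma (t + 1) - Real.log y) / (t + 1) + 1 / (t + 1) ^ 2)) :
    0 < ggdCore t y := by
  have ht1 : 0 < t + 1 := by linarith
  set ψ := digamma (t + 1) with hψ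
  set V : ℝ → ℝ := fun z => z ^ t * ((ψ * z - z * Real.log z) / (t + 1) + z / (t + 1) ^ 2) with hV
  have hVd : ∀ z, 0 < z → HasDerivAt V (z ^ t * (ψ - Real.log z)) z := by
    intro z hz
    have h1 := Real.hasDerivAt_rpow_const (p := t) (Or.inl hz.ne')
    have h2 : HasDerivAt (fun z => (ψ * z - z * Real.log z) / (t + 1) + z / (t + 1) ^ 2)
        ((ψ * 1 - (1 * Real.log z + z * z⁻¹)) / (t + 1) + 1 / (t + 1) ^ 2) z :=
      ((((hasDerivAt_id z).const_mul ψ).sub ((hasDerivAt_id z).mul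
        (Real.hasDerivAt_log hz.ne'))).div_const _).add ((hasDerivAt_id z).div_const _)
    refine (h1.mul h2).congr_deriv ?_
    rw [Real.rpow_sub_one hz.ne']
    field_simp
    ring
  have hmono : MonotoneOn (fun z => logIncGamma (t + 1) z - ψ * incGamma (t + 1) z -
      Real.exp (-y) * V z) (Icc 0 y) := by
    refine monotoneOn_of_deriv_nonneg (convex_Icc 0 y) ?_ ?_ ?_
    · refine ContinuousOn.mono (s := Ici 0) ?_ Icc_subset_Ici_self
      refine ((continuousOn_logIncGamma ht1).sub ((continuousOn_incGamma ht1).const_smul ψ)).sub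
        (Continuous.continuousOn (continuous_const.mul ?_))
      refine (Real.continuous_rpow_const ht.le).mul ?_
      exact ((((continuous_id.const_smul ψ).sub Real.continuous_mul_log).div_const _).add
        (continuous_id.div_const _))
    all_goals
      intro z hz
      rw [interior_Icc] at hz
      have hd := ((hasDerivAt_logIncGamma ht1 hz.1).sub
        ((hasDerivAt_incGamma ht1 hz.1).const_mul ψ)).sub ((hVd z hz.1).const_mul (Real.exp (-y)))
    · exact hd.differentiableAt.differentiableWithinAt
    · erw [hd.deriv]
      have e1 : Real.exp (-y) ≤ Real.exp (-z) := Real.exp_le_exp.2 (by linarith [hz.2])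
      have e2 : Real.log z ≤ Real.log y := Real.log_le_log hz.1 hz.2.le
      have e3 : 0 ≤ z ^ t * ((ψ - Real.log z) * (Real.exp (-z) - Real.exp (-y))) :=
        mul_nonneg (Real.rpow_nonneg hz.1.le _)
          (mul_nonneg (by linarith) (by linarith))
      rw [add_sub_cancel_right]
      linarith
  have h0 := hmono (left_mem_Icc.2 hy.le) (right_mem_Icc.2 hy.le) hy.le
  have hV0 : V 0 = 0 := by simp [hV]
  simp only [hV0, logIncGamma_zero ht1, incGamma_zero ht1] at h0
  have hP : 0 < y ^ t * Real.exp (-y) := by positivity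
  have h1 := mul_lt_mul_of_pos_right h hP
  have h2 : y * ((ψ - Real.log y) / (t + 1) + 1 / (t + 1) ^ 2) * (y ^ t * Real.exp (-y)) =
      Real.exp (-y) * V y := by
    simp only [hV]
    ring
  rw [ggdCore]
  linarith

/-- The digamma bounds are applied one unit further out, where they are sharper and the condition `3
/ 10 ≤ s` is automatic. The remaining logarithm is bounded by `log r ≤ sinh (log r) = (r - 1 / r) /
2`. -/
theorem ggdDrift_le {t : ℝ} (ht : 0 < t) :
    ggdDrift t ≤ 3 / 2 * (((3 * t + 1) / (t + 1) - (t + 1) / (3 * t + 1)) / 2 - 1 / (3 * t + 1) +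
      1 / (6 * t + 7 / 3) + 1 / (t + 1) - 1 / (2 * t + 5 / 2)) := by
  have h1 := digamma_add_one_le (s := 3 * t + 1) (by linarith)
  have h2 := digamma_add_one_ge (s := t + 1) (by linarith)
  rw [digamma_add_one (by linarith)] at h1 h2
  have h3 : Real.log ((3 * t + 1) / (t + 1)) ≤
      ((3 * t + 1) / (t + 1) - (t + 1) / (3 * t + 1)) / 2 := by
    have hr : (1 : ℝ) ≤ (3 * t + 1) / (t + 1) := by
      rw [le_div_iff₀ (by linarith)]
      linarith
    have := Real.self_le_sinh_iff.2 (Real.log_nonneg hr)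
    rwa [Real.sinh_log (by positivity), inv_div] at this
  rw [Real.log_div (by positivity) (by positivity)] at h3
  rw [show 2 * (3 * t + 1) + 1 / 3 = 6 * t + 7 / 3 by ring] at h1
  rw [show 2 * (t + 1) + 1 / 2 = 2 * t + 5 / 2 by ring] at h2
  rw [ggdDrift]
  linarith

theorem log_five_lt : Real.log 5 < 1.6095 := by
  have h := log_one_add_inv_le (s := 4) (by norm_num) rfl
  have h2 : Real.log (5 / 4) = Real.log 5 - 2 * Real.log 2 := by
    rw [Real.log_div (by norm_num) (by norm_num), show (4 : ℝ) = 2 ^ 2 by norm_num, Real.log_pow]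
    norm_num
  norm_num at h
  linarith [Real.log_two_lt_d9]

theorem lt_log_five : 1.6094 < Real.log 5 := by
  have h := log_one_add_inv_ge (s := 4) (by norm_num) 3
  have h2 : Real.log (5 / 4) = Real.log 5 - 2 * Real.log 2 := by
    rw [Real.log_div (by norm_num) (by norm_num), show (4 : ℝ) = 2 ^ 2 by norm_num, Real.log_pow]
    norm_num
  norm_num [Finset.sum_range_succ] at h
  linarith [Real.log_two_gt_d9]

theorem log_two_fifths_bounds : -0.9164 ≤ Real.log 0.4 ∧ Real.log 0.4 ≤ -0.916 := by
  rw [show (0.4 : ℝ) = 2 / 5 by norm_num, Real.log_div (by norm_num) (by norm_num)]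
  constructor
  · linarith [Real.log_two_gt_d9, log_five_lt]
  · linarith [Real.log_two_lt_d9, lt_log_five]

theorem log_nine_fiftieths_le : Real.log 0.18 ≤ -1.71 := by
  rw [show (0.18 : ℝ) = 3 ^ 2 / (2 * 5 ^ 2) by norm_num, Real.log_div (by norm_num) (by norm_num),
    Real.log_mul (by norm_num) (by norm_num), Real.log_pow, Real.log_pow]
  push_cast
  linarith [Real.log_two_gt_d9, lt_log_five, log_three_lt]

theorem ggdCore_pos_nine_fiftieths {t : ℝ} (ht : 0 < t) (h2 : t ≤ 1 / 20) :
    0 < ggdCore t 0.18 := by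
  have h1 := neg_three_fifths_le_digamma (s := t + 1) (by linarith)
  have hl := log_nine_fiftieths_le
  refine ggdCore_pos_of_log_le ht (by norm_num) (by linarith) ((ggdDrift_le ht).trans_lt ?_)
  have h3 : (0.18 : ℝ) * ((-(3 / 5) + 1.71) / (t + 1) + 1 / (t + 1) ^ 2) ≤
      0.18 * ((digamma (t + 1) - Real.log 0.18) / (t + 1) + 1 / (t + 1) ^ 2) := by
    gcongr
    linarith
  refine lt_of_lt_of_le ?_ h3
  rw [← sub_pos]
  have e : (0.18 : ℝ) * ((-(3 / 5) + 1.71) / (t + 1) + 1 / (t + 1) ^ 2) -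
      3 / 2 * (((3 * t + 1) / (t + 1) - (t + 1) / (3 * t + 1)) / 2 - 1 / (3 * t + 1) +
      1 / (6 * t + 7 / 3) + 1 / (t + 1) - 1 / (2 * t + 5 / 2)) =
      (11793 / 1000 - 224529 / 2500 * t - 3760749 / 5000 * t ^ 2 - 4108371 / 2500 * t ^ 3 -
        888027 / 625 * t ^ 4 - 432 * t ^ 5) /
        ((1 + t) ^ 2 * (1 + 3 * t) * (7 + 18 * t) * (5 + 4 * t)) := by
    norm_num
    field_simp
    ring
  rw [e]
  refine div_pos ?_ (by positivity)
  have p2 := pow_le_pow_left₀ ht.le h2 2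
  have p3 := pow_le_pow_left₀ ht.le h2 3
  have p4 := pow_le_pow_left₀ ht.le h2 4
  have p5 := pow_le_pow_left₀ ht.le h2 5
  norm_num at p2 p3 p4 p5
  linarith

theorem ggdCore_pos_two_fifths {t : ℝ} (ht : 0 < t) (h2 : t ≤ 1 / 10) :
    0 < ggdCore t 0.4 := by
  have h1 := neg_three_fifths_le_digamma (s := t + 1) (by linarith)
  have hl := log_two_fifths_bounds.2
  refine ggdCore_pos_of_log_le ht (by norm_num) (by linarith) ((ggdDrift_le ht).trans_lt ?_)
  have h3 : (0.4 : ℝ) * ((-(3 / 5) + 0.916) / (t + 1) + 1 / (t + 1) ^ 2) ≤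
      0.4 * ((digamma (t + 1) - Real.log 0.4) / (t + 1) + 1 / (t + 1) ^ 2) := by
    gcongr
    linarith
  refine lt_of_lt_of_le ?_ h3
  rw [← sub_pos]
  have e : (0.4 : ℝ) * ((-(3 / 5) + 0.916) / (t + 1) + 1 / (t + 1) ^ 2) -
      3 / 2 * (((3 * t + 1) / (t + 1) - (t + 1) / (3 * t + 1)) / 2 - 1 / (3 * t + 1) +
      1 / (6 * t + 7 / 3) + 1 / (t + 1) - 1 / (2 * t + 5 / 2)) =
      (4231 / 250 - 74611 / 1250 * t - 882583 / 1250 * t ^ 2 - 2053689 / 1250 * t ^ 3 -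
        897936 / 625 * t ^ 4 - 432 * t ^ 5) /
        ((1 + t) ^ 2 * (1 + 3 * t) * (7 + 18 * t) * (5 + 4 * t)) := by
    norm_num
    field_simp
    ring
  rw [e]
  refine div_pos ?_ (by positivity)
  have p2 := pow_le_pow_left₀ ht.le h2 2
  have p3 := pow_le_pow_left₀ ht.le h2 3
  have p4 := pow_le_pow_left₀ ht.le h2 4
  have p5 := pow_le_pow_left₀ ht.le h2 5
  norm_num at p2 p3 p4 p5
  linarith

/-! ### Generalised Gaussian: tail level at the test points -/

theorem mul_Gamma_le_of_le {t σ G : ℝ} (ht : 0 < t) (ht1 : t ≤ 1) (hσ : 0 ≤ σ) (h : σ ≤ t * G) :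
    σ * Real.Gamma t ≤ G := by
  have h1 := Gamma_le_one (s := t + 1) (by linarith) (by linarith)
  rw [Real.Gamma_add_one ht.ne'] at h1
  have h2 := mul_le_mul_of_nonneg_left h1 hσ
  have h3 : t * (σ * Real.Gamma t) ≤ t * G := by linarith
  exact le_of_mul_le_mul_left h3 ht

/-- The convex function `t log t` lies above its tangent at `b`, which makes the exponent affine in
`t`. -/
theorem rpow_mul_exp_neg_ge {t b c : ℝ} (ht : 0 < t) (hb : 0 < b) (hc : 0 < c) :
    Real.exp (t * (Real.log (c * b) + 1 - c) - b) ≤ (c * t) ^ t * Real.exp (-(c * t)) := by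
  have h1 := Real.log_le_sub_one_of_pos (div_pos hb ht)
  rw [Real.log_div hb.ne' ht.ne'] at h1
  have h2 := mul_le_mul_of_nonneg_left h1 ht.le
  have h3 : t * (b / t - 1) = b - t := by field_simp
  rw [Real.rpow_def_of_pos (by positivity), ← Real.exp_add, Real.log_mul hc.ne' ht.ne',
    Real.log_mul hc.ne' hb.ne']
  refine Real.exp_le_exp.2 ?_
  linarith

/-- With `Γ (t + 1) ≤ 1` and the first convergent, it remains to bound `(c t) ^ t * exp (-c t)`. The
affine exponent is split into its value at `b`, bounded through `E`, and a multiple of `b - t`,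
bounded through `k` and `exp x ≥ 1 + x`. A quadratic inequality in `t` is left. -/
theorem mul_Gamma_le_incGamma_of_le_one {t b c k E σ : ℝ} (ht : 0 < t) (htb : t ≤ b) (hb : b ≤ 1)
    (hc : 1 ≤ c) (hσ : 0 ≤ σ) (hE0 : 0 ≤ E)
    (hE : E ≤ Real.exp (b * Real.log (c * b) - c * b)) (hk : k ≤ c - 1 - Real.log (c * b))
    (h : σ * ((c - 1) * t + 1) ≤ t * (E * (1 + k * (b - t)))) :
    σ * Real.Gamma t ≤ incGamma t (c * t) := by
  have hy : 0 < c * t := by positivity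
  have hD : 0 < c * t + 1 - t := by nlinarith
  refine mul_Gamma_le_of_le ht (by linarith) hσ ?_
  refine le_trans ?_ (mul_le_mul_of_nonneg_left (incGamma_ge_of_le_one ht (by linarith) hy) ht.le)
  rw [← mul_div_assoc, le_div_iff₀ hD]
  refine le_trans (le_of_eq (by ring)) (h.trans (mul_le_mul_of_nonneg_left ?_ ht.le))
  refine le_trans ?_ (rpow_mul_exp_neg_ge ht (ht.trans_le htb) (by linarith))
  rw [show t * (Real.log (c * b) + 1 - c) - b = (b * Real.log (c * b) - c * b) +
    (c - 1 - Real.log (c * b)) * (b - t) by ring, Real.exp_add]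
  have h1 := Real.add_one_le_exp ((c - 1 - Real.log (c * b)) * (b - t))
  have h2 := mul_le_mul_of_nonneg_right hk (sub_nonneg.2 htb)
  exact (mul_le_mul_of_nonneg_left (by linarith) hE0).trans
    (mul_le_mul_of_nonneg_right hE (Real.exp_pos _).le)

theorem exp_le_inv_one_sub {x : ℝ} (hx : x < 1) : Real.exp x ≤ 1 / (1 - x) := by
  have := Real.add_one_le_exp (-x)
  rw [le_div_iff₀ (by linarith)]
  have h2 : Real.exp x * Real.exp (-x) = 1 := by rw [← Real.exp_add]; simp
  nlinarith [Real.exp_pos x]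

theorem mul_Gamma_le_incGamma_seven {t : ℝ} (h1 : 1 / 10 ≤ t) (h2 : t ≤ 1 / 5) :
    0.0202 * Real.Gamma t ≤ incGamma t (7 * t) := by
  have hl : Real.log (7 * (1 / 5)) = Real.log 7 - Real.log 5 := by
    rw [mul_one_div, Real.log_div (by norm_num) (by norm_num)]
  have hl2 := Real.log_le_sub_one_of_pos (by norm_num : (0 : ℝ) < 7 * (1 / 5))
  refine mul_Gamma_le_incGamma_of_le_one (b := 1 / 5) (E := 0.23) (k := 5) (by linarith) h2
    (by norm_num) (by norm_num) (by norm_num) (by norm_num) ?_ (by linarith) (by nlinarith)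
  have h3 : -1.3328 ≤ 1 / 5 * Real.log (7 * (1 / 5)) - 7 * (1 / 5) := by
    rw [hl]
    linarith [lt_log_seven, log_five_lt]
  refine le_trans ?_ (Real.exp_le_exp.2 h3)
  have h4 := exp_le_inv_one_sub (x := 0.3328) (by norm_num)
  have h5 : Real.exp 1.3328 = Real.exp 1 * Real.exp 0.3328 := by rw [← Real.exp_add]; norm_num
  have h6 := Real.exp_one_lt_d9
  rw [Real.exp_neg, ← one_div, le_div_iff₀ (Real.exp_pos _), h5]
  norm_num at h4 h6 ⊢
  nlinarith [Real.exp_pos 1]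

theorem mul_Gamma_le_incGamma_nine_halves {t : ℝ} (h1 : 1 / 5 ≤ t) (h2 : t ≤ 1 / 2) :
    0.0202 * Real.Gamma t ≤ incGamma t (4.5 * t) := by
  have hl : Real.log (4.5 * (1 / 2)) = 2 * (Real.log 3 - Real.log 2) := by
    rw [show (4.5 : ℝ) * (1 / 2) = (3 / 2) ^ 2 by norm_num, Real.log_pow,
      Real.log_div (by norm_num) (by norm_num)]
    norm_num
  have h0 := lt_log_three
  have h0' := log_three_lt
  have h7 := Real.log_two_lt_d9
  have h8 := Real.log_two_gt_d9
  refine mul_Gamma_le_incGamma_of_le_one (b := 1 / 2) (E := 0.12) (k := 2.6) (by linarith) h2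
    (by norm_num) (by norm_num) (by norm_num) (by norm_num) ?_ ?_ (by nlinarith)
  · have h3 : -1.845 ≤ 1 / 2 * Real.log (4.5 * (1 / 2)) - 4.5 * (1 / 2) := by
      rw [hl]
      linarith
    refine le_trans ?_ (Real.exp_le_exp.2 h3)
    have h4 := exp_le_inv_one_sub (x := -0.155) (by norm_num)
    have h5 : Real.exp 1.845 = Real.exp 1 * Real.exp 1 * Real.exp (-0.155) := by
      rw [← Real.exp_add, ← Real.exp_add]; norm_num
    have h6 := Real.exp_one_lt_d9
    have h9 : Real.exp 1 * Real.exp 1 ≤ 7.4 := by nlinarith [Real.exp_pos 1]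
    rw [Real.exp_neg, ← one_div, le_div_iff₀ (Real.exp_pos _), h5]
    norm_num at h4 h9 ⊢
    nlinarith [Real.exp_pos 1]
  · rw [hl]
    linarith

theorem mul_Gamma_le_incGamma_seven_halves {t : ℝ} (h1 : 1 / 2 ≤ t) (h2 : t ≤ 1) :
    0.0202 * Real.Gamma t ≤ incGamma t (3.5 * t) := by
  have h0 := lt_log_seven_halves
  have hl2 : Real.log (3.5 * 1) ≤ Real.log (2 ^ 2) :=
    Real.log_le_log (by norm_num) (by norm_num)
  have h7 := Real.log_two_lt_d9
  rw [Real.log_pow] at hl2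
  push_cast at hl2
  refine mul_Gamma_le_incGamma_of_le_one (b := 1) (E := 0.08) (k := 1) (by linarith) h2
    (by norm_num) (by norm_num) (by norm_num) (by norm_num) ?_ (by linarith) (by nlinarith)
  have h3 : -2.2473 ≤ 1 * Real.log (3.5 * 1) - 3.5 * 1 := by
    rw [mul_one]
    linarith
  refine le_trans ?_ (Real.exp_le_exp.2 h3)
  have h4 := exp_le_inv_one_sub (x := 0.2473) (by norm_num)
  have h5 : Real.exp 2.2473 = Real.exp 1 * Real.exp 1 * Real.exp 0.2473 := by
    rw [← Real.exp_add, ← Real.exp_add]; norm_num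
  have h6 := Real.exp_one_lt_d9
  have h9 : Real.exp 1 * Real.exp 1 ≤ 7.4 := by nlinarith [Real.exp_pos 1]
  rw [Real.exp_neg, ← one_div, le_div_iff₀ (Real.exp_pos _), h5]
  norm_num at h4 h9 ⊢
  nlinarith [Real.exp_pos 1]

theorem mul_Gamma_le_incGamma_of_one_le {t : ℝ} (h1 : 1 ≤ t) (h2 : t ≤ 2) :
    0.0202 * Real.Gamma t ≤ incGamma t (2.9 * t) := by
  have ht : 0 < t := by linarith
  have hD : 0 < 2.9 * t + 2 - t := by linarith
  have hG := Gamma_le_one h1 h2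
  refine le_trans (by linarith : _ ≤ (0.0202 : ℝ))
    (le_trans ?_ (incGamma_ge_mul h1 h2 (by norm_num)))
  have hm : 6.8 / 33.64 ≤ (2.9 * t + 1) / (2.9 * t * (2.9 * t + 2 - t)) := by
    rw [div_le_div_iff₀ (by norm_num) (by positivity)]
    nlinarith
  have hl2 : Real.log (2.9 * 2) ≤ 1.9 := by
    have h3 : Real.log (2.9 * 2) ≤ Real.log (2 * 3) :=
      Real.log_le_log (by norm_num) (by norm_num)
    rw [Real.log_mul two_ne_zero three_ne_zero] at h3
    linarith [Real.log_two_lt_d9, log_three_lt]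
  have hP : 33.64 * (1.22 / 2.7182818286 ^ 6) ≤ (2.9 * t) ^ t * Real.exp (-(2.9 * t)) := by
    refine le_trans ?_ (rpow_mul_exp_neg_ge (b := 2) ht (by norm_num) (by norm_num))
    -- Since `log 5.8 ≤ 1.9`, the affine exponent does not increase in `t`, so `t = 2` is the worst
    -- case, with value `5.8 ^ 2 * exp (0.2 - 6)`. The final product is about `0.0206`, little more
    -- than the required `0.0202`.
    have h3 : 2 * Real.log (2.9 * 2) - 5.8 ≤ t * (Real.log (2.9 * 2) + 1 - 2.9) - 2 := by
      nlinarith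
    refine le_trans ?_ (Real.exp_le_exp.2 h3)
    rw [show 2 * Real.log (2.9 * 2) - 5.8 = Real.log (2.9 * 2) + Real.log (2.9 * 2) + (0.2 - 6) by
      ring, Real.exp_add, Real.exp_add, Real.exp_log (by norm_num), Real.exp_sub]
    have h4 := Real.quadratic_le_exp_of_nonneg (x := 0.2) (by norm_num)
    have h5 : Real.exp 6 ≤ 2.7182818286 ^ 6 := by
      rw [show (6 : ℝ) = (6 : ℕ) * 1 by norm_num, Real.exp_nat_mul]
      exact pow_le_pow_left₀ (Real.exp_pos 1).le Real.exp_one_lt_d9.le 6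
    rw [show (33.64 : ℝ) = 2.9 * 2 * (2.9 * 2) by norm_num]
    gcongr
    linarith
  refine le_trans ?_ (mul_le_mul hm hP (by norm_num) (by positivity))
  norm_num

theorem mul_Gamma_le_incGamma_two_fifths {t : ℝ} (h1 : 1 / 20 ≤ t) (h2 : t ≤ 1 / 10) :
    0.0202 * Real.Gamma t ≤ incGamma t 0.4 := by
  have ht : 0 < t := by linarith
  refine mul_Gamma_le_of_le ht (by linarith) (by norm_num) ?_
  refine le_trans ?_ (mul_le_mul_of_nonneg_left
    (incGamma_ge_of_le_one ht (by linarith) (by norm_num)) ht.le)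
  rw [← mul_div_assoc, le_div_iff₀ (by linarith)]
  have h3 : 1 - 0.9164 * t ≤ (0.4 : ℝ) ^ t := by
    rw [Real.rpow_def_of_pos (by norm_num)]
    refine le_trans ?_ (Real.add_one_le_exp _)
    nlinarith [log_two_fifths_bounds.1]
  have h4 := Real.add_one_le_exp (-0.4 : ℝ)
  have h5 : (1 - 0.9164 * t) * 0.6 ≤ (0.4 : ℝ) ^ t * Real.exp (-0.4) :=
    mul_le_mul h3 (by linarith) (by norm_num) (by positivity)
  nlinarith

/-- `log Γ` vanishes at one and has slope at least `-3/5` from there on. -/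
theorem exp_neg_le_Gamma_add_one {t : ℝ} (ht : 0 ≤ t) :
    Real.exp (-(3 / 5) * t) ≤ Real.Gamma (t + 1) := by
  have hpos := Real.Gamma_pos_of_pos (by linarith : 0 < t + 1)
  rw [← Real.le_log_iff_exp_le hpos]
  have h := (convex_Ici (1 : ℝ)).mul_sub_le_image_sub_of_le_deriv (f := Real.log ∘ Real.Gamma)
    (C := -(3 / 5))
    (fun x hx => (hasDerivAt_log_Gamma (one_pos.trans_le hx)).continuousAt.continuousWithinAt)
    (fun x hx => (hasDerivAt_log_Gamma
      (one_pos.trans_le (interior_subset hx))).differentiableAt.differentiableWithinAt)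
    (fun x hx => by
      rw [(hasDerivAt_log_Gamma (one_pos.trans_le (interior_subset hx))).deriv]
      exact neg_three_fifths_le_digamma (interior_subset hx))
    1 self_mem_Ici (t + 1) (by simpa using ht) (by linarith)
  simpa using h

/-- The missing integral over `(0, y)` is at most that of `x ^ (t - 1)`, because `exp (-x) ≤ 1`. -/
theorem Gamma_sub_le_incGamma {t y : ℝ} (ht : 0 < t) (hy : 0 ≤ y) :
    Real.Gamma t - y ^ t / t ≤ incGamma t y := by
  have hmono : MonotoneOn (fun z => incGamma t z + z ^ t / t) (Ici 0) := by
    refine monotoneOn_of_deriv_nonneg (convex_Ici 0) ?_ ?_ ?_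
    · exact (continuousOn_incGamma ht).add
        ((Real.continuous_rpow_const ht.le).div_const t).continuousOn
    all_goals
      intro z hz
      rw [interior_Ici] at hz
      have hd := (hasDerivAt_incGamma ht hz).add
        ((Real.hasDerivAt_rpow_const (p := t) (Or.inl (ne_of_gt hz))).div_const t)
    · exact hd.differentiableAt.differentiableWithinAt
    · erw [hd.deriv]
      have h1 : Real.exp (-z) ≤ 1 := Real.exp_le_one_iff.2 (by simpa using (mem_Ioi.1 hz).le)
      have h2 := mul_nonneg (Real.rpow_nonneg (mem_Ioi.1 hz).le (t - 1)) (sub_nonneg.2 h1)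
      rw [mul_div_cancel_left₀ _ ht.ne']
      linarith
  have h := hmono self_mem_Ici hy hy
  simp only [incGamma_zero ht, Real.zero_rpow ht.ne', zero_div, add_zero] at h
  linarith

theorem mul_Gamma_le_incGamma_nine_fiftieths {t : ℝ} (h1 : 1 / 50 ≤ t) :
    0.0202 * Real.Gamma t ≤ incGamma t 0.18 := by
  have ht : 0 < t := by linarith
  refine le_trans ?_ (Gamma_sub_le_incGamma ht (by norm_num))
  have h2 := exp_neg_le_Gamma_add_one ht.le
  have h3 : (0.18 : ℝ) ^ t ≤ Real.exp (-1.71 * t) := by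
    rw [Real.rpow_def_of_pos (by norm_num)]
    exact Real.exp_le_exp.2 (by nlinarith [log_nine_fiftieths_le])
  have h4 : Real.exp (-(3 / 5) * t) = Real.exp (-1.71 * t) * Real.exp (1.11 * t) := by
    rw [← Real.exp_add]
    ring_nf
  have h5 := Real.add_one_le_exp (1.11 * t)
  -- The restriction `β ≤ 50` is used here: `1 / 50 ≤ t` gives `1.11 t ≥ 0.0222`, and `0.9798 *
  -- 1.0222 > 1`.
  have h6 : Real.exp (-1.71 * t) * 1.0222 ≤ Real.exp (-1.71 * t) * Real.exp (1.11 * t) := by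
    gcongr
    linarith
  have h7 := Real.exp_pos (-1.71 * t)
  have h8 : (0.18 : ℝ) ^ t ≤ t * (0.9798 * Real.Gamma t) := by
    rw [Real.Gamma_add_one ht.ne'] at h2
    linarith
  rw [← div_le_iff₀' ht] at h8
  linarith

theorem tailRadiusStrictMono_ggdLaw_half_fifty {τ : ℝ} (hτ : τ ∈ Ioo (0 : ℝ) 0.0202) :
    TailRadiusStrictMonoInKurtosis ggdLaw (Icc (1 / 2) 50) τ := by
  have key : ∀ {t y : ℝ}, 0 < t → 0 < y → 0.0202 * Real.Gamma t ≤ incGamma t y →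
      0 < ggdCore t y → ∃ y, 0 < y ∧ 0.0202 * Real.Gamma t ≤ incGamma t y ∧
        ∀ z, y ≤ z → 0 < ggdCore t z :=
    fun {t y} ht hy h h' => ⟨y, hy, h, fun z hz => ggdCore_pos_of_le ht hy hz h'⟩
  refine tailRadiusStrictMono_ggdLaw (by norm_num) (by norm_num) (fun t ht => ?_) hτ
  obtain ⟨ha, hb⟩ := ht
  norm_num at hb
  have ht : 0 < t := by linarith
  rcases le_total t (1 / 20) with h1 | h1
  · exact key ht (by norm_num) (mul_Gamma_le_incGamma_nine_fiftieths ha)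
      (ggdCore_pos_nine_fiftieths ht h1)
  rcases le_total t (1 / 10) with h2 | h2
  · exact key ht (by norm_num) (mul_Gamma_le_incGamma_two_fifths h1 h2)
      (ggdCore_pos_two_fifths ht h2)
  rcases le_total t (1 / 5) with h3 | h3
  · exact key ht (by positivity) (mul_Gamma_le_incGamma_seven h2 h3) (ggdCore_pos_seven h2 h3)
  rcases le_total t (1 / 2) with h4 | h4
  · exact key ht (by positivity) (mul_Gamma_le_incGamma_nine_halves h3 h4)
      (ggdCore_pos_nine_halves h3 h4)
  rcases le_total t 1 with h5 | h5
  · exact key ht (by positivity) (mul_Gamma_le_incGamma_seven_halves h4 h5)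
      (ggdCore_pos_seven_halves h4 h5)
  · exact key ht (by positivity) (mul_Gamma_le_incGamma_of_one_le h5 hb)
      (ggdCore_pos_of_one_le h5 hb)

/-! ### The incomplete Beta function with second parameter one half -/

/-- The incomplete Beta function with second parameter `1 / 2`. -/
noncomputable def incBeta (m v : ℝ) : ℝ := ∫ u in (0 : ℝ)..v, u ^ (m - 1) * (1 - u) ^ (-(1 / 2) : ℝ)

/-- The derivative of the incomplete Beta function in its first parameter. -/
noncomputable def logIncBeta (m v : ℝ) : ℝ :=
  ∫ u in (0 : ℝ)..v, u ^ (m - 1) * (Real.log u * (1 - u) ^ (-(1 / 2) : ℝ))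

theorem intervalIntegrable_one_sub_rpow (a b : ℝ) :
    IntervalIntegrable (fun u : ℝ => (1 - u) ^ (-(1 / 2) : ℝ)) volume a b := by
  have h := (intervalIntegral.intervalIntegrable_rpow' (a := 1 - a) (b := 1 - b)
    (r := -(1 / 2)) (by norm_num)).comp_sub_left 1
  simpa using h

theorem intervalIntegrable_incBeta {m : ℝ} (hm : 1 ≤ m) (a b : ℝ) :
    IntervalIntegrable (fun u : ℝ => u ^ (m - 1) * (1 - u) ^ (-(1 / 2) : ℝ)) volume a b :=
  (intervalIntegrable_one_sub_rpow a b).continuousOn_mul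
    (Real.continuous_rpow_const (by linarith)).continuousOn

theorem continuous_rpow_mul_log {m : ℝ} (hm : 2 ≤ m) :
    Continuous fun u : ℝ => u ^ (m - 1) * Real.log u := by
  -- The assumption `2 ≤ m` leaves a factor `u log u`, continuous at zero, times a nonnegative
  -- power.
  have h : (fun u : ℝ => u ^ (m - 1) * Real.log u) = fun u => u ^ (m - 2) * (u * Real.log u) := by
    ext u
    rcases eq_or_ne u 0 with rfl | hu
    · simp
    · rw [← mul_assoc, ← Real.rpow_add_one hu]
      ring_nf
  rw [h]
  exact (Real.continuous_rpow_const (by linarith)).mul Real.continuous_mul_log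

theorem intervalIntegrable_logIncBeta {m : ℝ} (hm : 2 ≤ m) (a b : ℝ) :
    IntervalIntegrable (fun u : ℝ => u ^ (m - 1) * (Real.log u * (1 - u) ^ (-(1 / 2) : ℝ)))
      volume a b := by
  simp only [← mul_assoc]
  exact (intervalIntegrable_one_sub_rpow a b).continuousOn_mul
    (continuous_rpow_mul_log hm).continuousOn

theorem continuous_incBeta {m : ℝ} (hm : 1 ≤ m) : Continuous (incBeta m) :=
  intervalIntegral.continuous_primitive (intervalIntegrable_incBeta hm) 0

theorem continuous_logIncBeta {m : ℝ} (hm : 2 ≤ m) : Continuous (logIncBeta m) :=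
  intervalIntegral.continuous_primitive (intervalIntegrable_logIncBeta hm) 0

theorem hasDerivAt_incBeta {m v : ℝ} (hm : 1 ≤ m) (hv : v < 1) :
    HasDerivAt (incBeta m) (v ^ (m - 1) * (1 - v) ^ (-(1 / 2) : ℝ)) v := by
  refine intervalIntegral.integral_hasDerivAt_right (intervalIntegrable_incBeta hm 0 v)
    (Measurable.stronglyMeasurable (by fun_prop)).stronglyMeasurableAtFilter ?_
  exact (Real.continuous_rpow_const (by linarith)).continuousAt.mul
    (ContinuousAt.rpow_const (by fun_prop) (Or.inl (by linarith)))

theorem hasDerivAt_logIncBeta {m v : ℝ} (hm : 2 ≤ m) (hv : v < 1) :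
    HasDerivAt (logIncBeta m) (v ^ (m - 1) * (Real.log v * (1 - v) ^ (-(1 / 2) : ℝ))) v := by
  refine intervalIntegral.integral_hasDerivAt_right (intervalIntegrable_logIncBeta hm 0 v)
    (Measurable.stronglyMeasurable (by fun_prop)).stronglyMeasurableAtFilter ?_
  simp only [← mul_assoc]
  exact (continuous_rpow_mul_log hm).continuousAt.mul
    (ContinuousAt.rpow_const (by fun_prop) (Or.inl (by linarith)))

theorem incBeta_zero (m : ℝ) : incBeta m 0 = 0 := intervalIntegral.integral_same

theorem logIncBeta_zero (m : ℝ) : logIncBeta m 0 = 0 := intervalIntegral.integral_same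

theorem incBeta_one {m : ℝ} (hm : 0 < m) : incBeta m 1 = beta m (1 / 2) := by
  rw [beta_eq_betaIntegralReal m (1 / 2) hm (by norm_num), Complex.betaIntegral, incBeta]
  rw [show (∫ x : ℝ in (0 : ℝ)..1, (x : ℂ) ^ ((m : ℂ) - 1) * (1 - (x : ℂ)) ^ (((1 / 2 : ℝ) : ℂ) - 1)) =
    ∫ x : ℝ in (0 : ℝ)..1, ((x ^ (m - 1) * (1 - x) ^ (-(1 / 2) : ℝ) : ℝ) : ℂ) from ?_,
    intervalIntegral.integral_ofReal, Complex.ofReal_re]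
  refine intervalIntegral.integral_congr fun x hx => ?_
  rw [uIcc_of_le zero_le_one] at hx
  simp only [Complex.ofReal_mul, Complex.ofReal_cpow hx.1, Complex.ofReal_cpow (sub_nonneg.2 hx.2)]
  norm_num

theorem beta_half {m : ℝ} : beta m (1 / 2) =
    Real.Gamma m * Real.sqrt Real.pi / Real.Gamma (m + 1 / 2) := by
  rw [beta, Real.Gamma_one_half_eq]

theorem hasDerivAt_beta_half {m : ℝ} (hm : 0 < m) : HasDerivAt (fun m => beta m (1 / 2))
    (-(digamma (m + 1 / 2) - digamma m) * beta m (1 / 2)) m := by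
  have h1 := Real.Gamma_pos_of_pos (by linarith : 0 < m + 1 / 2)
  have h := ((hasDerivAt_Gamma_digamma hm).mul_const (Real.sqrt Real.pi)).div
    ((hasDerivAt_Gamma_digamma (by linarith : 0 < m + 1 / 2)).comp_add_const m (1 / 2)) h1.ne'
  simp only [beta_half]
  refine h.congr_deriv ?_
  field_simp
  ring

theorem hasDerivAt_incBeta_param {m v : ℝ} (hm : 0 < m) (hv0 : 0 ≤ v) :
    HasDerivAt (fun m => incBeta m v) (logIncBeta m v) m := by
  set w : ℝ → ℝ := (Ioc 0 v).indicator fun u => (1 - u) ^ (-(1 / 2) : ℝ) with hw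
  have hloc : LocallyIntegrableOn w (Ioi 0) := by
    have h := (intervalIntegrable_iff_integrableOn_Ioc_of_le hv0).1
      (intervalIntegrable_one_sub_rpow 0 v)
    have h2 : Integrable w := (integrable_indicator_iff measurableSet_Ioc).2 h
    exact h2.locallyIntegrable.locallyIntegrableOn _
  have htop : w =O[atTop] fun x : ℝ => x ^ (-(m + 1)) := by
    refine IsBigO.of_bound 0 ?_
    filter_upwards [eventually_gt_atTop v] with x hx
    rw [hw, indicator_of_notMem (fun h => absurd h.2 (not_le.2 hx))]
    simp
  have hbot : w =O[𝓝[>] 0] fun x : ℝ => x ^ (-(0 : ℝ)) := by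
    refine IsBigO.of_bound ((1 / 2 : ℝ) ^ (-(1 / 2) : ℝ)) ?_
    filter_upwards [Ioo_mem_nhdsGT (by norm_num : (0 : ℝ) < 1 / 2)] with x hx
    refine (norm_indicator_le_norm_self _ _).trans ?_
    have : (0 : ℝ) ≤ (1 - x) ^ (-(1 / 2) : ℝ) := Real.rpow_nonneg (by linarith [hx.2]) _
    simp only [Real.norm_eq_abs, neg_zero, Real.rpow_zero, abs_one, mul_one, abs_of_nonneg this]
    exact Real.rpow_le_rpow_of_nonpos (by norm_num) (by linarith [hx.2]) (by norm_num)
  have h := (hasDerivAt_integral_rpow_mul hloc htop (lt_add_one m) hbot hm).2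
  have hinter : Ioi (0 : ℝ) ∩ Ioc 0 v = Ioc 0 v := inter_eq_self_of_subset_right fun x hx => hx.1
  have e : ∀ g : ℝ → ℝ, ∫ x in Ioi 0, g x * w x =
      ∫ x in (0 : ℝ)..v, g x * (1 - x) ^ (-(1 / 2) : ℝ) := fun g => by
    have : (fun x => g x * w x) = (Ioc 0 v).indicator fun x => g x * (1 - x) ^ (-(1 / 2) : ℝ) := by
      ext x
      by_cases hx : x ∈ Ioc 0 v <;> simp [hw, hx]
    rw [this, setIntegral_indicator measurableSet_Ioc, hinter,
      intervalIntegral.integral_of_le hv0]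
  simp only [← mul_assoc, e] at h
  simpa only [logIncBeta, incBeta, ← mul_assoc] using h

/-- Differentiating the complete Beta function in its parameter; this identity is what makes the
Student core vanish at `v = 1`. -/
theorem logIncBeta_one {m : ℝ} (hm : 0 < m) :
    logIncBeta m 1 = -(digamma (m + 1 / 2) - digamma m) * beta m (1 / 2) := by
  refine (hasDerivAt_incBeta_param hm zero_le_one).unique
    ((hasDerivAt_beta_half hm).congr_of_eventuallyEq ?_)
  filter_upwards [lt_mem_nhds hm] with x hx
  exact incBeta_one hx

/-! ### The Student law: tail, moments and kurtosis -/

theorem studentPDF_abs (ν x : ℝ) : studentPDF ν |x| = studentPDF ν x := by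
  simp only [studentPDF, sq_abs]

theorem measurable_studentPDF (ν : ℝ) : Measurable (studentPDF ν) := by
  unfold studentPDF
  fun_prop

/-- The upper tail function of the Student law. -/
noncomputable def studentTail (ν x : ℝ) : ℝ :=
  incBeta (ν / 2) (1 / (1 + x ^ 2 / ν)) / (2 * beta (ν / 2) (1 / 2))

/-- A multiple of the Student density with the exponent raised by one. -/
noncomputable def studentAux (ν x : ℝ) : ℝ := (1 + x ^ 2 / ν) * studentPDF ν x

/-- The upper tail integral of the second moment of the Student law. -/
noncomputable def studentTailTwo (ν x : ℝ) : ℝ :=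
  ν / (ν - 2) * (studentTail ν x + x * studentAux ν x)

/-- The upper tail integral of the fourth moment of the Student law. -/
noncomputable def studentTailFour (ν x : ℝ) : ℝ :=
  ν / (ν - 4) * (3 * studentTailTwo ν x + x ^ 3 * studentAux ν x)

section

variable {ν : ℝ}

theorem one_add_sq_div_pos (hν : 0 < ν) (x : ℝ) : 0 < 1 + x ^ 2 / ν := by positivity

theorem studentPDF_pos (hν : 0 < ν) (x : ℝ) : 0 < studentPDF ν x := by
  have h1 := Real.Gamma_pos_of_pos (by positivity : 0 < (ν + 1) / 2)
  have h2 := Real.Gamma_pos_of_pos (by positivity : 0 < ν / 2)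
  have h3 := one_add_sq_div_pos hν x
  have h4 := Real.pi_pos
  rw [studentPDF]
  positivity

theorem studentPDF_eq (hν : 0 < ν) (x : ℝ) : studentPDF ν x =
    1 / (Real.sqrt ν * beta (ν / 2) (1 / 2)) * (1 + x ^ 2 / ν) ^ (-((ν + 1) / 2)) := by
  have h1 := Real.Gamma_pos_of_pos (by positivity : 0 < (ν + 1) / 2)
  have h2 := Real.Gamma_pos_of_pos (by positivity : 0 < ν / 2)
  have h3 := Real.sqrt_pos.2 hν
  have h4 := Real.sqrt_pos.2 Real.pi_pos
  rw [studentPDF, beta_half, Real.sqrt_mul hν.le, show ν / 2 + 1 / 2 = (ν + 1) / 2 by ring]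
  congr 1
  field_simp

theorem hasDerivAt_studentTail (hν : 2 ≤ ν) {x : ℝ} (hx : 0 < x) :
    HasDerivAt (studentTail ν) (-studentPDF ν x) x := by
  have hν0 : 0 < ν := by linarith
  have hD := one_add_sq_div_pos hν0 x
  have hB : 0 < beta (ν / 2) (1 / 2) := beta_pos (by linarith) (by norm_num)
  have hv1 : 1 / (1 + x ^ 2 / ν) < 1 := by
    rw [div_lt_one hD]
    have : 0 < x ^ 2 / ν := by positivity
    linarith
  have h1 : HasDerivAt (fun x : ℝ => 1 / (1 + x ^ 2 / ν))
      (-(2 * x / ν) / (1 + x ^ 2 / ν) ^ 2) x := by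
    have h := (((hasDerivAt_pow 2 x).div_const ν).const_add 1).inv hD.ne'
    simp only [one_div]
    refine h.congr_deriv ?_
    simp
  have h := ((hasDerivAt_incBeta (m := ν / 2) (by linarith) hv1).comp x h1).div_const
    (2 * beta (ν / 2) (1 / 2))
  refine h.congr_deriv ?_
  have e1 : 1 - 1 / (1 + x ^ 2 / ν) = (x / Real.sqrt ν) ^ 2 * (1 + x ^ 2 / ν)⁻¹ := by
    rw [div_pow, Real.sq_sqrt hν0.le]
    field_simp
    ring
  have hs := Real.sqrt_pos.2 hν0
  have e2 : ((x / Real.sqrt ν) ^ 2) ^ (-(1 / 2) : ℝ) = Real.sqrt ν / x := by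
    rw [Real.rpow_neg (by positivity), ← Real.sqrt_eq_rpow, Real.sqrt_sq (by positivity), inv_div]
  have e3 : (1 / (1 + x ^ 2 / ν)) ^ (ν / 2 - 1) * ((1 + x ^ 2 / ν)⁻¹) ^ (-(1 / 2) : ℝ) /
      (1 + x ^ 2 / ν) ^ 2 = (1 + x ^ 2 / ν) ^ (-((ν + 1) / 2)) := by
    rw [one_div, Real.inv_rpow hD.le, Real.inv_rpow hD.le, ← Real.rpow_neg hD.le,
      ← Real.rpow_neg hD.le, ← Real.rpow_natCast (1 + x ^ 2 / ν) 2, ← Real.rpow_add hD,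
      ← Real.rpow_sub hD]
    congr 1
    push_cast
    ring
  rw [studentPDF_eq hν0, ← e3, e1, Real.mul_rpow (by positivity) (by positivity), e2]
  have e4 : Real.sqrt ν * Real.sqrt ν = ν := Real.mul_self_sqrt hν0.le
  generalize (1 / (1 + x ^ 2 / ν)) ^ (ν / 2 - 1) = A
  generalize ((1 + x ^ 2 / ν)⁻¹) ^ (-(1 / 2) : ℝ) = C
  generalize 1 + x ^ 2 / ν = D at *
  generalize beta (ν / 2) (1 / 2) = B at *
  field_simp
  rw [sq, e4]
  ring

theorem continuous_studentTail (hν : 2 ≤ ν) : Continuous (studentTail ν) := by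
  have hν0 : 0 < ν := by linarith
  refine Continuous.div_const ((continuous_incBeta (by linarith)).comp ?_) _
  exact continuous_const.div (by fun_prop) fun x => (one_add_sq_div_pos hν0 x).ne'

theorem tendsto_studentTail (hν : 2 ≤ ν) : Tendsto (studentTail ν) atTop (𝓝 0) := by
  have hν0 : 0 < ν := by linarith
  have h1 : Tendsto (fun x : ℝ => 1 / (1 + x ^ 2 / ν)) atTop (𝓝 0) := by
    refine tendsto_const_nhds.div_atTop (tendsto_atTop_add_const_left _ _ ?_)
    exact (tendsto_pow_atTop two_ne_zero).atTop_div_const hν0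
  have h2 := (((continuous_incBeta (m := ν / 2) (by linarith)).tendsto 0).comp h1).div_const
    (2 * beta (ν / 2) (1 / 2))
  rw [incBeta_zero, zero_div] at h2
  exact h2

theorem studentTail_zero (hν : 0 < ν) : studentTail ν 0 = 1 / 2 := by
  have hB : 0 < beta (ν / 2) (1 / 2) := beta_pos (by linarith) (by norm_num)
  have : studentTail ν 0 = incBeta (ν / 2) 1 / (2 * beta (ν / 2) (1 / 2)) := by
    simp [studentTail]
  rw [this, incBeta_one (by linarith)]
  field_simp

theorem studentAux_eq (hν : 0 < ν) (x : ℝ) : studentAux ν x =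
    1 / (Real.sqrt ν * beta (ν / 2) (1 / 2)) * (1 + x ^ 2 / ν) ^ (-((ν - 1) / 2)) := by
  have hD := one_add_sq_div_pos hν x
  rw [studentAux, studentPDF_eq hν, show -((ν - 1) / 2) = -((ν + 1) / 2) + 1 by ring,
    Real.rpow_add_one hD.ne']
  ring

/-- Because this derivative is a multiple of `x` times the density, integration by parts expresses
the second moment tail through the tail, and the fourth through the second. -/
theorem hasDerivAt_studentAux (hν : 0 < ν) (x : ℝ) :
    HasDerivAt (studentAux ν) (-((ν - 1) / ν * x * studentPDF ν x)) x := by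
  have hD := one_add_sq_div_pos hν x
  have h := ((((hasDerivAt_pow 2 x).div_const ν).const_add 1).rpow_const (p := -((ν - 1) / 2))
    (Or.inl hD.ne')).const_mul (1 / (Real.sqrt ν * beta (ν / 2) (1 / 2)))
  rw [show studentAux ν = _ from funext (studentAux_eq hν)]
  refine h.congr_deriv ?_
  rw [studentPDF_eq hν, show -((ν - 1) / 2) - 1 = -((ν + 1) / 2) by ring]
  push_cast
  ring

theorem continuous_studentAux (hν : 0 < ν) : Continuous (studentAux ν) :=
  continuous_iff_continuousAt.2 fun x => (hasDerivAt_studentAux hν x).continuousAt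

/-- The auxiliary function decays like `x ^ (-(ν - 1))`; the case `k = 3` is where the fourth moment
needs `4 < ν`. -/
theorem tendsto_pow_mul_studentAux {k : ℕ} (hν : 0 < ν) (hk : k + 1 < ν) :
    Tendsto (fun x => x ^ k * studentAux ν x) atTop (𝓝 0) := by
  have h1 : Tendsto (fun x : ℝ => 1 / (Real.sqrt ν * beta (ν / 2) (1 / 2)) *
      ν ^ ((ν - 1) / 2) * x ^ (-(ν - 1 - k))) atTop (𝓝 0) := by
    have := (tendsto_rpow_neg_atTop (y := ν - 1 - k) (by linarith)).const_mul
      (1 / (Real.sqrt ν * beta (ν / 2) (1 / 2)) * ν ^ ((ν - 1) / 2))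
    rwa [mul_zero] at this
  have hB : 0 < beta (ν / 2) (1 / 2) := beta_pos (by linarith) (by norm_num)
  refine squeeze_zero' ?_ ?_ h1
  · filter_upwards [eventually_gt_atTop 0] with x hx
    exact mul_nonneg (pow_nonneg hx.le _) (mul_pos (one_add_sq_div_pos hν x)
      (studentPDF_pos hν x)).le
  · filter_upwards [eventually_gt_atTop 0] with x hx
    have hD := one_add_sq_div_pos hν x
    have hk0 : (0 : ℝ) ≤ k := k.cast_nonneg
    have h2 : (1 + x ^ 2 / ν) ^ (-((ν - 1) / 2)) ≤ (x ^ 2 / ν) ^ (-((ν - 1) / 2)) :=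
      Real.rpow_le_rpow_of_nonpos (by positivity) (by linarith) (by linarith)
    have h3 : (x ^ 2 / ν) ^ (-((ν - 1) / 2)) = ν ^ ((ν - 1) / 2) * x ^ (-(ν - 1)) := by
      rw [Real.div_rpow (by positivity) hν.le, Real.rpow_neg hν.le, div_inv_eq_mul, mul_comm,
        ← Real.rpow_natCast, ← Real.rpow_mul hx.le]
      congr 2
      push_cast
      ring
    rw [studentAux_eq hν]
    have h4 : x ^ (-(ν - 1 - k)) = x ^ (-(ν - 1)) * x ^ k := by
      rw [← Real.rpow_natCast, ← Real.rpow_add hx]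
      ring_nf
    rw [h4]
    rw [h3] at h2
    have h5 : 0 ≤ x ^ k * (1 / (Real.sqrt ν * beta (ν / 2) (1 / 2))) := by positivity
    linarith [mul_le_mul_of_nonneg_left h2 h5]

theorem hasDerivAt_studentTailTwo (hν : 2 < ν) {x : ℝ} (hx : 0 < x) :
    HasDerivAt (studentTailTwo ν) (-(studentPDF ν x * x ^ 2)) x := by
  have hν0 : 0 < ν := by linarith
  have h2 : ν - 2 ≠ 0 := by linarith
  refine (((hasDerivAt_studentTail hν.le hx).add
    ((hasDerivAt_id x).mul (hasDerivAt_studentAux hν0 x))).const_mul _).congr_deriv ?_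
  simp only [studentAux, id]
  field_simp
  ring

theorem hasDerivAt_studentTailFour (hν : 4 < ν) {x : ℝ} (hx : 0 < x) :
    HasDerivAt (studentTailFour ν) (-(studentPDF ν x * x ^ 4)) x := by
  have hν0 : 0 < ν := by linarith
  have h2 : ν - 4 ≠ 0 := by linarith
  refine ((((hasDerivAt_studentTailTwo (by linarith) hx).const_mul 3).add
    ((hasDerivAt_pow 3 x).mul (hasDerivAt_studentAux hν0 x))).const_mul _).congr_deriv ?_
  simp only [studentAux]
  field_simp
  push_cast
  ring

theorem tendsto_studentTailTwo (hν : 2 < ν) : Tendsto (studentTailTwo ν) atTop (𝓝 0) := by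
  have h := ((tendsto_studentTail hν.le).add
    (tendsto_pow_mul_studentAux (k := 1) (by linarith) (by norm_num; linarith))).const_mul
    (ν / (ν - 2))
  simp only [pow_one, add_zero, mul_zero] at h
  exact h

theorem tendsto_studentTailFour (hν : 4 < ν) : Tendsto (studentTailFour ν) atTop (𝓝 0) := by
  have h := (((tendsto_studentTailTwo (by linarith)).const_mul 3).add
    (tendsto_pow_mul_studentAux (k := 3) (by linarith) (by norm_num; linarith))).const_mul
    (ν / (ν - 4))
  simp only [add_zero, mul_zero] at h
  exact h

theorem hasTail_studentLaw (hν : 2 ≤ ν) : HasTail (studentLaw ν) (studentTail ν) :=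
  hasTail_withDensity (studentPDF_abs ν) (fun x _ => studentPDF_pos (by linarith) x)
    (studentPDF_pos (by linarith) 0).le (fun _ hx => hasDerivAt_studentTail hν hx)
    (continuous_studentTail hν).continuousWithinAt (tendsto_studentTail hν)
    (studentTail_zero (by linarith))

theorem integral_studentPDF_mul_sq (hν : 2 < ν) : ∫ x, studentPDF ν x * x ^ 2 = ν / (ν - 2) := by
  have hν0 : 0 < ν := by linarith
  have h := (integrable_and_integral_of_even (g := fun x => studentPDF ν x * x ^ 2)
    (fun x => by simp only [studentPDF_abs, sq_abs])
    (fun x _ => mul_nonneg (studentPDF_pos hν0 x).le (sq_nonneg x))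
    (fun x hx => hasDerivAt_studentTailTwo hν hx)
    (Continuous.continuousWithinAt (continuous_const.mul ((continuous_studentTail hν.le).add
      (continuous_id.mul (continuous_studentAux hν0)))))
    (tendsto_studentTailTwo hν)).2
  rw [h, studentTailTwo, studentTail_zero hν0]
  ring

theorem integrable_and_integral_studentPDF_mul_pow_four (hν : 4 < ν) :
    Integrable (fun x => studentPDF ν x * x ^ 4) ∧
      ∫ x, studentPDF ν x * x ^ 4 = 3 * ν ^ 2 / ((ν - 2) * (ν - 4)) := by
  have hν0 : 0 < ν := by linarith
  obtain ⟨h1, h⟩ := integrable_and_integral_of_even (g := fun x => studentPDF ν x * x ^ 4)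
    (fun x => by simp only [studentPDF_abs, (show Even 4 by decide).pow_abs])
    (fun x _ => mul_nonneg (studentPDF_pos hν0 x).le (by positivity))
    (fun x hx => hasDerivAt_studentTailFour hν hx)
    (Continuous.continuousWithinAt (continuous_const.mul ((continuous_const.mul
      (continuous_const.mul ((continuous_studentTail (by linarith)).add
      (continuous_id.mul (continuous_studentAux hν0))))).add
      ((continuous_id.pow 3).mul (continuous_studentAux hν0)))))
    (tendsto_studentTailFour hν)
  refine ⟨h1, h.trans ?_⟩
  have h2 : ν - 2 ≠ 0 := by linarith
  have h4 : ν - 4 ≠ 0 := by linarith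
  rw [studentTailFour, studentTailTwo, studentTail_zero hν0]
  field_simp
  ring

theorem hasTail_stdStudentLaw (hν : 2 < ν) : HasTail (stdStudentLaw ν)
    fun x => studentTail ν (x / Real.sqrt ((ν - 2) / ν)) :=
  (hasTail_studentLaw hν.le).map_const_mul
    (Real.sqrt_pos.2 (div_pos (by linarith) (by linarith)))

theorem integral_pow_map_const_mul (μ : Measure ℝ) (c : ℝ) (n : ℕ) :
    ∫ x, x ^ n ∂(μ.map fun x => c * x) = c ^ n * ∫ x, x ^ n ∂μ := by
  rw [integral_map (measurable_const_mul c).aemeasurable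
    (Measurable.aestronglyMeasurable (by fun_prop))]
  simp only [mul_pow, integral_const_mul]

theorem isStandardised_stdStudentLaw (hν : 4 < ν) : IsStandardised (stdStudentLaw ν) ∧
    kurtosis (stdStudentLaw ν) = 3 + 6 / (ν - 4) := by
  have hν0 : 0 < ν := by linarith
  have h2 : 0 < ν - 2 := by linarith
  have h4 : 0 < ν - 4 := by linarith
  have hnn : ∀ x, 0 ≤ studentPDF ν x := fun x => (studentPDF_pos hν0 x).le
  have hc : Real.sqrt ((ν - 2) / ν) ^ 2 = (ν - 2) / ν := Real.sq_sqrt (by positivity)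
  have i4 := integrable_and_integral_studentPDF_mul_pow_four hν
  refine isStandardised_and_kurtosis_eq (hasTail_stdStudentLaw (by linarith)).isProbabilityMeasure
    ?_ ?_ ?_ ?_
  · refine (integrable_map_measure (Measurable.aestronglyMeasurable (by fun_prop))
      (measurable_const_mul _).aemeasurable).2 ?_
    simp only [Function.comp_def, mul_pow]
    exact (integrable_pow_withDensity (measurable_studentPDF ν) hnn 4 i4.1).const_mul _
  · have h := integral_pow_map_const_mul (studentLaw ν) (Real.sqrt ((ν - 2) / ν)) 1
    simp only [pow_one] at h
    refine h.trans (mul_eq_zero_of_right _ ?_)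
    exact integral_pow_one_withDensity (measurable_studentPDF ν) (studentPDF_abs ν) hnn
  · refine (integral_pow_map_const_mul _ _ 2).trans ?_
    rw [studentLaw, integral_pow_withDensity (measurable_studentPDF ν) hnn 2,
      integral_studentPDF_mul_sq (by linarith), hc]
    field_simp
  · refine (integral_pow_map_const_mul _ _ 4).trans ?_
    rw [studentLaw, integral_pow_withDensity (measurable_studentPDF ν) hnn 4, i4.2,
      show Real.sqrt ((ν - 2) / ν) ^ 4 = (Real.sqrt ((ν - 2) / ν) ^ 2) ^ 2 by ring, hc]
    field_simp
    ring

end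

theorem strictAntiOn_kurtosis_stdStudentLaw :
    StrictAntiOn (fun ν => kurtosis (stdStudentLaw ν)) (Ioi 4) := by
  intro a ha b hb hab
  rw [mem_Ioi] at ha hb
  simp only [(isStandardised_stdStudentLaw ha).2, (isStandardised_stdStudentLaw hb).2]
  have := div_lt_div_of_pos_left (by norm_num : (0 : ℝ) < 6) (by linarith : 0 < a - 4)
    (by linarith : a - 4 < b - 4)
  linarith

/-! ### The Student core: sign structure and lower bounds -/

/-- Up to the factor `-2 * beta m (1 / 2)`, the derivative in `m = ν / 2` of the upper tail of the
standardised Student law at the point `x` with `1 / (1 + x ^ 2 / (ν - 2)) = v`. -/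
noncomputable def studentCore (m v : ℝ) : ℝ :=
  -logIncBeta m v - (digamma (m + 1 / 2) - digamma m) * incBeta m v -
    v ^ m * Real.sqrt (1 - v) / (m - 1)

theorem le_of_hasDerivAt_nonneg {D D' : ℝ → ℝ} {v : ℝ} (hv : 0 ≤ v) (hc : Continuous D)
    (hd : ∀ u ∈ Ioo 0 v, HasDerivAt D (D' u) u) (hnn : ∀ u ∈ Ioo 0 v, 0 ≤ D' u) : D 0 ≤ D v := by
  refine monotoneOn_of_deriv_nonneg (convex_Icc 0 v) hc.continuousOn ?_ ?_
    (left_mem_Icc.2 hv) (right_mem_Icc.2 hv) hv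
  all_goals
    intro u hu
    rw [interior_Icc] at hu
  · exact (hd u hu).differentiableAt.differentiableWithinAt
  · rw [(hd u hu).deriv]
    exact hnn u hu

section

variable {m v : ℝ}

theorem one_sub_rpow_eq (hv : v < 1) : (1 - v) ^ (-(1 / 2) : ℝ) = (Real.sqrt (1 - v))⁻¹ := by
  rw [Real.rpow_neg (by linarith), ← Real.sqrt_eq_rpow]

theorem sqrt_one_sub_eq (hv : v < 1) :
    Real.sqrt (1 - v) = (1 - v) * (1 - v) ^ (-(1 / 2) : ℝ) := by
  have h := Real.sqrt_pos.2 (sub_pos.2 hv)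
  have h2 := Real.mul_self_sqrt (sub_pos.2 hv).le
  rw [one_sub_rpow_eq hv, ← div_eq_mul_inv, eq_div_iff h.ne', h2]

theorem continuous_rpow_mul_sqrt (hm : 0 ≤ m) :
    Continuous fun v : ℝ => v ^ m * Real.sqrt (1 - v) :=
  (Real.continuous_rpow_const hm).mul (Real.continuous_sqrt.comp (by fun_prop))

theorem hasDerivAt_rpow_mul_sqrt (hv0 : 0 < v) (hv : v < 1) :
    HasDerivAt (fun v : ℝ => v ^ m * Real.sqrt (1 - v))
      (v ^ (m - 1) * (1 - v) ^ (-(1 / 2) : ℝ) * ((m + 1 / 2) * (1 - v) - 1 / 2)) v := by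
  have h := (Real.hasDerivAt_rpow_const (p := m) (Or.inl hv0.ne')).mul
    (((hasDerivAt_id v).const_sub 1).sqrt (sub_pos.2 hv).ne')
  refine h.congr_deriv ?_
  have hs := Real.sqrt_pos.2 (sub_pos.2 hv)
  have e : v ^ m = v ^ (m - 1) * v := by
    rw [← Real.rpow_add_one hv0.ne']; simp
  simp only [id]
  rw [e, one_sub_rpow_eq hv]
  have h2 : Real.sqrt (1 - v) ^ 2 = 1 - v := Real.sq_sqrt (sub_pos.2 hv).le
  field_simp
  rw [h2]
  ring

theorem continuous_studentCore (hm : 2 ≤ m) : Continuous (studentCore m) := by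
  have h1 := continuous_incBeta (m := m) (by linarith)
  have h2 := continuous_rpow_mul_sqrt (m := m) (by linarith)
  exact ((continuous_logIncBeta hm).neg.sub (continuous_const.mul h1)).sub (h2.div_const _)

theorem studentCore_zero (hm : 2 ≤ m) : studentCore m 0 = 0 := by
  rw [studentCore, logIncBeta_zero, incBeta_zero, Real.zero_rpow (by linarith)]
  simp

theorem studentCore_one (hm : 2 ≤ m) : studentCore m 1 = 0 := by
  rw [studentCore, logIncBeta_one (by linarith), incBeta_one (by linarith), sub_self,
    Real.sqrt_zero]
  ring

theorem hasDerivAt_studentCore (hm : 2 ≤ m) (hv0 : 0 < v) (hv : v < 1) :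
    HasDerivAt (studentCore m) (v ^ (m - 1) * (1 - v) ^ (-(1 / 2) : ℝ) *
      (-Real.log v - (digamma (m + 1 / 2) - digamma m) -
        ((m + 1 / 2) * (1 - v) - 1 / 2) / (m - 1))) v := by
  have h := ((hasDerivAt_logIncBeta hm hv).neg.sub ((hasDerivAt_incBeta (m := m)
    (by linarith) hv).const_mul
    (digamma (m + 1 / 2) - digamma m))).sub ((hasDerivAt_rpow_mul_sqrt (m := m) hv0 hv).div_const
    (m - 1))
  refine h.congr_deriv ?_
  ring

/-- In `s = 1 - v`, which grows outward, the core vanishes at both ends of `(0, 1)` and its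
derivative is a positive weight times `log (1 - s)` plus an affine function, which is concave. The
sign lemma applies as in the generalised Gaussian case. -/
theorem studentCore_pos_of_le {v₀ : ℝ} (hm : 2 ≤ m) (hv : 0 < v) (hvv : v ≤ v₀) (hv₀ : v₀ < 1)
    (h : 0 < studentCore m v₀) : 0 < studentCore m v := by
  set δ := digamma (m + 1 / 2) - digamma m with hδ
  have hconc : ConcaveOn ℝ (Ioo 0 1) fun s : ℝ => -(-Real.log (1 - s) - δ -
      ((m + 1 / 2) * s - 1 / 2) / (m - 1)) := by
    have h1 : ConcaveOn ℝ (Ioo (0 : ℝ) 1) fun s : ℝ => Real.log (1 - s) := by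
      have h := strictConcaveOn_log_Ioi.concaveOn.comp_affineMap
        (AffineMap.const ℝ ℝ (1 : ℝ) - AffineMap.id ℝ ℝ)
      refine (h.subset (fun s hs => ?_) (convex_Ioo 0 1)).congr fun s hs => ?_
      · simpa using hs.2
      · simp
    have h2 : ConcaveOn ℝ (Ioo (0 : ℝ) 1) fun s : ℝ =>
        (m + 1 / 2) / (m - 1) * s + (δ - 1 / 2 / (m - 1)) :=
      ((LinearMap.mul ℝ ℝ ((m + 1 / 2) / (m - 1))).concaveOn (convex_Ioo 0 1)).add_const _
    refine (h1.add h2).congr fun s _ => ?_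
    simp only [Pi.add_apply]
    ring
  have hd : ∀ s ∈ Ioo (0 : ℝ) 1, HasDerivAt (fun s => studentCore m (1 - s))
      ((1 - s) ^ (m - 1) * s ^ (-(1 / 2) : ℝ) * -(-Real.log (1 - s) - δ -
      ((m + 1 / 2) * s - 1 / 2) / (m - 1))) s := by
    intro s hs
    have h1 := (hasDerivAt_studentCore hm (v := 1 - s) (by linarith [hs.2])
      (by linarith [hs.1])).comp s ((hasDerivAt_id s).const_sub 1)
    refine h1.congr_deriv ?_
    rw [sub_sub_cancel]
    ring
  have hcont : Continuous fun s => studentCore m (1 - s) :=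
    (continuous_studentCore hm).comp (by fun_prop)
  have hkey := pos_of_hasDerivAt_mul_concaveOn (convex_Ioo (0 : ℝ) 1) hd
    (fun s hs => mul_pos (Real.rpow_pos_of_pos (by linarith [hs.2]) _)
      (Real.rpow_pos_of_pos hs.1 _)) hconc (y₀ := 1 - v₀) (y₁ := 1 - v)
    ⟨by linarith, by linarith⟩ ⟨by linarith, by linarith⟩ (by linarith)
    (by simpa using h) ?_ ?_
  · simpa using hkey
  · have h0 : Tendsto (fun s => studentCore m (1 - s)) (𝓝[>] 0) (𝓝 0) := by
      have := (hcont.tendsto 0).mono_left (nhdsWithin_le_nhds (s := Ioi 0))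
      rwa [sub_zero, studentCore_one hm] at this
    obtain ⟨s, h1, h2⟩ := ((h0.eventually (gt_mem_nhds h)).and
      (Ioo_mem_nhdsGT (by linarith : (0 : ℝ) < 1 - v₀))).exists
    exact ⟨s, ⟨h2.1, by linarith [h2.2]⟩, h2.2, by simpa using h1⟩
  · intro hle
    have h1 : Tendsto (fun s => studentCore m (1 - s)) (𝓝[<] 1) (𝓝 0) := by
      have := (hcont.tendsto 1).mono_left (nhdsWithin_le_nhds (s := Iio 1))
      rwa [sub_self, studentCore_zero hm] at this
    have hmid : 1 - v < 1 - v / 2 := by linarith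
    rcases le_or_gt (studentCore m (1 - (1 - v))) (studentCore m (1 - (1 - v / 2))) with h2 | h2
    · exact ⟨1 - v, ⟨by linarith, by linarith⟩, 1 - v / 2, ⟨by linarith, by linarith⟩, le_rfl,
        hmid, h2⟩
    · obtain ⟨q, h3, h4⟩ := ((h1.eventually (lt_mem_nhds (h2.trans_le hle))).and
        (Ioo_mem_nhdsLT (by linarith : 1 - v / 2 < 1))).exists
      exact ⟨1 - v / 2, ⟨by linarith, by linarith⟩, q, ⟨by linarith [h4.1], h4.2⟩, hmid.le, h4.1,
        h3.le⟩

theorem le_incBeta (hm : 2 ≤ m) (hv0 : 0 ≤ v) (hv : v < 1) :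
    (m + 1) / (m * (1 / 2 + (m + 1 / 2) * (1 - v))) * (v ^ m * Real.sqrt (1 - v)) ≤
      incBeta m v := by
  have hden : ∀ u ≤ v, 0 < 1 / 2 + (m + 1 / 2) * (1 - u) := fun u hu => by nlinarith
  -- The maximum keeps the denominator positive on the whole line, as global continuity is required;
  -- on `[0, v]` it has no effect.
  have hcden : Continuous fun u => max (1 / 2) (1 / 2 + (m + 1 / 2) * (1 - u)) := by fun_prop
  set D : ℝ → ℝ := fun u => incBeta m u - (m + 1) / m *
    (u ^ m * Real.sqrt (1 - u) / max (1 / 2) (1 / 2 + (m + 1 / 2) * (1 - u))) with hD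
  have hmax : ∀ u ≤ v, max (1 / 2) (1 / 2 + (m + 1 / 2) * (1 - u)) =
      1 / 2 + (m + 1 / 2) * (1 - u) := fun u hu => max_eq_right (by nlinarith)
  have h := le_of_hasDerivAt_nonneg (D := D) (v := v)
    (D' := fun u => u ^ (m - 1) * (1 - u) ^ (-(1 / 2) : ℝ) *
      ((m + 1 / 2) / 2 * u ^ 2 / (m * (1 / 2 + (m + 1 / 2) * (1 - u)) ^ 2))) hv0 ?_ ?_ ?_
  · simp only [hD, hmax v le_rfl, incBeta_zero, Real.zero_rpow (by linarith : m ≠ 0)] at h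
    have e : (m + 1) / (m * (1 / 2 + (m + 1 / 2) * (1 - v))) * (v ^ m * Real.sqrt (1 - v)) =
        (m + 1) / m * (v ^ m * Real.sqrt (1 - v) / (1 / 2 + (m + 1 / 2) * (1 - v))) := by
      rw [← div_div]
      ring
    rw [e]
    simpa using h
  · refine (continuous_incBeta (by linarith)).sub (continuous_const.mul
      ((continuous_rpow_mul_sqrt (by linarith)).div hcden fun u => ?_))
    positivity
  · intro u hu
    have hu1 : u < 1 := hu.2.trans hv
    have hg := hden u hu.2.le
    have h1 := (hasDerivAt_incBeta (m := m) (by linarith) hu1).sub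
      (((hasDerivAt_rpow_mul_sqrt (m := m) hu.1 hu1).div
        ((((hasDerivAt_id u).const_sub 1).const_mul (m + 1 / 2)).const_add (1 / 2))
        hg.ne').const_mul ((m + 1) / m))
    refine (h1.congr_of_eventuallyEq ?_).congr_deriv ?_
    · filter_upwards [gt_mem_nhds hu.2] with w hw
      simp only [hD, hmax w hw.le]
      rfl
    · have e : u ^ m = u ^ (m - 1) * u := by
        rw [← Real.rpow_add_one hu.1.ne']; simp
      have hm0 : m ≠ 0 := by linarith
      simp only [id]
      rw [sqrt_one_sub_eq hu1, e]
      generalize hg' : 1 / 2 + (m + 1 / 2) * (1 - u) = g at hg ⊢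
      generalize u ^ (m - 1) = A
      generalize (1 - u) ^ (-(1 / 2) : ℝ) = C
      rw [show (m + 1 / 2) * (1 - u) = g - 1 / 2 by linarith]
      field_simp
      rw [← hg']
      ring
  · intro u hu
    have h1 : 0 < 1 - u := by linarith [hu.2]
    have := hu.1
    have : 0 < m := by linarith
    positivity

theorem one_add_half_le_one_sub_rpow {u : ℝ} (hu0 : 0 ≤ u) (hu : u < 1) :
    1 + u / 2 ≤ (1 - u) ^ (-(1 / 2) : ℝ) := by
  have hs := Real.sqrt_pos.2 (sub_pos.2 hu)
  have h2 := Real.sq_sqrt (sub_pos.2 hu).le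
  rw [one_sub_rpow_eq hu, ← one_div, le_div_iff₀ hs]
  have h3 : Real.sqrt (1 - u) ≤ 1 - u / 2 := by
    nlinarith [sq_nonneg (Real.sqrt (1 - u) - 1)]
  nlinarith

/-- The excess is the integral of `u ^ (m - 1) log (v / u) (1 - u) ^ (-1/2)` over `(0, v)`.
Replacing the last factor by `1 + u / 2` makes it elementary. -/
theorem log_mul_incBeta_add_le (hm : 2 ≤ m) (hv0 : 0 < v) (hv : v < 1) :
    -Real.log v * incBeta m v + v ^ m * (1 / m ^ 2 + v / (2 * (m + 1) ^ 2)) ≤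
      -logIncBeta m v := by
  -- The exponents `m + 1 - 1` and `m + 2 - 1` are left unsimplified to match
  -- `continuous_rpow_mul_log`.
  set D : ℝ → ℝ := fun u => -logIncBeta m u + Real.log v * incBeta m u -
    (Real.log v * (u ^ m / m + u ^ (m + 1) / (2 * (m + 1))) -
      (u ^ (m + 1 - 1) * Real.log u / m + u ^ (m + 2 - 1) * Real.log u / (2 * (m + 1))) +
      (u ^ m / m ^ 2 + u ^ (m + 1) / (2 * (m + 1) ^ 2))) with hD
  have h := le_of_hasDerivAt_nonneg (D := D) (v := v)
    (D' := fun u => u ^ (m - 1) * ((1 - u) ^ (-(1 / 2) : ℝ) - (1 + u / 2)) *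
      (Real.log v - Real.log u)) hv0.le ?_ ?_ ?_
  · have e1 : v ^ (m + 1) = v ^ m * v := Real.rpow_add_one hv0.ne' m
    have e2 : v ^ (m + 2 - 1) = v ^ m * v := by
      rw [← e1]
      ring_nf
    simp only [hD, incBeta_zero, logIncBeta_zero, Real.log_zero, add_sub_cancel_right,
      Real.zero_rpow (by linarith : m ≠ 0), Real.zero_rpow (by linarith : m + 1 ≠ 0), e1, e2] at h
    have e3 : v ^ m * (1 / m ^ 2 + v / (2 * (m + 1) ^ 2)) =
      v ^ m / m ^ 2 + v ^ m * v / (2 * (m + 1) ^ 2) := by ring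
    rw [e3]
    simp only [mul_zero, zero_div, add_zero, sub_zero, neg_zero] at h
    have e4 : Real.log v * (v ^ m / m + v ^ m * v / (2 * (m + 1))) =
      v ^ m * Real.log v / m + v ^ m * v * Real.log v / (2 * (m + 1)) := by ring
    linarith
  · have c1 := continuous_rpow_mul_log (m := m + 1) (by linarith)
    have c2 := continuous_rpow_mul_log (m := m + 2) (by linarith)
    have c3 := Real.continuous_rpow_const (q := m) (by linarith)
    have c4 := Real.continuous_rpow_const (q := m + 1) (by linarith)
    have c5 := continuous_logIncBeta hm
    have c6 := continuous_incBeta (m := m) (by linarith)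
    exact (c5.neg.add (continuous_const.mul c6)).sub (((continuous_const.mul
      ((c3.div_const _).add (c4.div_const _))).sub ((c1.div_const _).add (c2.div_const _))).add
      ((c3.div_const _).add (c4.div_const _)))
  · intro u hu
    have hu1 : u < 1 := hu.2.trans hv
    have hne := hu.1.ne'
    have r1 := Real.hasDerivAt_rpow_const (p := m) (Or.inl hne)
    have r2 := Real.hasDerivAt_rpow_const (p := m + 1) (Or.inl hne)
    have r3 := (Real.hasDerivAt_rpow_const (p := m + 1 - 1) (Or.inl hne)).mul
      (Real.hasDerivAt_log hne)
    have r4 := (Real.hasDerivAt_rpow_const (p := m + 2 - 1) (Or.inl hne)).mul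
      (Real.hasDerivAt_log hne)
    have h1 := ((hasDerivAt_logIncBeta hm hu1).neg.add
      ((hasDerivAt_incBeta (m := m) (by linarith) hu1).const_mul (Real.log v))).sub
      (((((r1.div_const m).add (r2.div_const (2 * (m + 1)))).const_mul (Real.log v)).sub
        ((r3.div_const m).add (r4.div_const (2 * (m + 1))))).add
        ((r1.div_const (m ^ 2)).add (r2.div_const (2 * (m + 1) ^ 2))))
    refine h1.congr_deriv ?_
    have e1 : u ^ m = u ^ (m - 1) * u := by
      rw [← Real.rpow_add_one hne]; simp
    have e2 : u ^ (m + 1) = u ^ (m - 1) * u * u := by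
      rw [Real.rpow_add_one hne, e1]
    have hm0 : m ≠ 0 := by linarith
    have hm1 : m + 1 ≠ 0 := by linarith
    rw [show m + 2 - 1 = m + 1 by ring, add_sub_cancel_right, e1, e2]
    field_simp
    ring
  · intro u hu
    have hu1 : u < 1 := hu.2.trans hv
    exact mul_nonneg (mul_nonneg (Real.rpow_nonneg hu.1.le _)
      (sub_nonneg.2 (one_add_half_le_one_sub_rpow hu.1.le hu1)))
      (sub_nonneg.2 (Real.log_le_log hu.1 hu.2.le))

theorem one_sub_add_sq_le_neg_log {r : ℝ} (hr0 : 0 < r) (hr : r ≤ 1) :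
    (1 - r) + (1 - r) ^ 2 / 2 ≤ -Real.log r := by
  have h := sum_le_hasSum (Finset.range 2) (fun n _ => by
      have : 0 ≤ 1 - r := by linarith
      positivity)
    (Real.hasSum_pow_div_log_of_abs_lt_one (x := 1 - r) (by rw [abs_lt]; constructor <;> linarith))
  rw [sub_sub_cancel] at h
  norm_num [Finset.sum_range_succ] at h
  exact h

/-- Here `log (v / u)` is bounded below by its quadratic Taylor polynomial in `1 - u / v`, and the
singular weight is kept exact. -/
theorem taylor_le_neg_logIncBeta (hm : 2 ≤ m) (hv0 : 0 < v) (hv : v < 1) :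
    (-Real.log v + (1 / (2 * m + 1) - (1 - v)) / v +
      (3 / ((2 * m + 1) * (2 * m + 3)) - 2 * (1 - v) / (2 * m + 1) + (1 - v) ^ 2) / (2 * v ^ 2)) *
        incBeta m v +
      (2 / (2 * m + 1) / v + ((6 / (2 * m + 1) + 2 * (1 - v)) / (2 * m + 3) -
        4 * (1 - v) / (2 * m + 1)) / (2 * v ^ 2)) * (v ^ m * Real.sqrt (1 - v)) ≤
      -logIncBeta m v := by
  set P : ℝ → ℝ := fun u => u ^ m * Real.sqrt (1 - u) with hP
  -- `Z₁` and `Z₂` are the integrals of `1 - u` and `(1 - u) ^ 2` against the Beta weight, reduced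
  -- by parts to `incBeta` and `P`.
  set Z₁ : ℝ → ℝ := fun u => (incBeta m u + 2 * P u) / (2 * m + 1) with hZ₁
  set Z₂ : ℝ → ℝ := fun u => (3 * Z₁ u + 2 * ((1 - u) * P u)) / (2 * m + 3) with hZ₂
  set D : ℝ → ℝ := fun u => -logIncBeta m u - (-Real.log v * incBeta m u +
    (Z₁ u - (1 - v) * incBeta m u) / v +
    (Z₂ u - 2 * (1 - v) * Z₁ u + (1 - v) ^ 2 * incBeta m u) / (2 * v ^ 2)) with hD
  have hm1 : 0 < 2 * m + 1 := by linarith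
  have hm3 : 0 < 2 * m + 3 := by linarith
  have h := le_of_hasDerivAt_nonneg (D := D) (v := v)
    (D' := fun u => u ^ (m - 1) * (1 - u) ^ (-(1 / 2) : ℝ) *
      (-Real.log u + Real.log v - (1 - u / v) - (1 - u / v) ^ 2 / 2)) hv0.le ?_ ?_ ?_
  · have h0 : D 0 = 0 := by
      simp [hD, hZ₂, hZ₁, hP, incBeta_zero, logIncBeta_zero, Real.zero_rpow (by linarith : m ≠ 0)]
    rw [h0] at h
    refine le_of_sub_nonneg (h.trans_eq ?_)
    simp only [hD, hZ₂, hZ₁, hP]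
    field_simp
    ring
  · have c1 : Continuous P := continuous_rpow_mul_sqrt (by linarith)
    have c5 := continuous_logIncBeta hm
    have c6 := continuous_incBeta (m := m) (by linarith)
    have c2 : Continuous Z₁ := (c6.add (continuous_const.mul c1)).div_const _
    have c3 : Continuous Z₂ := ((continuous_const.mul c2).add (continuous_const.mul
      ((continuous_const.sub continuous_id).mul c1))).div_const _
    exact c5.neg.sub (((continuous_const.mul c6).add ((c2.sub (continuous_const.mul c6)).div_const
      _)).add (((c3.sub (continuous_const.mul c2)).add (continuous_const.mul c6)).div_const _))
  · intro u hu
    have hu1 : u < 1 := hu.2.trans hv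
    have hne := hu.1.ne'
    have r1 : HasDerivAt P _ u := hasDerivAt_rpow_mul_sqrt (m := m) hu.1 hu1
    have r2 := hasDerivAt_incBeta (m := m) (by linarith) hu1
    have r3 : HasDerivAt Z₁ _ u := (r2.add (r1.const_mul 2)).div_const (2 * m + 1)
    have r4 : HasDerivAt Z₂ _ u := ((r3.const_mul 3).add
      ((((hasDerivAt_id u).const_sub 1).mul r1).const_mul 2)).div_const (2 * m + 3)
    have h1 : HasDerivAt D _ u := (hasDerivAt_logIncBeta hm hu1).neg.sub
      (((r2.const_mul (-Real.log v)).add ((r3.sub (r2.const_mul (1 - v))).div_const v)).add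
      (((r4.sub (r3.const_mul (2 * (1 - v)))).add (r2.const_mul ((1 - v) ^ 2))).div_const
        (2 * v ^ 2)))
    refine h1.congr_deriv ?_
    have e1 : u ^ m = u ^ (m - 1) * u := by
      rw [← Real.rpow_add_one hne]; simp
    simp only [hP, id]
    rw [sqrt_one_sub_eq hu1, e1]
    generalize u ^ (m - 1) = A
    generalize (1 - u) ^ (-(1 / 2) : ℝ) = C
    field_simp
    ring
  · intro u hu
    have hu1 : u < 1 := hu.2.trans hv
    refine mul_nonneg (mul_nonneg (Real.rpow_nonneg hu.1.le _)
      (Real.rpow_nonneg (by linarith) _)) ?_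
    have := one_sub_add_sq_le_neg_log (div_pos hu.1 hv0) ((div_le_one hv0).2 hu.2.le)
    rw [Real.log_div hu.1.ne' hv0.ne'] at this
    linarith

end

/-! ### The Student test point -/

section

variable {m : ℝ}

/-- The test point `v = (5m - 7) / (5m + 3)` corresponds to `x ^ 2 = 20 (m - 1) / (5m - 7)`, which
tends to `4` in the Gaussian limit. -/
theorem one_sub_studentPoint (hm : 2 ≤ m) :
    1 - (5 * m - 7) / (5 * m + 3) = 10 / (5 * m + 3) := by
  have : 5 * m + 3 ≠ 0 := by linarith
  field_simp
  ring

theorem neg_log_studentPoint_ge (hm : 2 ≤ m) (n : ℕ) :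
    ∑ k ∈ Finset.range n, 2 * (1 / (2 * (k : ℝ) + 1)) * (5 / (5 * m - 2)) ^ (2 * k + 1) ≤
      -Real.log ((5 * m - 7) / (5 * m + 3)) := by
  have h := log_one_add_inv_ge (s := (5 * m - 7) / 10) (by linarith) n
  have h1 : 5 * m - 7 ≠ 0 := by linarith
  have h2 : 5 * m - 2 ≠ 0 := by linarith
  have h3 : 5 * m + 3 ≠ 0 := by linarith
  have h4 : 2 * ((5 * m - 7) / 10) + 1 ≠ 0 := by linarith
  have e1 : 1 / (2 * ((5 * m - 7) / 10) + 1) = 5 / (5 * m - 2) := by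
    rw [div_eq_div_iff h4 h2]
    ring
  have e2 : 1 + 1 / ((5 * m - 7) / 10) = (5 * m + 3) / (5 * m - 7) := by
    field_simp
    ring
  rw [← Real.log_inv, inv_div, ← e1, ← e2]
  exact h

theorem incBeta_studentPoint_ge (hm : 2 ≤ m) :
    (6 + 16 * m + 10 * m ^ 2) / (m * (13 + 25 * m)) *
      (((5 * m - 7) / (5 * m + 3)) ^ m * Real.sqrt (1 - (5 * m - 7) / (5 * m + 3))) ≤
      incBeta m ((5 * m - 7) / (5 * m + 3)) := by
  have h0 : 0 < 5 * m + 3 := by linarith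
  have h := le_incBeta (v := (5 * m - 7) / (5 * m + 3)) hm
    (div_nonneg (by linarith) (by linarith)) (by rw [div_lt_one h0]; linarith)
  convert h using 2
  rw [one_sub_studentPoint hm]
  have h1 : m ≠ 0 := by linarith
  have h2 : 13 + 25 * m ≠ 0 := by linarith
  have h3 : 5 * m + 3 ≠ 0 := h0.ne'
  have h4 : 1 / 2 + (m + 1 / 2) * (10 / (5 * m + 3)) = (13 + 25 * m) / (2 * (5 * m + 3)) := by
    field_simp
    ring
  rw [h4]
  field_simp
  ring

/-- Each term is bounded below by a rational multiple of `v ^ m √(1 - v)`. The resulting rational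
function has a negative leading coefficient, so this argument is limited to small `m`. -/
theorem studentCore_studentPoint_pos_of_le_three (hm : 2 ≤ m) (hm3 : m ≤ 3) :
    0 < studentCore m ((5 * m - 7) / (5 * m + 3)) := by
  have hK := incBeta_studentPoint_ge hm
  have hL := neg_log_studentPoint_ge hm 3
  have hs := one_sub_studentPoint hm
  have hδ := digamma_add_half_sub_le (m := m) (by linarith)
  have hv0 : 0 < (5 * m - 7) / (5 * m + 3) := div_pos (by linarith) (by linarith)
  have hs0 : 0 < 10 / (5 * m + 3) := div_pos (by norm_num) (by linarith)
  have hv1 : (5 * m - 7) / (5 * m + 3) < 1 := by linarith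
  have hE := log_mul_incBeta_add_le hm hv0 hv1
  have hvv : (5 * m - 7) / (5 * m + 3) = 1 - 10 / (5 * m + 3) := by linarith
  have hvm : 0 < ((5 * m - 7) / (5 * m + 3)) ^ m := Real.rpow_pos_of_pos hv0 m
  set v := (5 * m - 7) / (5 * m + 3) with hv
  have hsq := Real.sqrt_pos.2 (sub_pos.2 hv1)
  have hP : 0 < v ^ m * Real.sqrt (1 - v) := mul_pos hvm hsq
  -- The elementary bound leaves a bare `v ^ m`; the inequality `√(1 - v) ≤ (1 + (1 - v)) / 2`
  -- rewrites it as a multiple of `v ^ m √(1 - v)`.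
  have hsle : Real.sqrt (1 - v) * ((5 * m + 3) / (5 * m + 13)) ≤ 1 / 2 := by
    have h1 : Real.sqrt (1 - v) ≤ (5 * m + 13) / (2 * (5 * m + 3)) := by
      have h2 := Real.sq_sqrt (sub_pos.2 hv1).le
      have h3 : (1 + (1 - v)) / 2 = (5 * m + 13) / (2 * (5 * m + 3)) := by
        rw [hs]
        have : 5 * m + 3 ≠ 0 := by linarith
        field_simp
        ring
      rw [← h3]
      nlinarith [sq_nonneg (Real.sqrt (1 - v) - 1)]
    have h4 : 0 < (5 * m + 3) / (5 * m + 13) := div_pos (by linarith) (by linarith)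
    refine (mul_le_mul_of_nonneg_right h1 h4.le).trans_eq ?_
    have : 5 * m + 3 ≠ 0 := by linarith
    have : 5 * m + 13 ≠ 0 := by linarith
    field_simp
  have hvP : v ^ m * Real.sqrt (1 - v) * (2 * ((5 * m + 3) / (5 * m + 13))) ≤ v ^ m := by
    nlinarith
  set W := 1 / m ^ 2 + v / (2 * (m + 1) ^ 2) with hW
  have hW0 : 0 ≤ W := by
    have : 0 < m := by linarith
    positivity
  set A := 2 * (5 / (5 * m - 2)) + 2 / 3 * (5 / (5 * m - 2)) ^ 3 + 2 / 5 * (5 / (5 * m - 2)) ^ 5 -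
    2 / (4 * m - 1) with hA
  have hA0 : 0 ≤ A := by
    have h1 : 0 < 5 / (5 * m - 2) := div_pos (by norm_num) (by linarith)
    have h2 : 2 / (4 * m - 1) ≤ 2 * (5 / (5 * m - 2)) := by
      rw [mul_div_assoc', div_le_div_iff₀ (by linarith) (by linarith)]
      linarith
    have : 0 < (5 / (5 * m - 2)) ^ 3 := by positivity
    have : 0 < (5 / (5 * m - 2)) ^ 5 := by positivity
    rw [hA]
    linarith
  have hAle : A ≤ -Real.log v - (digamma (m + 1 / 2) - digamma m) := by
    have e : 1 / (2 * m - 1 / 2) = 2 / (4 * m - 1) := by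
      rw [div_eq_div_iff (by linarith) (by linarith)]
      ring
    rw [e] at hδ
    norm_num [Finset.sum_range_succ] at hL
    rw [hA]
    linarith
  set K := (6 + 16 * m + 10 * m ^ 2) / (m * (13 + 25 * m)) with hKd
  have hrat : 0 < A * K + W * (2 * ((5 * m + 3) / (5 * m + 13))) - 1 / (m - 1) := by
    rw [hA, hW, hKd, hv]
    obtain ⟨x, hx, rfl⟩ : ∃ x : ℝ, 0 ≤ x ∧ m = 2 + x := ⟨m - 2, by linarith, by ring⟩
    have e : (2 * (5 / (5 * (2 + x) - 2)) + 2 / 3 * (5 / (5 * (2 + x) - 2)) ^ 3 +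
        2 / 5 * (5 / (5 * (2 + x) - 2)) ^ 5 - 2 / (4 * (2 + x) - 1)) *
        ((6 + 16 * (2 + x) + 10 * (2 + x) ^ 2) / ((2 + x) * (13 + 25 * (2 + x)))) +
        (1 / (2 + x) ^ 2 + (5 * (2 + x) - 7) / (5 * (2 + x) + 3) / (2 * (2 + x + 1) ^ 2)) *
        (2 * ((5 * (2 + x) + 3) / (5 * (2 + x) + 13))) - 1 / (2 + x - 1) =
        (3304444680 + 23359526100 * x + 64871329560 * x ^ 2 + 93315682600 * x ^ 3 +
          68147490960 * x ^ 4 + 6889995610 * x ^ 5 - 35335675550 * x ^ 6 - 37277721500 * x ^ 7 -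
          20285665625 * x ^ 8 - 6825890625 * x ^ 9 - 1435015625 * x ^ 10 - 174140625 * x ^ 11 -
          9375000 * x ^ 12) /
        (15 * (8 + 5 * x) ^ 5 * (7 + 4 * x) * (2 + x) ^ 2 * (63 + 25 * x) * (1 + x) * (3 + x) ^ 2 *
          (23 + 5 * x)) := by
      rw [show 5 * (2 + x) - 2 = 8 + 5 * x by ring, show 4 * (2 + x) - 1 = 7 + 4 * x by ring,
        show 13 + 25 * (2 + x) = 63 + 25 * x by ring, show 5 * (2 + x) + 3 = 13 + 5 * x by ring,
        show 2 + x + 1 = 3 + x by ring, show 5 * (2 + x) + 13 = 23 + 5 * x by ring,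
        show 2 + x - 1 = 1 + x by ring]
      field_simp
      ring
    rw [e]
    refine div_pos ?_ (by positivity)
    have hx1 : x ≤ 1 := by linarith
    -- On `[0, 1]` the powers decrease, so the positive low-order coefficients absorb the negative
    -- high-order ones.
    have hstep : ∀ n : ℕ, x ^ (n + 1) ≤ x ^ n := fun n => pow_le_pow_of_le_one hx hx1 n.le_succ
    have p2 := hstep 1
    have p3 := hstep 2
    have p4 := hstep 3
    have p5 := hstep 4
    have p6 := hstep 5
    have p7 := hstep 6
    have p8 := hstep 7
    have p9 := hstep 8
    have p10 := hstep 9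
    have p11 := hstep 10
    have p12 := hstep 11
    have p0 : 0 ≤ x ^ 12 := pow_nonneg hx 12
    norm_num at p2 p3 p4 p5 p6 p7 p8 p9 p10 p11 p12
    linarith
  have h1 := mul_le_mul_of_nonneg_left hK hA0
  have h2 := mul_le_mul_of_nonneg_right hAle (hK.trans' (by positivity : (0 : ℝ) ≤ _))
  have h3 := mul_le_mul_of_nonneg_right hvP hW0
  have h4 := mul_pos hP hrat
  rw [studentCore]
  have h5 : v ^ m * Real.sqrt (1 - v) * (A * K + W * (2 * ((5 * m + 3) / (5 * m + 13))) -
      1 / (m - 1)) = A * (K * (v ^ m * Real.sqrt (1 - v))) +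
      v ^ m * Real.sqrt (1 - v) * (2 * ((5 * m + 3) / (5 * m + 13))) * W -
      v ^ m * Real.sqrt (1 - v) / (m - 1) := by ring
  linarith

/-- The quadratic Taylor bound remains good as `m` grows: with origin `m = 3` all coefficients are
positive. It is not enough down to `m = 2`, where the same rational function is negative. -/
theorem studentCore_studentPoint_pos_of_three_le (hm : 3 ≤ m) :
    0 < studentCore m ((5 * m - 7) / (5 * m + 3)) := by
  have hm2 : 2 ≤ m := by linarith
  have hK := incBeta_studentPoint_ge hm2
  have hL := neg_log_studentPoint_ge hm2 2
  have hs := one_sub_studentPoint hm2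
  have hδ := digamma_add_half_sub_le (m := m) (by linarith)
  have hv0 : 0 < (5 * m - 7) / (5 * m + 3) := div_pos (by linarith) (by linarith)
  have hs0 : 0 < 10 / (5 * m + 3) := div_pos (by norm_num) (by linarith)
  have hv1 : (5 * m - 7) / (5 * m + 3) < 1 := by linarith
  have hE := taylor_le_neg_logIncBeta hm2 hv0 hv1
  have hP : 0 < ((5 * m - 7) / (5 * m + 3)) ^ m * Real.sqrt (1 - (5 * m - 7) / (5 * m + 3)) :=
    mul_pos (Real.rpow_pos_of_pos hv0 m) (Real.sqrt_pos.2 (sub_pos.2 hv1))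
  rw [studentCore]
  generalize ((5 * m - 7) / (5 * m + 3)) ^ m * Real.sqrt (1 - (5 * m - 7) / (5 * m + 3)) = P at *
  generalize incBeta m ((5 * m - 7) / (5 * m + 3)) = F at *
  generalize logIncBeta m ((5 * m - 7) / (5 * m + 3)) = J at *
  generalize digamma (m + 1 / 2) - digamma m = δ at *
  have e : 1 / (2 * m - 1 / 2) = 2 / (4 * m - 1) := by
    rw [div_eq_div_iff (by linarith) (by linarith)]
    ring
  rw [e] at hδ
  norm_num [Finset.sum_range_succ] at hL
  rw [hs] at hE
  generalize hA : Real.log ((5 * m - 7) / (5 * m + 3)) = A at *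
  set c := (1 / (2 * m + 1) - 10 / (5 * m + 3)) / ((5 * m - 7) / (5 * m + 3)) +
    (3 / ((2 * m + 1) * (2 * m + 3)) - 2 * (10 / (5 * m + 3)) / (2 * m + 1) +
      (10 / (5 * m + 3)) ^ 2) / (2 * ((5 * m - 7) / (5 * m + 3)) ^ 2) with hc
  set d := 2 / (2 * m + 1) / ((5 * m - 7) / (5 * m + 3)) +
    ((6 / (2 * m + 1) + 2 * (10 / (5 * m + 3))) / (2 * m + 3) -
      4 * (10 / (5 * m + 3)) / (2 * m + 1)) / (2 * ((5 * m - 7) / (5 * m + 3)) ^ 2) with hd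
  set B := 2 * (5 / (5 * m - 2)) + 2 / 3 * (5 / (5 * m - 2)) ^ 3 - 2 / (4 * m - 1) with hB
  set K := (6 + 16 * m + 10 * m ^ 2) / (m * (13 + 25 * m)) with hKd
  have hcF : 0 ≤ B + c := by
    rw [hB, hc]
    obtain ⟨x, hx, rfl⟩ : ∃ x : ℝ, 0 ≤ x ∧ m = 3 + x := ⟨m - 3, by linarith, by ring⟩
    rw [show 5 * (3 + x) - 2 = 13 + 5 * x by ring, show 4 * (3 + x) - 1 = 11 + 4 * x by ring,
      show 2 * (3 + x) + 1 = 7 + 2 * x by ring, show 2 * (3 + x) + 3 = 9 + 2 * x by ring,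
      show 5 * (3 + x) + 3 = 18 + 5 * x by ring, show 5 * (3 + x) - 7 = 8 + 5 * x by ring]
    have e : 2 * (5 / (13 + 5 * x)) + 2 / 3 * (5 / (13 + 5 * x)) ^ 3 - 2 / (11 + 4 * x) +
        ((1 / (7 + 2 * x) - 10 / (18 + 5 * x)) / ((8 + 5 * x) / (18 + 5 * x)) +
        (3 / ((7 + 2 * x) * (9 + 2 * x)) - 2 * (10 / (18 + 5 * x)) / (7 + 2 * x) +
        (10 / (18 + 5 * x)) ^ 2) / (2 * ((8 + 5 * x) / (18 + 5 * x)) ^ 2)) =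
        (57521088 + 97266760 * x + 130679325 / 2 * x ^ 2 + 43376375 / 2 * x ^ 3 +
          7081875 / 2 * x ^ 4 + 453125 / 2 * x ^ 5) /
        (3 * (13 + 5 * x) ^ 3 * (11 + 4 * x) * (7 + 2 * x) * (9 + 2 * x) * (8 + 5 * x) ^ 2) := by
      field_simp
      ring
    rw [e]
    positivity
  have hrat : 0 < (B + c) * K + d - 1 / (m - 1) := by
    rw [hB, hc, hd, hKd]
    obtain ⟨x, hx, rfl⟩ : ∃ x : ℝ, 0 ≤ x ∧ m = 3 + x := ⟨m - 3, by linarith, by ring⟩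
    rw [show 5 * (3 + x) - 2 = 13 + 5 * x by ring, show 4 * (3 + x) - 1 = 11 + 4 * x by ring,
      show 2 * (3 + x) + 1 = 7 + 2 * x by ring, show 2 * (3 + x) + 3 = 9 + 2 * x by ring,
      show 5 * (3 + x) + 3 = 18 + 5 * x by ring, show 5 * (3 + x) - 7 = 8 + 5 * x by ring,
      show 13 + 25 * (3 + x) = 88 + 25 * x by ring, show 3 + x - 1 = 2 + x by ring]
    have e : (2 * (5 / (13 + 5 * x)) + 2 / 3 * (5 / (13 + 5 * x)) ^ 3 - 2 / (11 + 4 * x) +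
        ((1 / (7 + 2 * x) - 10 / (18 + 5 * x)) / ((8 + 5 * x) / (18 + 5 * x)) +
        (3 / ((7 + 2 * x) * (9 + 2 * x)) - 2 * (10 / (18 + 5 * x)) / (7 + 2 * x) +
        (10 / (18 + 5 * x)) ^ 2) / (2 * ((8 + 5 * x) / (18 + 5 * x)) ^ 2))) *
        ((6 + 16 * (3 + x) + 10 * (3 + x) ^ 2) / ((3 + x) * (88 + 25 * x))) +
        (2 / (7 + 2 * x) / ((8 + 5 * x) / (18 + 5 * x)) +
        ((6 / (7 + 2 * x) + 2 * (10 / (18 + 5 * x))) / (9 + 2 * x) -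
        4 * (10 / (18 + 5 * x)) / (7 + 2 * x)) / (2 * ((8 + 5 * x) / (18 + 5 * x)) ^ 2)) -
        1 / (2 + x) =
        (28885248 + 1847925504 * x + 5818809812 * x ^ 2 + 8071947231 * x ^ 3 +
          6357575745 * x ^ 4 + 3102812175 * x ^ 5 + 960340125 * x ^ 6 + 184023750 * x ^ 7 +
          19956250 * x ^ 8 + 937500 * x ^ 9) /
        (3 * (13 + 5 * x) ^ 3 * (11 + 4 * x) * (7 + 2 * x) * (9 + 2 * x) * (8 + 5 * x) ^ 2 *
          (3 + x) * (88 + 25 * x) * (2 + x)) := by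
      field_simp
      ring
    rw [e]
    positivity
  have hF : 0 ≤ F := hK.trans' (mul_nonneg (div_nonneg (by positivity)
    (mul_nonneg (by linarith) (by linarith))) hP.le)
  have h1 := mul_le_mul_of_nonneg_left hK hcF
  have h2 : B + c ≤ -A - δ + c := by
    rw [hB]
    linarith
  have h3 := mul_le_mul_of_nonneg_right h2 hF
  have h4 := mul_pos hP hrat
  have h5 : P * ((B + c) * K + d - 1 / (m - 1)) = (B + c) * (K * P) + d * P - P / (m - 1) := by ring
  have h6 : (-A + (1 / (2 * m + 1) - 10 / (5 * m + 3)) / ((5 * m - 7) / (5 * m + 3)) +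
    (3 / ((2 * m + 1) * (2 * m + 3)) - 2 * (10 / (5 * m + 3)) / (2 * m + 1) +
      (10 / (5 * m + 3)) ^ 2) / (2 * ((5 * m - 7) / (5 * m + 3)) ^ 2)) * F = (-A + c) * F := by
    rw [hc]
    ring
  rw [h6] at hE
  linarith

theorem studentCore_studentPoint_pos (hm : 2 ≤ m) :
    0 < studentCore m ((5 * m - 7) / (5 * m + 3)) := by
  rcases le_total m 3 with h | h
  · exact studentCore_studentPoint_pos_of_le_three hm h
  · exact studentCore_studentPoint_pos_of_three_le h

end

/-- The derivative of `m log v` is nonnegative because `log (1 / v) ≤ (1 / v - v) / 2`. This allows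
`v ^ m` to be bounded below by its value at the left end of a range. -/
theorem monotoneOn_studentPoint_rpow :
    MonotoneOn (fun m : ℝ => ((5 * m - 7) / (5 * m + 3)) ^ m) (Ici 2) := by
  have hpos : ∀ m : ℝ, 2 ≤ m → 0 < (5 * m - 7) / (5 * m + 3) := fun m hm =>
    div_pos (by linarith) (by linarith)
  have hd : ∀ m : ℝ, 2 ≤ m → HasDerivAt (fun m => m * Real.log ((5 * m - 7) / (5 * m + 3)))
      (Real.log ((5 * m - 7) / (5 * m + 3)) + 50 * m / ((5 * m + 3) * (5 * m - 7))) m := by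
    intro m hm
    have h1 : 5 * m - 7 ≠ 0 := by linarith
    have h2 : 5 * m + 3 ≠ 0 := by linarith
    have h := (hasDerivAt_id m).mul ((((((hasDerivAt_id m).const_mul 5).sub_const 7).div
      (((hasDerivAt_id m).const_mul 5).add_const 3) h2)).log (hpos m hm).ne')
    refine h.congr_deriv ?_
    simp only [id, Pi.div_apply]
    field_simp
    ring
  have hmono : MonotoneOn (fun m : ℝ => m * Real.log ((5 * m - 7) / (5 * m + 3))) (Ici 2) := by
    refine monotoneOn_of_deriv_nonneg (convex_Ici 2)
      (fun m hm => (hd m hm).continuousAt.continuousWithinAt)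
      (fun m hm => (hd m (interior_subset hm)).differentiableAt.differentiableWithinAt)
      fun m hm => ?_
    have hm2 : 2 ≤ m := interior_subset hm
    have h1 : 0 < 5 * m - 7 := by linarith
    have h2 : 0 < 5 * m + 3 := by linarith
    rw [(hd m hm2).deriv]
    have h3 : (1 : ℝ) ≤ (5 * m + 3) / (5 * m - 7) := by
      rw [le_div_iff₀ h1]
      linarith
    have h4 := Real.self_le_sinh_iff.2 (Real.log_nonneg h3)
    rw [Real.sinh_log (by positivity), inv_div, ← inv_div (5 * m - 7), Real.log_inv,
      inv_div] at h4
    have h5 : ((5 * m + 3) / (5 * m - 7) - (5 * m - 7) / (5 * m + 3)) / 2 ≤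
        50 * m / ((5 * m + 3) * (5 * m - 7)) := by
      rw [div_sub_div _ _ h1.ne' h2.ne', div_div, div_le_div_iff₀ (by positivity) (by positivity)]
      have : 0 < (5 * m + 3) * (5 * m - 7) := by positivity
      nlinarith
    linarith
  intro a ha b hb hab
  simp only [Real.rpow_def_of_pos (hpos a ha), Real.rpow_def_of_pos (hpos b hb)]
  have := hmono ha hb hab
  exact Real.exp_le_exp.2 (by linarith)

/-- After the bound `Γ m √(m - 1/4) ≤ Γ (m + 1/2)`, squaring removes all the roots and leaves `π`, a
power of `v` and a rational function of `m`. -/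
theorem mul_beta_le_of_sq_bounds {m c w : ℝ} (hm : 2 ≤ m)
    (hc : c ≤ (((5 * m - 7) / (5 * m + 3)) ^ m) ^ 2) (hw0 : 0 ≤ w)
    (hw : w ≤ ((6 + 16 * m + 10 * m ^ 2) / (m * (13 + 25 * m))) ^ 2 *
      (10 / (5 * m + 3) * (m - 1 / 4)))
    (h : 0.0202 ^ 2 * 3.1416 ≤ c * w) :
    0.0202 * beta m (1 / 2) ≤ incBeta m ((5 * m - 7) / (5 * m + 3)) := by
  have hK := incBeta_studentPoint_ge hm
  have hG := Gamma_le_Gamma_add_half (m := m) (by linarith)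
  have h1 := Real.Gamma_pos_of_pos (by linarith : 0 < m)
  have h2 := Real.Gamma_pos_of_pos (by linarith : 0 < m + 1 / 2)
  have hs := Real.sqrt_pos.2 (by linarith : 0 < m - 1 / 4)
  have hm0 : 0 < m := by linarith
  refine le_trans ?_ hK
  rw [one_sub_studentPoint hm]
  have hv : 0 < ((5 * m - 7) / (5 * m + 3)) ^ m :=
    Real.rpow_pos_of_pos (div_pos (by linarith) (by linarith)) m
  generalize ((5 * m - 7) / (5 * m + 3)) ^ m = V at *
  generalize hKd : (6 + 16 * m + 10 * m ^ 2) / (m * (13 + 25 * m)) = K at *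
  have hK0 : 0 < K := by
    rw [← hKd]
    positivity
  have hX : 0 < K * (V * Real.sqrt (10 / (5 * m + 3))) := by positivity
  have hkey : 0.0202 * Real.sqrt Real.pi ≤
      K * (V * Real.sqrt (10 / (5 * m + 3))) * Real.sqrt (m - 1 / 4) := by
    refine (pow_le_pow_iff_left₀ (by positivity) (by positivity) two_ne_zero).1 ?_
    have e1 : (0.0202 * Real.sqrt Real.pi) ^ 2 = 0.0202 ^ 2 * Real.pi := by
      rw [mul_pow, Real.sq_sqrt Real.pi_pos.le]
    have e2 : (K * (V * Real.sqrt (10 / (5 * m + 3))) * Real.sqrt (m - 1 / 4)) ^ 2 =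
        V ^ 2 * (K ^ 2 * (10 / (5 * m + 3) * (m - 1 / 4))) := by
      rw [mul_pow, mul_pow, mul_pow, Real.sq_sqrt (by positivity), Real.sq_sqrt (by linarith)]
      ring
    rw [e1, e2]
    have h3 := mul_le_mul hc hw hw0 (sq_nonneg V)
    linarith [Real.pi_lt_d4]
  rw [beta_half, mul_div_assoc', div_le_iff₀ h2]
  refine le_trans ?_ (mul_le_mul_of_nonneg_left hG hX.le)
  linarith [mul_le_mul_of_nonneg_right hkey h1.le]

theorem mul_beta_le_incBeta_studentPoint {m : ℝ} (hm : 2 ≤ m) :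
    0.0202 * beta m (1 / 2) ≤ incBeta m ((5 * m - 7) / (5 * m + 3)) := by
  have h5 : 5 * m + 3 ≠ 0 := by linarith
  have h13 : 13 + 25 * m ≠ 0 := by linarith
  have hm0 : m ≠ 0 := by linarith
  -- At `m = 2` the test point is `3 / 13`, with `v ^ (2m) = 81 / 28561`. At `m = 2.4` it is `1 /
  -- 3`, with `v ^ (2m) = 3 ^ (-4.8) ≥ 1 / 243`.
  rcases le_total m 2.4 with h | h
  · refine mul_beta_le_of_sq_bounds (c := 81 / 28561) (w := 0.4525) hm ?_ (by norm_num) ?_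
      (by norm_num)
    · have h1 := monotoneOn_studentPoint_rpow self_mem_Ici hm hm
      norm_num at h1
      have h2 := pow_le_pow_left₀ (by norm_num) h1 2
      norm_num at h2
      exact h2
    · rw [← sub_nonneg]
      obtain ⟨x, hx, rfl⟩ : ∃ x : ℝ, 0 ≤ x ∧ m = 2 + x := ⟨m - 2, by linarith, by ring⟩
      have hx1 : x ≤ 0.4 := by linarith
      have e : ((6 + 16 * (2 + x) + 10 * (2 + x) ^ 2) / ((2 + x) * (13 + 25 * (2 + x)))) ^ 2 *
          (10 / (5 * (2 + x) + 3) * (2 + x - 1 / 4)) - 0.4525 =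
          (1307943 / 50 + 514524 / 25 * x - 2824137 / 200 * x ^ 2 - 785579 / 40 * x ^ 3 -
            56155 / 8 * x ^ 4 - 6625 / 8 * x ^ 5) /
          ((2 + x) ^ 2 * (63 + 25 * x) ^ 2 * (26 + 10 * x)) := by
        rw [show 13 + 25 * (2 + x) = 63 + 25 * x by ring,
          show 5 * (2 + x) + 3 = 13 + 5 * x by ring]
        norm_num
        field_simp
        ring
      rw [e]
      refine div_nonneg ?_ (by positivity)
      have p2 := pow_le_pow_left₀ hx hx1 2
      have p3 := pow_le_pow_left₀ hx hx1 3
      have p4 := pow_le_pow_left₀ hx hx1 4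
      have p5 := pow_le_pow_left₀ hx hx1 5
      norm_num at p2 p3 p4 p5
      linarith
  · refine mul_beta_le_of_sq_bounds (c := 1 / 243) (w := 0.32) hm ?_ (by norm_num) ?_
      (by norm_num)
    · have h1 := monotoneOn_studentPoint_rpow (a := 2.4) (by norm_num) hm h
      have h2 := pow_le_pow_left₀ (by positivity) h1 2
      refine le_trans ?_ h2
      have h3 : ((5 * 2.4 - 7) / (5 * 2.4 + 3) : ℝ) = 1 / 3 := by norm_num
      simp only [h3]
      rw [← Real.rpow_natCast, ← Real.rpow_mul (by norm_num)]
      have h4 : (1 / 3 : ℝ) ^ (5 : ℝ) ≤ (1 / 3 : ℝ) ^ ((2.4 : ℝ) * (2 : ℕ)) :=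
        Real.rpow_le_rpow_of_exponent_ge (by norm_num) (by norm_num) (by norm_num)
      refine le_trans (le_of_eq ?_) h4
      rw [show (5 : ℝ) = (5 : ℕ) by norm_num, Real.rpow_natCast]
      norm_num
    · rw [← sub_nonneg]
      obtain ⟨x, hx, rfl⟩ : ∃ x : ℝ, 0 ≤ x ∧ m = 2 + x := ⟨m - 2, by linarith, by ring⟩
      have e : ((6 + 16 * (2 + x) + 10 * (2 + x) ^ 2) / ((2 + x) * (13 + 25 * (2 + x)))) ^ 2 *
          (10 / (5 * (2 + x) + 3) * (2 + x - 1 / 4)) - 0.32 =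
          (2021292 / 25 + 3492912 / 25 * x + 2232568 / 25 * x ^ 2 + 125456 / 5 * x ^ 3 +
            2620 * x ^ 4) / ((2 + x) ^ 2 * (63 + 25 * x) ^ 2 * (26 + 10 * x)) := by
        rw [show 13 + 25 * (2 + x) = 63 + 25 * x by ring,
          show 5 * (2 + x) + 3 = 13 + 5 * x by ring]
        norm_num
        field_simp
        ring
      rw [e]
      positivity

/-! ### Student: derivative in the degrees of freedom, and conclusion -/

/-- The upper tail of the standardised Student law with `2 * m` degrees of freedom, as a function
of `m`. -/
noncomputable def stdStudentTail (x m : ℝ) : ℝ :=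
  incBeta m (1 / (1 + x ^ 2 / (2 * m - 2))) / (2 * beta m (1 / 2))

theorem studentTail_div_sqrt {ν x : ℝ} (hν : 2 < ν) :
    studentTail ν (x / Real.sqrt ((ν - 2) / ν)) = stdStudentTail x (ν / 2) := by
  have h1 : 0 < ν - 2 := by linarith
  have h2 : 0 < ν := by linarith
  rw [studentTail, stdStudentTail, div_pow, Real.sq_sqrt (by positivity)]
  congr 4
  field_simp

/-- Standardising makes the endpoint depend on `m`, with derivative `v (1 - v) / (m - 1)`; this
moving endpoint produces the last term of the core. -/
theorem hasDerivAt_stdStudentTail {x m : ℝ} (hx : 0 < x) (hm : 1 < m) :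
    HasDerivAt (stdStudentTail x) (-(studentCore m (1 / (1 + x ^ 2 / (2 * m - 2))) /
      (2 * beta m (1 / 2)))) m := by
  have hm0 : 0 < m := by linarith
  have h2m : 0 < 2 * m - 2 := by linarith
  have hq : 0 < x ^ 2 / (2 * m - 2) := by positivity
  have hD : 0 < 1 + x ^ 2 / (2 * m - 2) := by positivity
  have hV : HasDerivAt (fun m : ℝ => 1 / (1 + x ^ 2 / (2 * m - 2)))
      (1 / (1 + x ^ 2 / (2 * m - 2)) * (1 - 1 / (1 + x ^ 2 / (2 * m - 2))) / (m - 1)) m := by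
    have h := (((((hasDerivAt_id m).const_mul 2).sub_const 2).inv h2m.ne').const_mul
      (x ^ 2)).const_add 1
    have h' := h.inv (by simpa [div_eq_mul_inv] using hD.ne')
    simp only [one_div]
    refine (h'.congr_of_eventuallyEq (Eventually.of_forall fun y => ?_)).congr_deriv ?_
    · simp [div_eq_mul_inv]
    · have hm1 : m - 1 ≠ 0 := by linarith
      have e : 2 * m - 2 = 2 * (m - 1) := by ring
      simp only [id, Pi.inv_apply, ← div_eq_mul_inv] at *
      rw [e] at *
      have hne : 2 * (m - 1) + x ^ 2 ≠ 0 := by positivity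
      field_simp
      ring
  set v := 1 / (1 + x ^ 2 / (2 * m - 2)) with hv
  have hv0 : 0 < v := by positivity
  have hv1 : v < 1 := by
    rw [hv, div_lt_one hD]
    linarith
  have hk : ∀ᶠ p : ℝ × ℝ in 𝓝 (m, v),
      HasDerivAt (incBeta p.1) (p.2 ^ (p.1 - 1) * (1 - p.2) ^ (-(1 / 2) : ℝ)) p.2 := by
    filter_upwards [(lt_mem_nhds hm).prod_nhds (gt_mem_nhds hv1)] with p hp
    exact hasDerivAt_incBeta hp.1.le hp.2
  have hc : ContinuousAt (fun p : ℝ × ℝ => p.2 ^ (p.1 - 1) * (1 - p.2) ^ (-(1 / 2) : ℝ))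
      (m, v) := by
    refine ContinuousAt.mul ?_ ?_
    · exact ContinuousAt.rpow (by fun_prop) (by fun_prop) (Or.inl hv0.ne')
    · exact ContinuousAt.rpow_const (by fun_prop) (Or.inl (sub_pos.2 hv1).ne')
  have hd := hasDerivAt_param_comp (y := fun m => 1 / (1 + x ^ 2 / (2 * m - 2)))
    (k := fun m v => v ^ (m - 1) * (1 - v) ^ (-(1 / 2) : ℝ)) hk hc
    (hasDerivAt_incBeta_param hm0 hv0.le) hV
  have hB : 0 < beta m (1 / 2) := beta_pos hm0 (by norm_num)
  refine (hd.div ((hasDerivAt_beta_half hm0).const_mul 2) (by positivity)).congr_deriv ?_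
  rw [← hv, studentCore, sqrt_one_sub_eq hv1]
  have e : v ^ m = v ^ (m - 1) * v := by
    rw [← Real.rpow_add_one hv0.ne']; simp
  have hm1 : m - 1 ≠ 0 := by linarith
  rw [e]
  field_simp
  ring

theorem incBeta_mono {m v w : ℝ} (hm : 1 ≤ m) (hv : 0 ≤ v) (hvw : v ≤ w) (hw : w ≤ 1) :
    incBeta m v ≤ incBeta m w := by
  rw [← sub_nonneg, incBeta, incBeta, intervalIntegral.integral_interval_sub_left
    (intervalIntegrable_incBeta hm 0 w) (intervalIntegrable_incBeta hm 0 v)]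
  refine intervalIntegral.integral_nonneg hvw fun u hu => mul_nonneg ?_ ?_
  · exact Real.rpow_nonneg (hv.trans hu.1) _
  · exact Real.rpow_nonneg (sub_nonneg.2 (hu.2.trans hw)) _

theorem tailRadiusStrictMono_stdStudentLaw {τ : ℝ} (hτ : τ ∈ Ioo (0 : ℝ) 0.0202) :
    TailRadiusStrictMonoInKurtosis stdStudentLaw (Ioi 4) τ := by
  refine tailRadiusStrictMonoInKurtosis_of_strictAntiOn strictAntiOn_kurtosis_stdStudentLaw ?_
  intro a ha b hb hab
  rw [mem_Ioi] at ha hb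
  have hτ1 : τ ∈ Ioo (0 : ℝ) 1 := ⟨hτ.1, hτ.2.trans (by norm_num)⟩
  have hTa := hasTail_stdStudentLaw (by linarith : 2 < a)
  have hTb := hasTail_stdStudentLaw (by linarith : 2 < b)
  have hx := hTb.tailRadius_pos hτ1
  have hTx := hTb.apply_tailRadius hτ1
  set x := tailRadius (stdStudentLaw b) τ
  refine hTa.lt_tailRadius hτ1 hx.le ?_
  rw [studentTail_div_sqrt (by linarith)] at hTx ⊢
  rw [← hTx]
  -- The parameter is `-m`, so that the path runs from the lighter to the heavier law and a positive
  -- core means an increasing tail.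
  have hlt := lt_of_deriv_pos_of_lt (h := fun t => stdStudentTail x (-t)) (σ := 0.0202 / 2)
    (h' := fun t => studentCore (-t) (1 / (1 + x ^ 2 / (2 * -t - 2))) / (2 * beta (-t) (1 / 2)))
    (a := -(b / 2)) (b := -(a / 2)) (by linarith) ?_ ?_ ?_
  · simpa only [neg_neg] using hlt
  · intro t ht
    have h := (hasDerivAt_stdStudentTail hx (by linarith [ht.2] : 1 < -t)).comp t (hasDerivAt_neg t)
    refine h.congr_deriv ?_
    ring
  · simp only [neg_neg, hTx]
    linarith [hτ.2]
  · intro t ht hlt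
    have hm : 2 ≤ -t := by linarith [ht.2]
    generalize -t = m at hm hlt ⊢
    have hB : 0 < beta m (1 / 2) := beta_pos (by linarith) (by norm_num)
    refine div_pos ?_ (by positivity)
    have hq : 0 < x ^ 2 / (2 * m - 2) := div_pos (by positivity) (by linarith)
    have hv0 : 0 < 1 / (1 + x ^ 2 / (2 * m - 2)) := by positivity
    have hp1 : (5 * m - 7) / (5 * m + 3) < 1 := by
      rw [div_lt_one (by linarith)]
      linarith
    refine studentCore_pos_of_le hm hv0 ?_ hp1 (studentCore_studentPoint_pos hm)
    by_contra! hcon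
    have hv1 : 1 / (1 + x ^ 2 / (2 * m - 2)) ≤ 1 := by
      rw [div_le_one (by positivity)]
      linarith
    have hmono : incBeta m ((5 * m - 7) / (5 * m + 3)) ≤
        incBeta m (1 / (1 + x ^ 2 / (2 * m - 2))) :=
      incBeta_mono (by linarith) (div_nonneg (by linarith) (by linarith)) hcon.le hv1
    have h2 := mul_beta_le_incBeta_studentPoint hm
    rw [stdStudentTail, div_lt_iff₀ (by positivity)] at hlt
    linarith

theorem proposition1 :
    -- Generalised Gaussian family: standardisation, kurtosis formula and its strict decrease.
    (∀ β : ℝ, 0 < β → IsStandardised (ggdLaw β) ∧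
      kurtosis (ggdLaw β) =
        Real.Gamma (5 / β) * Real.Gamma (1 / β) / Real.Gamma (3 / β) ^ 2) ∧
    StrictAntiOn (fun β => kurtosis (ggdLaw β)) (Set.Ioi 0) ∧
    -- A uniform threshold on every compact range of shapes.
    (∀ b₁ b₂ : ℝ, 0 < b₁ → b₁ ≤ b₂ → ∃ τstar : ℝ, 0 < τstar ∧
      ∀ τ ∈ Set.Ioo 0 τstar, TailRadiusStrictMonoInKurtosis ggdLaw (Set.Icc b₁ b₂) τ) ∧
    -- On the shape range `[1/2, 50]` the threshold exceeds `0.02`.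
    (∃ τstar : ℝ, 0.02 < τstar ∧
      ∀ τ ∈ Set.Ioo 0 τstar, TailRadiusStrictMonoInKurtosis ggdLaw (Set.Icc (1 / 2) 50) τ) ∧
    -- Student-t family: standardisation, kurtosis formula and its strict decrease.
    (∀ ν : ℝ, 4 < ν → IsStandardised (stdStudentLaw ν) ∧
      kurtosis (stdStudentLaw ν) = 3 + 6 / (ν - 4)) ∧
    StrictAntiOn (fun ν => kurtosis (stdStudentLaw ν)) (Set.Ioi 4) ∧
    -- One threshold, exceeding `0.02`, for all `ν > 4`.
    (∃ τstar : ℝ, 0.02 < τstar ∧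
      ∀ τ ∈ Set.Ioo 0 τstar, TailRadiusStrictMonoInKurtosis stdStudentLaw (Set.Ioi 4) τ) :=
  ⟨fun _ hβ => isStandardised_ggdLaw hβ, strictAntiOn_kurtosis_ggdLaw,
    fun _ _ hb hb₂ => exists_threshold_ggdLaw hb hb₂,
    ⟨0.0202, by norm_num, fun _ hτ => tailRadiusStrictMono_ggdLaw_half_fifty hτ⟩,
    fun _ hν => isStandardised_stdStudentLaw hν, strictAntiOn_kurtosis_stdStudentLaw,
    ⟨0.0202, by norm_num, fun _ hτ => tailRadiusStrictMono_stdStudentLaw hτ⟩⟩
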